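/- Fix constants $\sigma^2,\gamma^2\ge 0$, $c>0$ and $a$. There are constants $C_1,C_2>0$, depending only on $\sigma^2,\gamma^2,c,a$, such that the following holds for all integers $M\ge 1$, $1\le k\le d$ and $n_1,\dots,n_M\ge 2$; write $N=\sum_{i=1}^M n_i$. For $i\in[M]$, $j\in[n_i]$ let $(x_{ij},y_{ij})\in\mathbb R^d\times\mathbb R$ be random pairs, independent across all $(i,j)$, with $\mathbb E[y_{ij}\mid x_{ij}]=x_{ij}^\top\theta_i^\star$, where $\theta_i^\star\in\mathbb R^d$ is deterministic. (A real random variable $X$ is called sub-gaussian with variance proxy $v$ if $\mathbb E\,e^{t(X-\mathbb EX)}\le e^{vt^2/2}$ for all $t\in\mathbb R$; a random vector is, if all its projections on unit vectors are.) Assume: 1. The noise variables $\xi_{ij}=y_{ij}-x_{ij}^\top\theta_i^\star$ have mean zero, are sub-gaussian with variance proxy $\sigma^2$, and $\xi_{ij}$ is independent of $x_{ij}$. 2. The covariates $x_{ij}$ have mean zero and are sub-gaussian with variance proxy $\gamma^2$; the matrix $\Gamma_i=\mathbb E[x_{ij}x_{ij}^\top]$ does not depend on $j$, and its smallest eigenvalue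 is at least $c$. (Its largest eigenvalue is then at most $\gamma^2$, so that its condition number is at most $\gamma^2/c$.) 3. There are $B^\star\in\mathbb R^{d\times k}$ with $(B^\star)^\top B^\star=I_k$ and $\alpha_i^\star\in\mathbb R^k$ such that $\Gamma_i\theta_i^\star=B^\star\alpha_i^\star$ for all $i$. 4. $\|\alpha_i^\star\|\le a$ for all $i$. Let $\lambda_1\ge\dots\ge\lambda_k$ be the eigenvalues of $D=\frac1N\sum_{i=1}^M n_i\alpha_i^\star(\alpha_i^\star)^\top$, and assume $\lambda_k>0$. With $m_i=\lfloor n_i/2\rfloor$ define $$\bar z_i=\frac1{m_i}\sum_{j=1}^{m_i}y_{ij}x_{ij},\qquad \tilde z_i=\frac1{n_i-m_i}\sum_{j=m_i+1}^{n_i}y_{ij}x_{ij},\qquad Z=\sum_{i=1}^M n_i\,\bar z_i\tilde z_i^\top ,$$ and let $\widehat B\in\mathbb R^{d\times k}$ consist of top-$k$ right singular vectors of $Z$, or of top-$k$ left singular vectors of $Z$ (any orthonormal choice). Let $\|\sin\Theta(\widehat B,B^\star)\|=\|\widehat B\widehat B^\top-B^\star(B^\star)^\top\|$, in spectral norm.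 Then, with probability at least $1-C_2(d+N)^{-10}$, $$\|\sin\Theta(\widehat B,B^\star)\|\le C_1\left(\sqrt{\frac{d\lambda_1}{N\lambda_k^2}}+\sqrt{\frac{Md}{N^2\lambda_k^2}}\right)\log^3(d+N).$$ -/

import Mathlib

open MeasureTheory ProbabilityTheory
open scoped NNReal Matrix

noncomputable section

namespace SharedRep

/-- A real random variable is sub-gaussian with variance proxy `v`:
`E[exp (t (X - E X))] ≤ exp (v t ^ 2 / 2)` for all real `t` (the exponentials being integrable). -/
def IsSubG {Ω : Type*} [MeasurableSpace Ω] (X : Ω → ℝ) (v : ℝ≥0) (μ : Measure Ω) : Prop :=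
  HasSubgaussianMGF (fun ω => X ω - ∫ ω', X ω' ∂μ) v μ

/-- A random vector is sub-gaussian with variance proxy `v` if all its one-dimensional
projections along unit vectors are. -/
def IsSubGVec {Ω : Type*} [MeasurableSpace Ω] {d : ℕ} (X : Ω → EuclideanSpace ℝ (Fin d))
    (v : ℝ≥0) (μ : Measure Ω) : Prop :=
  ∀ u : EuclideanSpace ℝ (Fin d), ‖u‖ = 1 → IsSubG (fun ω => inner ℝ u (X ω)) v μ

/-- The second-moment matrix `E[X Xᵀ]`. -/
def secondMoment {Ω : Type*} [MeasurableSpace Ω] {d : ℕ} (X : Ω → EuclideanSpace ℝ (Fin d))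
    (μ : Measure Ω) : Matrix (Fin d) (Fin d) ℝ :=
  Matrix.of fun a b => ∫ ω, X ω a * X ω b ∂μ

/-- The total number of samples `N = ∑ i, n i`. -/
def totalSamples {M : ℕ} (n : Fin M → ℕ) : ℕ := ∑ i, n i

/-- The client diversity matrix `D = (1 / N) ∑ i, n i • α i (α i)ᵀ`. -/
def diversity {M k : ℕ} (n : Fin M → ℕ) (α : Fin M → EuclideanSpace ℝ (Fin k)) :
    Matrix (Fin k) (Fin k) ℝ :=
  (totalSamples n : ℝ)⁻¹ • ∑ i, (n i : ℝ) • Matrix.vecMulVec (α i).ofLp (α i).ofLp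

theorem diversity_isHermitian {M k : ℕ} (n : Fin M → ℕ)
    (α : Fin M → EuclideanSpace ℝ (Fin k)) : (diversity n α).IsHermitian := by
  ext a b
  simp [diversity, Matrix.sum_apply, Matrix.vecMulVec_apply, mul_comm]

/-- The eigenvalues of `D` in decreasing order: `diversityEigenvalue n α r` is the `(r + 1)`-th
largest eigenvalue, counted with multiplicity. -/
def diversityEigenvalue {M k : ℕ} (n : Fin M → ℕ) (α : Fin M → EuclideanSpace ℝ (Fin k))
    (r : Fin k) : ℝ :=
  (diversity_isHermitian n α).eigenvalues₀ (Fin.cast (Fintype.card_fin k).symm r)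

/-- The principal angle distance `‖sin Θ(B, B')‖ = ‖B Bᵀ - B' B'ᵀ‖` (spectral norm). -/
def sinTheta {d k : ℕ} (B B' : Matrix (Fin d) (Fin k) ℝ) : ℝ :=
  ‖Matrix.toEuclideanCLM (n := Fin d) (𝕜 := ℝ) (B * Bᵀ - B' * B'ᵀ)‖

/-- `B` consists of top-`k` right singular vectors, or of top-`k` left singular vectors, of `Z`:
it is formed by the first `k` columns of the right or of the left orthogonal factor in some
singular value decomposition `Z = U diag(s) Vᵀ` with decreasing nonnegative `s`. -/
def IsTopSingular {d k : ℕ} (hkd : k ≤ d) (Z : Matrix (Fin d) (Fin d) ℝ)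
    (B : Matrix (Fin d) (Fin k) ℝ) : Prop :=
  ∃ (U V : Matrix (Fin d) (Fin d) ℝ) (s : Fin d → ℝ),
    Uᵀ * U = 1 ∧ Vᵀ * V = 1 ∧ Antitone s ∧ (∀ r, 0 ≤ s r) ∧
    Z = U * Matrix.diagonal s * Vᵀ ∧
    (B = V.submatrix id (Fin.castLE hkd) ∨ B = U.submatrix id (Fin.castLE hkd))

/-- The local average of `y x` over the first `⌊n / 2⌋` samples of a client. -/
def firstHalfAvg {d n : ℕ} (x : Fin n → EuclideanSpace ℝ (Fin d)) (y : Fin n → ℝ) :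
    EuclideanSpace ℝ (Fin d) :=
  ((n / 2 : ℕ) : ℝ)⁻¹ • ∑ j : Fin n with j.val < n / 2, y j • x j

/-- The local average of `y x` over the remaining `n - ⌊n / 2⌋` samples of a client. -/
def secondHalfAvg {d n : ℕ} (x : Fin n → EuclideanSpace ℝ (Fin d)) (y : Fin n → ℝ) :
    EuclideanSpace ℝ (Fin d) :=
  ((n - n / 2 : ℕ) : ℝ)⁻¹ • ∑ j : Fin n with n / 2 ≤ j.val, y j • x j

/-- `Z = ∑ i, n i • z̄ i (z̃ i)ᵀ`, computed from the data. -/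
def estimatorMatrix {M d : ℕ} (n : Fin M → ℕ)
    (x : (i : Fin M) → Fin (n i) → EuclideanSpace ℝ (Fin d))
    (y : (i : Fin M) → Fin (n i) → ℝ) : Matrix (Fin d) (Fin d) ℝ :=
  ∑ i, (n i : ℝ) •
    Matrix.vecMulVec (firstHalfAvg (x i) (y i)).ofLp (secondHalfAvg (x i) (y i)).ofLp

/-- The noise `y - ⟨x, θ⟩`. -/
def noise {Ω : Type*} {d : ℕ} (θ : EuclideanSpace ℝ (Fin d))
    (x : Ω → EuclideanSpace ℝ (Fin d)) (y : Ω → ℝ) (ω : Ω) : ℝ :=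
  y ω - inner ℝ (x ω) θ

/-- The linear regression model with shared representation: `M` clients, `n i` samples
`(x i j, y i j)` at client `i`, sub-gaussian noise (proxy `σ2`) and covariates (proxy `γ2`),
second-moment matrices `Γ i` with smallest eigenvalue at least `c`, and parameters satisfying
`Γ i θ i = B α i` with `‖α i‖ ≤ a`. (The largest eigenvalue of `Γ i` is at most `γ2`, by
sub-gaussianity of the covariates.) -/
structure Model {Ω : Type*} [MeasurableSpace Ω] (μ : Measure Ω) (σ2 γ2 : ℝ≥0) (c a : ℝ)
    {M d k : ℕ} (n : Fin M → ℕ)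
    (x : (i : Fin M) → Fin (n i) → Ω → EuclideanSpace ℝ (Fin d))
    (y : (i : Fin M) → Fin (n i) → Ω → ℝ)
    (Γ : Fin M → Matrix (Fin d) (Fin d) ℝ) (θ : Fin M → EuclideanSpace ℝ (Fin d))
    (B : Matrix (Fin d) (Fin k) ℝ) (α : Fin M → EuclideanSpace ℝ (Fin k)) : Prop where
  measurable_x : ∀ i j, Measurable (x i j)
  measurable_y : ∀ i j, Measurable (y i j)
  /-- `E[y | x] = ⟨x, θ⟩`. -/
  regression : ∀ i j,
    condExp (MeasurableSpace.comap (x i j) inferInstance) μ (y i j)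
      =ᵐ[μ] fun ω => inner ℝ (x i j ω) (θ i)
  /-- The samples are independent across all clients and all data points. -/
  indep_samples : iIndepFun (fun (p : (i : Fin M) × Fin (n i)) ω =>
    (x p.1 p.2 ω, y p.1 p.2 ω)) μ
  /-- The noise is independent of the covariates (with `indep_samples`, jointly so). -/
  indep_noise : ∀ i j, IndepFun (noise (θ i) (x i j) (y i j)) (x i j) μ
  noise_mean : ∀ i j, ∫ ω, noise (θ i) (x i j) (y i j) ω ∂μ = 0
  noise_subG : ∀ i j, IsSubG (noise (θ i) (x i j) (y i j)) σ2 μ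
  x_mean : ∀ i j, ∫ ω, x i j ω ∂μ = 0
  x_subG : ∀ i j, IsSubGVec (x i j) γ2 μ
  x_secondMoment : ∀ i j, secondMoment (x i j) μ = Γ i
  Γ_lower : ∀ i, (Γ i - c • (1 : Matrix (Fin d) (Fin d) ℝ)).PosSemidef
  B_orthonormal : Bᵀ * B = 1
  low_rank : ∀ i, Γ i *ᵥ (θ i).ofLp = B *ᵥ (α i).ofLp
  α_bound : ∀ i, ‖α i‖ ≤ a

end SharedRep

end

/-! Put `w i = B α i = Γ i θ i`. The residual `y x - w i` of a sample has mean zero, because the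
noise is centred and independent of the covariates. Its projections on unit vectors are
sub-exponential with constants depending only on σ², γ², c, a, since ‖θ i‖ ≤ a / c. The two half
averages of a client are independent, so `Z` has mean `N B D Bᵀ`. The leading singular subspaces of
this matrix, left and right, are the range of `B`, and its k-th singular value is N λ_k. The `sin Θ`
bound `sinTheta_le` therefore reduces the theorem to the size of `Z - N B D Bᵀ`, which
`estimatorMatrix_sub_eq` splits into two linear terms and a quadratic one.

A linear term is a sum of residuals times fixed multiples of the `w i`. Its variance in a direction
v is of order ∑ n_i ⟨w_i, v⟩² ≤ N λ₁. With L = log (d + N), a scalar Chernoff bound and a net of the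
unit ball give √(d N λ₁) L, provided d ≤ N λ₁ (`measureReal_norm_sum_vecMulVec_le`).

The quadratic term is ∑ A_i F_iᵀ, where A_i and F_i are the fluctuations of the two halves scaled by
√n_i: independent, centred, and sub-exponential at a scale free of n_i. Both factors are truncated
at radius of order √d L, and a matrix Bernstein inequality is applied to symmetric dilations of the
products; it rests on the Golden–Thompson inequality. The outcome is √(d (M + d)) L³
(`measureReal_norm_sum_vecMulVec_indep_le`).

If d ≤ N λ₁, the part √(d · d) is at most √(d N λ₁), and division by N λ_k gives the rate. If d > N
λ₁, then λ_k ≤ λ₁ makes the first summand of the rate at least 1, while `sin Θ` never exceeds 2, so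
the claim is trivial. -/

noncomputable section
open Filter Topology

/-! ### The Lie product formula -/

namespace NormedSpace

variable {𝔸 : Type*} [NormedRing 𝔸] [NormedAlgebra ℝ 𝔸] [CompleteSpace 𝔸] [NormOneClass 𝔸]

theorem norm_exp_le_exp_norm (x : 𝔸) : ‖exp x‖ ≤ Real.exp ‖x‖ := by
  have h1 := exp_series_hasSum_exp' (𝕂 := ℝ) x
  have h2 := exp_series_hasSum_exp' (𝕂 := ℝ) (‖x‖ : ℝ)
  rw [← Real.exp_eq_exp_ℝ] at h2
  rw [← h1.tsum_eq]
  refine tsum_of_norm_bounded h2 fun n => ?_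
  rw [norm_smul, norm_inv, RCLike.norm_natCast, smul_eq_mul]
  gcongr
  exact norm_pow_le _ _

/-- The Lie product formula. -/
theorem tendsto_exp_mul_exp_pow (A B : 𝔸) :
    Tendsto (fun n : ℕ => (exp ((n : ℝ)⁻¹ • A) * exp ((n : ℝ)⁻¹ • B)) ^ n) atTop
      (𝓝 (exp (A + B))) := by
  let _ : NormedAlgebra ℚ 𝔸 := NormedAlgebra.restrictScalars ℚ ℝ 𝔸
  -- The defect `f` vanishes to first order at 0, so n · f(1/n) tends to 0. Telescoping the
  -- difference of n-th powers costs only a factor n and the bounded factor `K`.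
  set f : ℝ → 𝔸 := fun t => exp (t • A) * exp (t • B) - exp (t • (A + B)) with hf
  have hd : HasDerivAt f 0 0 := by
    have hA := hasDerivAt_exp_smul_const (𝕂 := ℝ) A (0 : ℝ)
    have hB := hasDerivAt_exp_smul_const (𝕂 := ℝ) B (0 : ℝ)
    have hC := hasDerivAt_exp_smul_const (𝕂 := ℝ) (A + B) (0 : ℝ)
    exact ((hA.mul hB).sub hC).congr_deriv (by simp)
  have hf0 : f 0 = 0 := by simp [hf]
  have hlim : Tendsto (fun n : ℕ => ‖(n : ℝ) • f ((n : ℝ)⁻¹)‖) atTop (𝓝 0) := by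
    have h1 := hd.tendsto_slope_zero
    have h2 : Tendsto (fun n : ℕ => ((n : ℝ)⁻¹)) atTop (𝓝[≠] 0) := by
      refine tendsto_nhdsWithin_iff.2 ⟨tendsto_inv_atTop_nhds_zero_nat, ?_⟩
      filter_upwards [eventually_gt_atTop 0] with n hn
      have : (n : ℝ) ≠ 0 := by positivity
      simpa using this
    have h3 := (h1.comp h2).norm
    simpa [Function.comp_def, hf0] using h3
  set K : ℝ := Real.exp (‖A‖ + ‖B‖) with hK
  -- The correction at n = 0 makes the estimate valid for every n, so that a plain squeeze applies.
  have hbound : ∀ n : ℕ, ‖(exp ((n : ℝ)⁻¹ • A) * exp ((n : ℝ)⁻¹ • B)) ^ n - exp (A + B)‖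
      ≤ K * ‖(n : ℝ) • f ((n : ℝ)⁻¹)‖ + if n = 0 then ‖(1 : 𝔸) - exp (A + B)‖ else 0 := by
    intro n
    rcases Nat.eq_zero_or_pos n with rfl | hn
    · simp
    have hn' : (n : ℝ) ≠ 0 := by positivity
    rw [if_neg hn.ne', add_zero]
    set x := exp ((n : ℝ)⁻¹ • A) * exp ((n : ℝ)⁻¹ • B) with hx
    set y := exp ((n : ℝ)⁻¹ • (A + B)) with hy
    set q : ℝ := Real.exp ((n : ℝ)⁻¹ * (‖A‖ + ‖B‖)) with hq
    have hq1 : 1 ≤ q := Real.one_le_exp (by positivity)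
    have hxq : ‖x‖ ≤ q := by
      refine (norm_mul_le _ _).trans ?_
      rw [hq, mul_add, Real.exp_add]
      gcongr
      · refine (norm_exp_le_exp_norm _).trans (Real.exp_le_exp.2 ?_)
        rw [norm_smul, norm_inv, RCLike.norm_natCast]
      · refine (norm_exp_le_exp_norm _).trans (Real.exp_le_exp.2 ?_)
        rw [norm_smul, norm_inv, RCLike.norm_natCast]
    have hyq : ‖y‖ ≤ q := by
      refine (norm_exp_le_exp_norm _).trans (Real.exp_le_exp.2 ?_)
      rw [norm_smul, norm_inv, RCLike.norm_natCast]
      gcongr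
      exact norm_add_le _ _
    have hyn : exp (A + B) = y ^ n := by
      rw [hy, ← exp_nsmul, ← Nat.cast_smul_eq_nsmul ℝ, smul_smul, mul_inv_cancel₀ hn', one_smul]
    have hqn : q ^ n = K := by
      rw [hq, ← Real.exp_nat_mul, ← mul_assoc, mul_inv_cancel₀ hn', one_mul]
    have htel : ∀ m : ℕ, ‖x ^ m - y ^ m‖ ≤ m * (q ^ m * ‖x - y‖) := by
      intro m
      induction m with
      | zero => simp
      | succ m ih =>
        have : x ^ (m + 1) - y ^ (m + 1) = (x ^ m - y ^ m) * x + y ^ m * (x - y) := by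
          rw [pow_succ, pow_succ]; noncomm_ring
        rw [this]
        calc ‖(x ^ m - y ^ m) * x + y ^ m * (x - y)‖
            ≤ ‖x ^ m - y ^ m‖ * ‖x‖ + ‖y ^ m‖ * ‖x - y‖ :=
              (norm_add_le _ _).trans (add_le_add (norm_mul_le _ _) (norm_mul_le _ _))
          _ ≤ (m * (q ^ m * ‖x - y‖)) * q + q ^ (m + 1) * ‖x - y‖ := by
              gcongr
              calc ‖y ^ m‖ ≤ ‖y‖ ^ m := norm_pow_le _ _
                _ ≤ q ^ m := by gcongr
                _ ≤ q ^ (m + 1) := pow_le_pow_right₀ hq1 (Nat.le_succ m)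
          _ = _ := by push_cast; ring
    rw [hyn]
    refine (htel n).trans ?_
    rw [hqn, norm_smul, RCLike.norm_natCast]
    apply le_of_eq
    simp only [hf, hx, hy]
    ring
  rw [tendsto_iff_norm_sub_tendsto_zero]
  refine squeeze_zero (fun _ => norm_nonneg _) hbound ?_
  have h0 : Tendsto (fun n : ℕ => if n = 0 then ‖(1 : 𝔸) - exp (A + B)‖ else 0) atTop (𝓝 0) := by
    refine tendsto_const_nhds.congr' ?_
    filter_upwards [eventually_gt_atTop 0] with n hn
    rw [if_neg hn.ne']
  simpa using (hlim.const_mul K).add h0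

end NormedSpace

/-! ### The Golden–Thompson inequality -/

namespace Matrix

variable {n : Type*} [Fintype n]

theorem trace_transpose_mul_self_nonneg (A : Matrix n n ℝ) : 0 ≤ (Aᵀ * A).trace := by
  simp only [trace, diag, mul_apply, transpose_apply]
  exact Finset.sum_nonneg fun _ _ => Finset.sum_nonneg fun _ _ => mul_self_nonneg _

/-- Expand the squared Frobenius norm of Pᵀ - Q. -/
theorem two_mul_trace_mul_le (P Q : Matrix n n ℝ) :
    2 * (P * Q).trace ≤ (P * Pᵀ).trace + (Qᵀ * Q).trace := by
  have h := trace_transpose_mul_self_nonneg (Pᵀ - Q)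
  have h1 : (Qᵀ * Pᵀ).trace = (P * Q).trace := by
    rw [← trace_transpose, transpose_mul, transpose_transpose, transpose_transpose]
  simp only [transpose_sub, transpose_transpose, sub_mul, mul_sub, trace_sub] at h
  linarith

variable [DecidableEq n]

theorem trace_sq_le (M : Matrix n n ℝ) : (M ^ 2).trace ≤ (Mᵀ * M).trace := by
  have h := two_mul_trace_mul_le M M
  rw [trace_mul_comm M Mᵀ] at h
  rw [pow_two]
  linarith

theorem trace_mul_pow_comm (A B : Matrix n n ℝ) (k : ℕ) :
    ((A * B) ^ k).trace = ((B * A) ^ k).trace := by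
  cases k with
  | zero => simp
  | succ k =>
    have h : SemiconjBy A (B * A) (A * B) := by
      simp [SemiconjBy, Matrix.mul_assoc]
    have hk : A * (B * A) ^ k = (A * B) ^ k * A := h.pow_right k
    rw [pow_succ, ← Matrix.mul_assoc, ← hk, Matrix.mul_assoc, trace_mul_comm, Matrix.mul_assoc,
      ← pow_succ]

/-- Golden's trace inequality `tr (PQ)^m ≤ tr P^m Q^m` for `m` a power of two. -/
theorem trace_mul_pow_two_pow_le (j : ℕ) (P Q : Matrix n n ℝ) (hP : Pᵀ = P) (hQ : Qᵀ = Q) :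
    ((P * Q) ^ 2 ^ j).trace ≤ (P ^ 2 ^ j * Q ^ 2 ^ j).trace := by
  induction j using Nat.strong_induction_on generalizing P Q with
  | _ j ih =>
  -- By cyclicity the left trace is that of ((N Nᵀ)(Nᵀ N))^(2^i), to which the induction hypothesis
  -- applies. The resulting tr (PQ) is at most the mean of tr P² and tr Q², and these agree because
  -- N Nᵀ and Nᵀ N have equal power traces.
  have step : ∀ i < j, ∀ N : Matrix n n ℝ,
      ((((N ^ 2)ᵀ * N ^ 2)) ^ 2 ^ i).trace ≤ ((Nᵀ * N) ^ 2 ^ (i + 1)).trace := by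
    intro i hi N
    have e1 : (((N ^ 2)ᵀ * N ^ 2) ^ 2 ^ i).trace = (((N * Nᵀ) * (Nᵀ * N)) ^ 2 ^ i).trace := by
      rw [show (N ^ 2)ᵀ * N ^ 2 = (Nᵀ * Nᵀ * N) * N by
        simp only [pow_two, transpose_mul, Matrix.mul_assoc], trace_mul_pow_comm]
      simp only [Matrix.mul_assoc]
    rw [e1]
    have hs1 : (N * Nᵀ)ᵀ = N * Nᵀ := by simp
    have hs2 : (Nᵀ * N)ᵀ = Nᵀ * N := by simp
    refine (ih i hi _ _ hs1 hs2).trans ?_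
    have h := two_mul_trace_mul_le ((N * Nᵀ) ^ 2 ^ i) ((Nᵀ * N) ^ 2 ^ i)
    rw [transpose_pow, transpose_pow, hs1, hs2, ← pow_add, ← pow_add, ← two_mul, ← pow_succ',
      trace_mul_pow_comm N] at h
    linarith
  rcases j with _ | j
  · simp
  -- Each use of `step` halves the inner exponent and doubles the outer one, ending at a power of Mᵀ
  -- M.
  have chain : ∀ i ≤ j, ∀ M : Matrix n n ℝ, ((M ^ 2 ^ (j + 1))).trace ≤
      (((M ^ 2 ^ (j - i))ᵀ * M ^ 2 ^ (j - i)) ^ 2 ^ i).trace := by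
    intro i hi M
    induction i with
    | zero =>
      have := trace_sq_le (M ^ 2 ^ j)
      rw [← pow_mul, ← pow_succ] at this
      simpa using this
    | succ i ihi =>
      refine (ihi (by omega)).trans ?_
      have := step i (by omega) (M ^ 2 ^ (j - (i + 1)))
      rwa [← pow_mul, ← pow_succ, show j - (i + 1) + 1 = j - i by omega] at this
  have h1 := chain j le_rfl (P * Q)
  rw [Nat.sub_self, pow_zero, pow_one, transpose_mul, hP, hQ] at h1
  -- For M = PQ with P, Q symmetric, Mᵀ M = Q P² Q is cyclically P² Q², so the induction hypothesis
  -- for the pair P², Q² finishes.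
  have h2 : ((Q * P * (P * Q)) ^ 2 ^ j).trace = ((P ^ 2 * Q ^ 2) ^ 2 ^ j).trace := by
    rw [show Q * P * (P * Q) = Q * (P ^ 2 * Q) by simp only [pow_two, Matrix.mul_assoc],
      trace_mul_pow_comm]
    simp only [pow_two, Matrix.mul_assoc]
  rw [h2] at h1
  have h3 := ih j (Nat.lt_succ_self j) (P ^ 2) (Q ^ 2) (by rw [transpose_pow, hP])
    (by rw [transpose_pow, hQ])
  rw [← pow_mul, ← pow_mul, ← pow_succ'] at h3
  exact h1.trans h3

open scoped Matrix.Norms.L2Operator in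
/-- The **Golden–Thompson inequality** for real symmetric matrices. -/
theorem trace_exp_add_le (A B : Matrix n n ℝ) (hA : Aᵀ = A) (hB : Bᵀ = B) :
    (NormedSpace.exp (A + B)).trace ≤ (NormedSpace.exp A * NormedSpace.exp B).trace := by
  cases isEmpty_or_nonempty n
  · simp [trace]
  -- Only exponents 2^j are available in Golden's inequality, so the product formula is used along
  -- that subsequence. With P = exp (2^(-j) A) and Q = exp (2^(-j) B) the upper bound does not
  -- depend on j.
  have hlim := (NormedSpace.tendsto_exp_mul_exp_pow A B).comp
    (tendsto_pow_atTop_atTop_of_one_lt (one_lt_two : (1 : ℕ) < 2))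
  have htr : Continuous fun M : Matrix n n ℝ => M.trace := continuous_id.matrix_trace
  refine le_of_tendsto ((htr.tendsto _).comp hlim) (Eventually.of_forall fun j => ?_)
  have hsymm : ∀ (t : ℝ) (M : Matrix n n ℝ), Mᵀ = M →
      (NormedSpace.exp (t • M))ᵀ = NormedSpace.exp (t • M) := by
    intro t M hM
    rw [← exp_transpose, transpose_smul, hM]
  have hroot : ∀ M : Matrix n n ℝ,
      (NormedSpace.exp (((2 ^ j : ℕ) : ℝ)⁻¹ • M)) ^ 2 ^ j = NormedSpace.exp M := by
    intro M
    rw [← exp_nsmul, ← Nat.cast_smul_eq_nsmul ℝ, smul_smul, mul_inv_cancel₀ (by positivity),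
      one_smul]
  have := trace_mul_pow_two_pow_le j _ _ (hsymm (((2 ^ j : ℕ) : ℝ)⁻¹) A hA)
    (hsymm (((2 ^ j : ℕ) : ℝ)⁻¹) B hB)
  rw [hroot, hroot] at this
  exact this

end Matrix
end

/-! ### Quadratic forms and traces of exponentials of symmetric matrices -/

noncomputable section
namespace Matrix

variable {n : Type*} [Fintype n]

theorem dotProduct_conj_mulVec (U M : Matrix n n ℝ) (w : n → ℝ) :
    w ⬝ᵥ ((U * M * Uᵀ) *ᵥ w) = (Uᵀ *ᵥ w) ⬝ᵥ (M *ᵥ (Uᵀ *ᵥ w)) := by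
  rw [mulVec_transpose, ← mulVec_mulVec, ← mulVec_mulVec, dotProduct_mulVec, mulVec_transpose]

variable [DecidableEq n]

theorem exists_orthogonal_diagonalization {A : Matrix n n ℝ} (hA : Aᵀ = A) :
    ∃ (U : Matrix n n ℝ) (l : n → ℝ), Uᵀ * U = 1 ∧ U * Uᵀ = 1 ∧ A = U * diagonal l * Uᵀ := by
  have hH : A.IsHermitian := by rwa [IsHermitian, conjTranspose_eq_transpose_of_trivial]
  refine ⟨hH.eigenvectorUnitary, hH.eigenvalues, ?_, ?_, ?_⟩
  · rw [← conjTranspose_eq_transpose_of_trivial]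
    exact Unitary.coe_star_mul_self hH.eigenvectorUnitary
  · rw [← conjTranspose_eq_transpose_of_trivial]
    exact Unitary.coe_mul_star_self hH.eigenvectorUnitary
  · conv_lhs => rw [hH.spectral_theorem, Unitary.conjStarAlgAut_apply]
    rw [star_eq_conjTranspose, conjTranspose_eq_transpose_of_trivial]
    rfl

theorem exp_orthogonal_conj {U : Matrix n n ℝ} (h : Uᵀ * U = 1) (l : n → ℝ) :
    NormedSpace.exp (U * diagonal l * Uᵀ) = U * diagonal (fun i => Real.exp (l i)) * Uᵀ := by
  have hinv : U⁻¹ = Uᵀ := inv_eq_left_inv h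
  have hU : IsUnit U := IsUnit.of_mul_eq_one_right _ h
  rw [← hinv, exp_conj U _ hU, exp_diagonal]
  congr 3
  ext i
  rw [Pi.coe_exp, Real.exp_eq_exp_ℝ]

theorem dotProduct_conj_diagonal_mulVec (U : Matrix n n ℝ) (l w : n → ℝ) :
    w ⬝ᵥ ((U * diagonal l * Uᵀ) *ᵥ w) = ∑ i, l i * (Uᵀ *ᵥ w) i ^ 2 := by
  rw [dotProduct_conj_mulVec, dotProduct]
  refine Finset.sum_congr rfl fun i _ => ?_
  rw [mulVec_diagonal]
  ring

theorem dotProduct_self_eq_sum_sq {U : Matrix n n ℝ} (h : U * Uᵀ = 1) (w : n → ℝ) :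
    w ⬝ᵥ w = ∑ i, (Uᵀ *ᵥ w) i ^ 2 := by
  have := dotProduct_conj_diagonal_mulVec U (fun _ => 1) w
  simpa [h] using this

/-- The scalar inequality e^x ≤ 1 + x + x² for x ≤ 1, applied at each eigenvalue; `h1` says that A
is a contraction, which keeps the eigenvalues at most 1. -/
theorem dotProduct_exp_mulVec_le {A : Matrix n n ℝ} (hA : Aᵀ = A)
    (h1 : ∀ w, (A *ᵥ w) ⬝ᵥ (A *ᵥ w) ≤ w ⬝ᵥ w) (w : n → ℝ) :
    w ⬝ᵥ (NormedSpace.exp A *ᵥ w) ≤ w ⬝ᵥ w + w ⬝ᵥ (A *ᵥ w) + (A *ᵥ w) ⬝ᵥ (A *ᵥ w) := by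
  obtain ⟨U, l, hU, hU', hAU⟩ := exists_orthogonal_diagonalization hA
  have hsq : ∀ w, (A *ᵥ w) ⬝ᵥ (A *ᵥ w) = ∑ i, l i ^ 2 * (Uᵀ *ᵥ w) i ^ 2 := by
    intro w
    have e : (A *ᵥ w) ⬝ᵥ (A *ᵥ w) = w ⬝ᵥ ((A * A) *ᵥ w) := by
      rw [← mulVec_mulVec, dotProduct_mulVec w, ← mulVec_transpose, hA]
    have e2 : A * A = U * diagonal (fun i => l i ^ 2) * Uᵀ := by
      rw [hAU]
      calc U * diagonal l * Uᵀ * (U * diagonal l * Uᵀ)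
          = U * diagonal l * (Uᵀ * U) * diagonal l * Uᵀ := by simp only [Matrix.mul_assoc]
        _ = _ := by
          rw [hU, Matrix.mul_one, Matrix.mul_assoc U, diagonal_mul_diagonal]
          simp only [pow_two]
    rw [e, e2, dotProduct_conj_diagonal_mulVec]
  have hl : ∀ i, l i ≤ 1 := by
    intro i
    have h := h1 (U *ᵥ Pi.single i 1)
    rw [hsq, dotProduct_self_eq_sum_sq hU', mulVec_mulVec, hU, one_mulVec] at h
    simp [Pi.single_apply, ite_pow] at h
    exact (abs_le.1 h).2
  rw [hsq, dotProduct_self_eq_sum_sq hU']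
  conv_lhs => rw [hAU, exp_orthogonal_conj hU, dotProduct_conj_diagonal_mulVec]
  rw [hAU, dotProduct_conj_diagonal_mulVec, ← Finset.sum_add_distrib, ← Finset.sum_add_distrib]
  refine Finset.sum_le_sum fun i _ => ?_
  have hexp : ∀ x : ℝ, x ≤ 1 → Real.exp x ≤ 1 + x + x ^ 2 := by
    intro x hx
    rcases le_or_gt (-1) x with h | h
    · have := (abs_le.1 (Real.abs_exp_sub_one_sub_id_le (abs_le.2 ⟨h, hx⟩))).2
      linarith
    · have : Real.exp x ≤ 1 := Real.exp_le_one_iff.2 (by linarith)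
      nlinarith
  nlinarith [hexp (l i) (hl i), sq_nonneg ((Uᵀ *ᵥ w) i)]

/-- The Rayleigh quotient is at most the top eigenvalue, whose exponential is one of the positive
summands of the trace. -/
theorem exp_dotProduct_mulVec_le_trace {A : Matrix n n ℝ} (hA : Aᵀ = A) {w : n → ℝ}
    (hw : w ⬝ᵥ w = 1) : Real.exp (w ⬝ᵥ (A *ᵥ w)) ≤ (NormedSpace.exp A).trace := by
  obtain ⟨U, l, hU, hU', hAU⟩ := exists_orthogonal_diagonalization hA
  rw [dotProduct_self_eq_sum_sq hU'] at hw
  have hn : Nonempty n := by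
    by_contra h
    rw [not_nonempty_iff] at h
    simp at hw
  obtain ⟨i, hi⟩ := Finite.exists_max l
  have h1 : w ⬝ᵥ (A *ᵥ w) ≤ l i := by
    rw [hAU, dotProduct_conj_diagonal_mulVec, ← mul_one (l i), ← hw, Finset.mul_sum]
    exact Finset.sum_le_sum fun j _ => mul_le_mul_of_nonneg_right (hi j) (sq_nonneg _)
  have h2 : (NormedSpace.exp A).trace = ∑ j, Real.exp (l j) := by
    rw [hAU, exp_orthogonal_conj hU, trace_mul_comm, ← Matrix.mul_assoc, hU, Matrix.one_mul,
      trace_diagonal]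
  rw [h2]
  exact (Real.exp_le_exp.2 h1).trans
    (Finset.single_le_sum (fun j _ => (Real.exp_pos (l j)).le) (Finset.mem_univ i))

theorem dotProduct_exp_mulVec_nonneg {A : Matrix n n ℝ} (hA : Aᵀ = A) (w : n → ℝ) :
    0 ≤ w ⬝ᵥ (NormedSpace.exp A *ᵥ w) := by
  obtain ⟨U, l, hU, hU', hAU⟩ := exists_orthogonal_diagonalization hA
  rw [hAU, exp_orthogonal_conj hU, dotProduct_conj_diagonal_mulVec]
  exact Finset.sum_nonneg fun i _ => mul_nonneg (Real.exp_pos _).le (sq_nonneg _)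

/-- In an eigenbasis u_i of P the trace of PQ is ∑ l_i ⟨u_i, Q u_i⟩ with weights l_i ≥ 0. -/
theorem trace_mul_le_of_dotProduct_le {P Q : Matrix n n ℝ} (hP : Pᵀ = P)
    (hP0 : ∀ w, 0 ≤ w ⬝ᵥ (P *ᵥ w)) {g : ℝ} (hQ : ∀ w, w ⬝ᵥ (Q *ᵥ w) ≤ g * (w ⬝ᵥ w)) :
    (P * Q).trace ≤ g * P.trace := by
  obtain ⟨U, l, hU, hU', hPU⟩ := exists_orthogonal_diagonalization hP
  have hl : ∀ i, 0 ≤ l i := by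
    intro i
    have h := hP0 (U *ᵥ Pi.single i 1)
    rw [hPU, dotProduct_conj_diagonal_mulVec, mulVec_mulVec, hU, one_mulVec] at h
    simpa [Pi.single_apply, ite_pow] using h
  have h1 : (P * Q).trace = ∑ i, l i * (Uᵀ * Q * U) i i := by
    rw [hPU, show U * diagonal l * Uᵀ * Q = U * (diagonal l * (Uᵀ * Q)) by
      simp only [Matrix.mul_assoc], trace_mul_comm, Matrix.mul_assoc, trace]
    simp [diagonal_mul]
  have h2 : P.trace = ∑ i, l i := by
    rw [hPU, trace_mul_comm, ← Matrix.mul_assoc, hU, Matrix.one_mul, trace_diagonal]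
  rw [h1, h2, Finset.mul_sum]
  refine Finset.sum_le_sum fun i _ => ?_
  rw [mul_comm g]
  refine mul_le_mul_of_nonneg_left ?_ (hl i)
  have h := hQ (U *ᵥ Pi.single i 1)
  have e1 : (U *ᵥ Pi.single i 1) ⬝ᵥ (Q *ᵥ (U *ᵥ Pi.single i 1)) = (Uᵀ * Q * U) i i := by
    have := dotProduct_conj_mulVec Uᵀ Q (Pi.single i 1)
    rw [transpose_transpose] at this
    rw [← this]
    simp
  rw [e1, dotProduct_self_eq_sum_sq hU', mulVec_mulVec, hU, one_mulVec] at h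
  simpa [Pi.single_apply, ite_pow] using h

end Matrix
end

/-! ### Matrix Bernstein inequality by the trace of the exponential -/

noncomputable section
namespace Matrix

variable {n : Type*} [Fintype n] [DecidableEq n]

open scoped Matrix.Norms.L2Operator in
theorem continuous_exp_apply (a b : n) :
    Continuous fun f : n → n → ℝ => NormedSpace.exp (of f) a b := by
  let _ : NormedAlgebra ℚ (Matrix n n ℝ) := NormedAlgebra.restrictScalars ℚ ℝ _
  have h : Continuous fun f : n → n → ℝ => (of f : Matrix n n ℝ) := continuous_id
  have h2 : Continuous fun M : Matrix n n ℝ => NormedSpace.exp M := NormedSpace.exp_continuous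
  exact (h2.comp h).matrix_elem a b

variable {Ω : Type*} [MeasurableSpace Ω] {μ : Measure Ω} [IsProbabilityMeasure μ]

theorem integrable_exp_apply {X : Ω → n → n → ℝ} (hX : Measurable X) {K : ℝ}
    (hK : ∀ ω a b, |X ω a b| ≤ K) (a b : n) :
    Integrable (fun ω => NormedSpace.exp (of (X ω)) a b) μ := by
  have hc : IsCompact (Set.pi Set.univ fun _ : n => Set.pi Set.univ fun _ : n => Set.Icc (-K) K) :=
    isCompact_univ_pi fun _ => isCompact_univ_pi fun _ => isCompact_Icc
  obtain ⟨C, hC⟩ := hc.exists_bound_of_continuousOn (continuous_exp_apply a b).continuousOn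
  refine Integrable.of_bound
    ((continuous_exp_apply a b).measurable.comp hX).aestronglyMeasurable C ?_
  refine Filter.Eventually.of_forall fun ω => hC _ ?_
  simp only [Set.mem_pi, Set.mem_univ, true_imp_iff]
  exact fun a b => abs_le.1 (hK ω a b)

/-- Golden–Thompson splits one summand off the exponential; independence turns the expected trace of
the product into tr (PQ) with P, Q the entrywise expectations; and Q ≤ g as a quadratic form. Each
summand thus costs a factor g, starting from tr exp 0. -/
theorem integral_trace_exp_sum_le {ι : Type*} [DecidableEq ι] {X : ι → Ω → n → n → ℝ}
    (hX : ∀ i, Measurable (X i)) (hindep : iIndepFun X μ)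
    (hsymm : ∀ i ω a b, X i ω a b = X i ω b a) {K : ℝ} (hK : ∀ i ω a b, |X i ω a b| ≤ K)
    {g : ℝ} (hg0 : 0 ≤ g)
    (hg : ∀ i w, ∫ ω, w ⬝ᵥ (NormedSpace.exp (of (X i ω)) *ᵥ w) ∂μ ≤ g * (w ⬝ᵥ w))
    (s : Finset ι) :
    ∫ ω, (NormedSpace.exp (of (∑ i ∈ s, X i ω))).trace ∂μ ≤ Fintype.card n * g ^ s.card := by
  induction s using Finset.induction_on with
  | empty =>
    have : (of (0 : n → n → ℝ)) = (0 : Matrix n n ℝ) := rfl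
    simp [this, NormedSpace.exp_zero]
  | insert i s hi ih =>
    have hSm : Measurable fun ω => ∑ j ∈ s, X j ω := Finset.measurable_sum _ fun j _ => hX j
    have hSK : ∀ ω a b, |(∑ j ∈ s, X j ω) a b| ≤ s.card * K := by
      intro ω a b
      rw [Finset.sum_apply, Finset.sum_apply]
      refine (Finset.abs_sum_le_sum_abs _ _).trans ?_
      rw [← nsmul_eq_mul]
      exact Finset.sum_le_card_nsmul _ _ _ fun j _ => hK j ω a b
    have hSs : ∀ ω, (of (∑ j ∈ s, X j ω))ᵀ = of (∑ j ∈ s, X j ω) := by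
      intro ω
      ext a b
      simp only [transpose_apply, of_apply, Finset.sum_apply]
      exact Finset.sum_congr rfl fun j _ => hsymm j ω b a
    have hXs : ∀ ω, (of (X i ω))ᵀ = of (X i ω) := by
      intro ω
      ext a b
      exact hsymm i ω b a
    have hind : IndepFun (fun ω => ∑ j ∈ s, X j ω) (X i) μ := by
      have := hindep.indepFun_finsetSum_of_notMem hX hi
      convert this using 1
      funext ω
      rw [Finset.sum_apply]
    have hSi := integrable_exp_apply (μ := μ) hSm hSK
    have hXi := integrable_exp_apply (μ := μ) (hX i) (hK i)
    have hprod : ∀ a b, IndepFun (fun ω => NormedSpace.exp (of (∑ j ∈ s, X j ω)) a b)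
        (fun ω => NormedSpace.exp (of (X i ω)) b a) μ := fun a b =>
      hind.comp (continuous_exp_apply a b).measurable (continuous_exp_apply b a).measurable
    have hint : ∀ a b, Integrable (fun ω => NormedSpace.exp (of (∑ j ∈ s, X j ω)) a b *
        NormedSpace.exp (of (X i ω)) b a) μ := fun a b =>
      (hprod a b).integrable_mul (hSi a b) (hXi b a)
    set P : Matrix n n ℝ := of fun a b => ∫ ω, NormedSpace.exp (of (∑ j ∈ s, X j ω)) a b ∂μ
      with hP
    set Q : Matrix n n ℝ := of fun a b => ∫ ω, NormedSpace.exp (of (X i ω)) a b ∂μ with hQ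
    have hquad : ∀ (F : Ω → Matrix n n ℝ) (_ : ∀ a b, Integrable (fun ω => F ω a b) μ) (w : n → ℝ),
        w ⬝ᵥ ((of fun a b => ∫ ω, F ω a b ∂μ) *ᵥ w) = ∫ ω, w ⬝ᵥ (F ω *ᵥ w) ∂μ := by
      intro F hF w
      simp only [dotProduct, mulVec, of_apply]
      rw [integral_finsetSum _ fun a _ => ?_]
      · refine Finset.sum_congr rfl fun a _ => ?_
        rw [integral_const_mul, integral_finsetSum _ fun b _ => (hF a b).mul_const _]
        simp only [integral_mul_const]
      · exact (integrable_finsetSum _ fun b _ => (hF a b).mul_const _).const_mul _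
    have htrP : P.trace = ∫ ω, (NormedSpace.exp (of (∑ j ∈ s, X j ω))).trace ∂μ := by
      simp only [trace, diag]
      rw [integral_finsetSum _ fun a _ => hSi a a]
      rfl
    have hPQ : (P * Q).trace ≤ g * P.trace := by
      refine trace_mul_le_of_dotProduct_le ?_ ?_ ?_
      · ext a b
        simp only [hP, transpose_apply, of_apply]
        refine integral_congr_ae (Filter.Eventually.of_forall fun ω => ?_)
        have := exp_transpose (of (∑ j ∈ s, X j ω))
        rw [hSs] at this
        exact (congrFun (congrFun this a) b).symm
      · intro w
        rw [hP, hquad _ hSi]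
        exact integral_nonneg fun ω => dotProduct_exp_mulVec_nonneg (hSs ω) w
      · intro w
        rw [hQ, hquad _ hXi]
        exact hg i w
    calc ∫ ω, (NormedSpace.exp (of (∑ j ∈ insert i s, X j ω))).trace ∂μ
        ≤ ∫ ω, (NormedSpace.exp (of (∑ j ∈ s, X j ω)) * NormedSpace.exp (of (X i ω))).trace ∂μ := by
          refine integral_mono_of_nonneg (Filter.Eventually.of_forall fun ω => ?_) ?_
            (Filter.Eventually.of_forall fun ω => ?_)
          · have hs2 : (of (∑ j ∈ insert i s, X j ω))ᵀ = of (∑ j ∈ insert i s, X j ω) := by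
              ext a b
              simp only [transpose_apply, of_apply, Finset.sum_apply]
              exact Finset.sum_congr rfl fun j _ => hsymm j ω b a
            have := fun a => dotProduct_exp_mulVec_nonneg hs2 (Pi.single a 1)
            simp only [mulVec_single_one, single_one_dotProduct] at this
            exact Finset.sum_nonneg fun a _ => this a
          · simp only [trace, diag, mul_apply]
            exact integrable_finsetSum _ fun a _ => integrable_finsetSum _ fun b _ => hint a b
          · have := trace_exp_add_le _ _ (hSs ω) (hXs ω)
            rwa [of_add_of, add_comm, ← Finset.sum_insert (f := fun j => X j ω) hi] at this
      _ = (P * Q).trace := by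
          simp only [trace, diag, mul_apply]
          rw [integral_finsetSum _ fun a _ => integrable_finsetSum _ fun b _ => hint a b]
          refine Finset.sum_congr rfl fun a _ => ?_
          rw [integral_finsetSum _ fun b _ => hint a b]
          refine Finset.sum_congr rfl fun b _ => ?_
          exact (hprod a b).integral_mul_eq_mul_integral (hSi a b).aestronglyMeasurable
            (hXi b a).aestronglyMeasurable
      _ ≤ g * P.trace := hPQ
      _ ≤ g * (Fintype.card n * g ^ s.card) := by rw [htrP]; gcongr
      _ = Fintype.card n * g ^ (insert i s).card := by
          rw [Finset.card_insert_of_notMem hi]; ring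

/-- A **matrix Bernstein inequality** for sums of independent bounded symmetric random matrices
with small mean (Ahlswede–Winter form). -/
theorem measureReal_exists_le_dotProduct_sum_le {ι : Type*} [Fintype ι] {X : ι → Ω → n → n → ℝ}
    (hX : ∀ i, Measurable (X i)) (hindep : iIndepFun X μ)
    (hsymm : ∀ i ω a b, X i ω a b = X i ω b a) {t b v : ℝ} (ht : 0 < t)
    (hbdd : ∀ i ω w, t ^ 2 * ((of (X i ω) *ᵥ w) ⬝ᵥ (of (X i ω) *ᵥ w)) ≤ w ⬝ᵥ w)
    (hmean : ∀ i w, ∫ ω, w ⬝ᵥ (of (X i ω) *ᵥ w) ∂μ ≤ b * (w ⬝ᵥ w))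
    (hvar : ∀ i w, ∫ ω, (of (X i ω) *ᵥ w) ⬝ᵥ (of (X i ω) *ᵥ w) ∂μ ≤ v * (w ⬝ᵥ w)) (r : ℝ) :
    μ.real {ω | ∃ w, w ⬝ᵥ w = 1 ∧ r ≤ w ⬝ᵥ (of (∑ i, X i ω) *ᵥ w)} ≤
      Fintype.card n * Real.exp (-(t * r) + Fintype.card ι * (t * b + t ^ 2 * v)) := by
  classical
  set Y : ι → Ω → n → n → ℝ := fun i ω a b => t * X i ω a b with hY
  have hYof : ∀ i ω, of (Y i ω) = t • of (X i ω) := fun i ω => rfl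
  have hYm : ∀ i, Measurable (Y i) := fun i => by
    refine measurable_pi_iff.2 fun a => measurable_pi_iff.2 fun b => ?_
    exact ((measurable_pi_apply b).comp ((measurable_pi_apply a).comp (hX i))).const_mul t
  have hYi : iIndepFun Y μ := by
    refine hindep.comp (fun _ f a b => t * f a b) fun _ => ?_
    refine measurable_pi_iff.2 fun a => measurable_pi_iff.2 fun b => ?_
    exact Measurable.const_mul (f := fun f : n → n → ℝ => f a b)
      ((measurable_pi_apply b).comp (measurable_pi_apply a)) t
  have hYs : ∀ i ω a b, Y i ω a b = Y i ω b a := fun i ω a b => by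
    simp only [hY]; rw [hsymm]
  have hY1 : ∀ i ω w, (of (Y i ω) *ᵥ w) ⬝ᵥ (of (Y i ω) *ᵥ w) ≤ w ⬝ᵥ w := by
    intro i ω w
    rw [hYof, smul_mulVec, smul_dotProduct, dotProduct_smul, smul_smul, smul_eq_mul, ← pow_two]
    exact hbdd i ω w
  have hYK : ∀ i ω a b, |Y i ω a b| ≤ 1 := by
    intro i ω a b
    have h := hY1 i ω (Pi.single b 1)
    rw [mulVec_single_one] at h
    simp only [single_one_dotProduct, Pi.single_eq_same] at h
    rw [← sq_le_one_iff_abs_le_one, pow_two]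
    refine le_trans ?_ h
    exact Finset.single_le_sum (f := fun a => Y i ω a b * Y i ω a b)
      (fun c _ => mul_self_nonneg _) (Finset.mem_univ a)
  have hYt : ∀ i ω, (of (Y i ω))ᵀ = of (Y i ω) := by
    intro i ω
    ext a b
    exact hYs i ω b a
  set g : ℝ := Real.exp (t * b + t ^ 2 * v) with hg
  have hentry : ∀ i a b, Integrable (fun ω => of (X i ω) a b) μ := by
    intro i a b
    have : Integrable (fun ω => Y i ω a b) μ := Integrable.of_bound
      ((measurable_pi_apply b).comp ((measurable_pi_apply a).comp (hYm i))).aestronglyMeasurable 1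
      (Filter.Eventually.of_forall fun ω => hYK i ω a b)
    have := this.const_mul t⁻¹
    simpa [hY, ← mul_assoc, inv_mul_cancel₀ ht.ne'] using this
  have hentry2 : ∀ i a b c, Integrable (fun ω => of (X i ω) a b * of (X i ω) a c) μ := by
    intro i a b c
    refine (hentry i a b).mul_bdd (c := t⁻¹) (hentry i a c).aestronglyMeasurable ?_
    refine Filter.Eventually.of_forall fun ω => ?_
    have := hYK i ω a c
    rw [hY, abs_mul, abs_of_pos ht] at this
    rw [Real.norm_eq_abs, of_apply, ← one_div, le_div_iff₀ ht]
    linarith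
  -- Integrating exp (tX) ≤ 1 + tX + t² X² gives 1 + t b + t² v, which is at most its exponential.
  have hgb : ∀ i w, ∫ ω, w ⬝ᵥ (NormedSpace.exp (of (Y i ω)) *ᵥ w) ∂μ ≤ g * (w ⬝ᵥ w) := by
    intro i w
    have hi1 : Integrable (fun ω => w ⬝ᵥ (of (X i ω) *ᵥ w)) μ := by
      simp only [dotProduct, mulVec]
      exact integrable_finsetSum _ fun a _ =>
        (integrable_finsetSum _ fun b _ => (hentry i a b).mul_const _).const_mul _
    have hi2 : Integrable (fun ω => (of (X i ω) *ᵥ w) ⬝ᵥ (of (X i ω) *ᵥ w)) μ := by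
      simp only [dotProduct, mulVec]
      refine integrable_finsetSum _ fun a _ => ?_
      simp only [Finset.sum_mul_sum]
      refine integrable_finsetSum _ fun b _ => integrable_finsetSum _ fun c _ => ?_
      refine ((hentry2 i a b c).mul_const (w b * w c)).congr (Filter.Eventually.of_forall fun ω => ?_)
      simp only
      ring
    have hww : 0 ≤ w ⬝ᵥ w := Finset.sum_nonneg fun a _ => mul_self_nonneg _
    calc ∫ ω, w ⬝ᵥ (NormedSpace.exp (of (Y i ω)) *ᵥ w) ∂μ
        ≤ ∫ ω, (w ⬝ᵥ w + t * (w ⬝ᵥ (of (X i ω) *ᵥ w)) +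
            t ^ 2 * ((of (X i ω) *ᵥ w) ⬝ᵥ (of (X i ω) *ᵥ w))) ∂μ := by
          refine integral_mono_of_nonneg (Filter.Eventually.of_forall fun ω =>
            dotProduct_exp_mulVec_nonneg (hYt i ω) w) ?_ (Filter.Eventually.of_forall fun ω => ?_)
          · exact ((integrable_const _).add (hi1.const_mul _)).add (hi2.const_mul _)
          · refine (dotProduct_exp_mulVec_le (hYt i ω) (hY1 i ω) w).trans (le_of_eq ?_)
            simp only [hYof, smul_mulVec, smul_dotProduct, dotProduct_smul, smul_eq_mul, pow_two]
            ring
      _ = w ⬝ᵥ w + t * ∫ ω, w ⬝ᵥ (of (X i ω) *ᵥ w) ∂μ +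
            t ^ 2 * ∫ ω, (of (X i ω) *ᵥ w) ⬝ᵥ (of (X i ω) *ᵥ w) ∂μ := by
          rw [integral_add, integral_add, integral_const_mul, integral_const_mul]
          · simp
          · exact integrable_const _
          · exact hi1.const_mul _
          · exact (integrable_const _).add (hi1.const_mul _)
          · exact hi2.const_mul _
      _ ≤ w ⬝ᵥ w + t * (b * (w ⬝ᵥ w)) + t ^ 2 * (v * (w ⬝ᵥ w)) := by
          gcongr
          · exact hmean i w
          · exact hvar i w
      _ = (t * b + t ^ 2 * v + 1) * (w ⬝ᵥ w) := by ring
      _ ≤ g * (w ⬝ᵥ w) := mul_le_mul_of_nonneg_right (Real.add_one_le_exp _) hww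
  have hmain := integral_trace_exp_sum_le hYm hYi hYs hYK (Real.exp_pos _).le hgb Finset.univ
  have hSm : Measurable fun ω => ∑ j, Y j ω := Finset.measurable_sum _ fun j _ => hYm j
  have hSK : ∀ ω a b, |(∑ j, Y j ω) a b| ≤ Fintype.card ι := by
    intro ω a b
    rw [Finset.sum_apply, Finset.sum_apply]
    refine (Finset.abs_sum_le_sum_abs _ _).trans ?_
    refine (Finset.sum_le_card_nsmul _ _ 1 fun j _ => hYK j ω a b).trans ?_
    simp
  have hSs : ∀ ω, (of (∑ j, Y j ω))ᵀ = of (∑ j, Y j ω) := by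
    intro ω
    ext a b
    simp only [transpose_apply, of_apply, Finset.sum_apply]
    exact Finset.sum_congr rfl fun j _ => hYs j ω b a
  have hSi : Integrable (fun ω => (NormedSpace.exp (of (∑ j, Y j ω))).trace) μ := by
    simp only [trace, diag]
    exact integrable_finsetSum _ fun a _ => integrable_exp_apply hSm hSK a a
  have hpos : ∀ ω, 0 ≤ (NormedSpace.exp (of (∑ j, Y j ω))).trace := by
    intro ω
    have := fun a => dotProduct_exp_mulVec_nonneg (hSs ω) (Pi.single a 1)
    simp only [mulVec_single_one, single_one_dotProduct] at this
    exact Finset.sum_nonneg fun a _ => this a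
  -- One trace dominates the exponentials of all Rayleigh quotients at once, so Markov's inequality
  -- for the trace handles every w without a union bound.
  have hsub : {ω | ∃ w, w ⬝ᵥ w = 1 ∧ r ≤ w ⬝ᵥ (of (∑ i, X i ω) *ᵥ w)} ⊆
      {ω | Real.exp (t * r) ≤ (NormedSpace.exp (of (∑ j, Y j ω))).trace} := by
    rintro ω ⟨w, hw, hr⟩
    refine le_trans ?_ (exp_dotProduct_mulVec_le_trace (hSs ω) hw)
    rw [Real.exp_le_exp]
    have : of (∑ j, Y j ω) = t • of (∑ i, X i ω) := by
      ext a b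
      simp [hY, Finset.sum_apply, Finset.mul_sum]
    rw [this, smul_mulVec, dotProduct_smul, smul_eq_mul]
    gcongr
  have hmarkov := mul_meas_ge_le_integral_of_nonneg (Filter.Eventually.of_forall hpos) hSi
    (Real.exp (t * r))
  calc _ ≤ μ.real {ω | Real.exp (t * r) ≤ (NormedSpace.exp (of (∑ j, Y j ω))).trace} :=
        measureReal_mono hsub
    _ ≤ Real.exp (-(t * r)) * (Fintype.card n * g ^ (Finset.univ : Finset ι).card) := by
        rw [Real.exp_neg, ← div_eq_inv_mul, le_div_iff₀ (Real.exp_pos _), mul_comm]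
        exact hmarkov.trans hmain
    _ = _ := by
        rw [hg, ← Real.exp_nat_mul, Finset.card_univ, Real.exp_add]
        ring

end Matrix
end

/-! ### Perturbation of singular subspaces -/

noncomputable section
namespace Matrix

open scoped Matrix.Norms.L2Operator

section OpNorm

variable {m n l : Type*} [Fintype m] [Fintype n] [DecidableEq n] [Fintype l] [DecidableEq l]

theorem l2_opNorm_le_of_forall (M : Matrix m n ℝ) {K : ℝ} (hK : 0 ≤ K)
    (h : ∀ x : n → ℝ, ‖WithLp.toLp 2 (M *ᵥ x)‖ ≤ K * ‖WithLp.toLp 2 x‖) : ‖M‖ ≤ K := by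
  rw [l2_opNorm_def]
  exact ContinuousLinearMap.opNorm_le_bound _ hK fun x => h x.ofLp

theorem norm_toLp_mulVec_le (M : Matrix m n ℝ) (x : n → ℝ) :
    ‖WithLp.toLp 2 (M *ᵥ x)‖ ≤ ‖M‖ * ‖WithLp.toLp 2 x‖ :=
  l2_opNorm_mulVec M (WithLp.toLp 2 x)

theorem l2_opNorm_transpose [DecidableEq m] (M : Matrix m n ℝ) : ‖Mᵀ‖ = ‖M‖ := by
  rw [← conjTranspose_eq_transpose_of_trivial, l2_opNorm_conjTranspose]

theorem l2_opNorm_transpose_mul_self (M : Matrix m n ℝ) : ‖Mᵀ * M‖ = ‖M‖ * ‖M‖ := by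
  rw [← conjTranspose_eq_transpose_of_trivial, l2_opNorm_conjTranspose_mul_self]

theorem l2_opNorm_le_one_of_isometry {M : Matrix m n ℝ} (h : Mᵀ * M = 1) : ‖M‖ ≤ 1 := by
  have h1 := l2_opNorm_transpose_mul_self M
  have h2 : ‖(1 : Matrix n n ℝ)‖ ≤ 1 :=
    l2_opNorm_le_of_forall _ zero_le_one fun x => by rw [one_mulVec, one_mul]
  rw [h] at h1
  nlinarith [norm_nonneg M]

theorem l2_opNorm_le_one_of_projection {Q : Matrix n n ℝ} (h : Qᵀ * Q = Q) : ‖Q‖ ≤ 1 := by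
  have h1 := l2_opNorm_transpose_mul_self Q
  rw [h] at h1
  by_contra hlt
  nlinarith

theorem norm_toLp_mulVec_of_isometry [DecidableEq m] {M : Matrix m n ℝ} (h : Mᵀ * M = 1) (x : n → ℝ) :
    ‖WithLp.toLp 2 (M *ᵥ x)‖ = ‖WithLp.toLp 2 x‖ := by
  refine le_antisymm ?_ ?_
  · refine (norm_toLp_mulVec_le M x).trans ?_
    exact mul_le_of_le_one_left (norm_nonneg _) (l2_opNorm_le_one_of_isometry h)
  · have h1 := norm_toLp_mulVec_le Mᵀ (M *ᵥ x)
    rw [mulVec_mulVec, h, one_mulVec, l2_opNorm_transpose] at h1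
    exact h1.trans (mul_le_of_le_one_left (norm_nonneg _) (l2_opNorm_le_one_of_isometry h))

end OpNorm

/-- Dimension count: vectors supported on S form a space of dimension larger than that of the
target. -/
theorem exists_ne_zero_mulVec_eq_zero {m d : ℕ} (M : Matrix (Fin m) (Fin d) ℝ) (S : Finset (Fin d))
    (h : m < S.card) : ∃ c : Fin d → ℝ, c ≠ 0 ∧ (∀ r, r ∉ S → c r = 0) ∧ M *ᵥ c = 0 := by
  have hfr : Module.finrank ℝ (Fin m → ℝ) < Module.finrank ℝ (S → ℝ) := by simpa using h
  have hker := LinearMap.ker_ne_bot_of_finrank_lt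
    (f := (M.submatrix id (Subtype.val : S → Fin d)).mulVecLin) hfr
  obtain ⟨z, hz, hz0⟩ := (Submodule.ne_bot_iff _).1 hker
  refine ⟨fun r => if hr : r ∈ S then z ⟨r, hr⟩ else 0, ?_, fun r hr => by simp [hr], ?_⟩
  · intro h0
    apply hz0
    ext r
    have := congrFun h0 r.1
    simpa using this
  · rw [LinearMap.mem_ker, mulVecLin_apply] at hz
    rw [← hz]
    ext a
    simp only [mulVec, dotProduct, submatrix_apply, id]
    calc ∑ r, M a r * (if hr : r ∈ S then z ⟨r, hr⟩ else 0)
        = ∑ r ∈ S, M a r * (if hr : r ∈ S then z ⟨r, hr⟩ else 0) :=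
          (Finset.sum_subset (Finset.subset_univ S) fun r _ hr => by simp [hr]).symm
      _ = ∑ r : S, M a r * (if hr : r.1 ∈ S then z ⟨r, hr⟩ else 0) :=
          (Finset.sum_coe_sort S fun r => M a r * (if hr : r ∈ S then z ⟨r, hr⟩ else 0)).symm
      _ = ∑ r : S, M a r * z r := Finset.sum_congr rfl fun r _ => by simp

theorem submatrix_isometry {d k : ℕ} {V : Matrix (Fin d) (Fin d) ℝ} (hV : Vᵀ * V = 1)
    {f : Fin k → Fin d} (hf : Function.Injective f) :
    (V.submatrix id f)ᵀ * V.submatrix id f = 1 := by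
  ext i j
  have := congrFun (congrFun hV (f i)) (f j)
  rw [one_apply] at this
  rw [one_apply]
  simp only [hf.eq_iff] at this
  exact this

end Matrix

namespace SharedRep

open Matrix
open scoped Matrix.Norms.L2Operator

section

variable {d k : ℕ} {Z U V : Matrix (Fin d) (Fin d) ℝ} {s : Fin d → ℝ}
  {B : Matrix (Fin d) (Fin k) ℝ} {D : Matrix (Fin k) (Fin k) ℝ}

/-- Weyl's argument: indices start at 0, so r + 1 > k leading right singular vectors have a nonzero
combination killed by `Bᵀ`. On it Z coincides with the perturbation and stretches by at least s r.
-/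
theorem singularValue_le_of_le (hU : Uᵀ * U = 1) (hV : Vᵀ * V = 1) (hs : Antitone s)
    (hs0 : ∀ r, 0 ≤ s r) (hZ : Z = U * diagonal s * Vᵀ) (r : Fin d) (hr : k ≤ r) :
    s r ≤ ‖Z - B * D * Bᵀ‖ := by
  obtain ⟨c, hc0, hcS, hc⟩ := exists_ne_zero_mulVec_eq_zero (Bᵀ * V) (Finset.Iic r)
    (by rw [Fin.card_Iic]; omega)
  have hpos : 0 < ‖WithLp.toLp 2 c‖ := by
    rw [norm_pos_iff]
    simpa using hc0
  have h1 : (Z - B * D * Bᵀ) *ᵥ (V *ᵥ c) = U *ᵥ (diagonal s *ᵥ c) := by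
    have e1 : Bᵀ *ᵥ (V *ᵥ c) = 0 := by rw [mulVec_mulVec, hc]
    have e2 : Vᵀ *ᵥ (V *ᵥ c) = c := by rw [mulVec_mulVec, hV, one_mulVec]
    rw [sub_mulVec, ← mulVec_mulVec _ _ Bᵀ, e1, mulVec_zero, sub_zero, hZ, ← mulVec_mulVec,
      ← mulVec_mulVec, e2]
  have h2 := norm_toLp_mulVec_le (Z - B * D * Bᵀ) (V *ᵥ c)
  rw [h1, norm_toLp_mulVec_of_isometry hU, norm_toLp_mulVec_of_isometry hV] at h2
  have h3 : s r * ‖WithLp.toLp 2 c‖ ≤ ‖WithLp.toLp 2 (diagonal s *ᵥ c)‖ := by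
    refine le_of_sq_le_sq ?_ (norm_nonneg _)
    rw [mul_pow, EuclideanSpace.real_norm_sq_eq, EuclideanSpace.real_norm_sq_eq, Finset.mul_sum]
    refine Finset.sum_le_sum fun i _ => ?_
    simp only [mulVec_diagonal, mul_pow]
    by_cases hi : i ∈ Finset.Iic r
    · have := hs (Finset.mem_Iic.1 hi)
      have := hs0 r
      gcongr
    · simp [hcS i hi]
  exact le_of_mul_le_mul_right (h3.trans h2) hpos

/-- The dual argument: some B z ≠ 0 is orthogonal to the first r < k right singular vectors. On it Z
stretches by at most s r, whereas `B D Bᵀ` stretches by at least lam. -/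
theorem le_singularValue_add (hU : Uᵀ * U = 1) (hV : Vᵀ * V = 1) (hs : Antitone s)
    (hs0 : ∀ r, 0 ≤ s r) (hZ : Z = U * diagonal s * Vᵀ) (hB : Bᵀ * B = 1) {lam : ℝ}
    (hD : ∀ z, lam * ‖WithLp.toLp 2 z‖ ≤ ‖WithLp.toLp 2 (D *ᵥ z)‖) (r : Fin d) (hr : r.1 < k) :
    lam ≤ s r + ‖Z - B * D * Bᵀ‖ := by
  obtain ⟨z, hz0, -, hz⟩ := exists_ne_zero_mulVec_eq_zero
    ((Vᵀ * B).submatrix (Fin.castLE r.2.le : Fin r.1 → Fin d) id) Finset.univ (by simpa using hr)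
  have hpos : 0 < ‖WithLp.toLp 2 z‖ := by
    rw [norm_pos_iff]
    simpa using hz0
  have hVt : Vᵀᵀ * Vᵀ = 1 := by rw [transpose_transpose]; exact mul_eq_one_comm.1 hV
  have h1 : ‖WithLp.toLp 2 (Z *ᵥ (B *ᵥ z))‖ ≤ s r * ‖WithLp.toLp 2 z‖ := by
    rw [hZ, ← mulVec_mulVec, ← mulVec_mulVec, norm_toLp_mulVec_of_isometry hU,
      ← norm_toLp_mulVec_of_isometry hB z, ← norm_toLp_mulVec_of_isometry hVt (B *ᵥ z)]
    refine le_of_sq_le_sq ?_ (mul_nonneg (hs0 r) (norm_nonneg _))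
    rw [mul_pow, EuclideanSpace.real_norm_sq_eq, EuclideanSpace.real_norm_sq_eq, Finset.mul_sum]
    refine Finset.sum_le_sum fun i _ => ?_
    simp only [mulVec_diagonal, mul_pow]
    rcases lt_or_ge i.1 r.1 with hi | hi
    · have := congrFun hz ⟨i.1, hi⟩
      have h0 : (Vᵀ *ᵥ (B *ᵥ z)) i = 0 := by
        rw [mulVec_mulVec]
        exact this
      rw [h0]
      simp
    · have := hs (show r ≤ i from hi)
      have := hs0 i
      gcongr
  have h2 := norm_toLp_mulVec_le (Z - B * D * Bᵀ) (B *ᵥ z)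
  rw [norm_toLp_mulVec_of_isometry hB] at h2
  have h3 : lam * ‖WithLp.toLp 2 z‖ ≤ ‖WithLp.toLp 2 ((B * D * Bᵀ) *ᵥ (B *ᵥ z))‖ := by
    rw [← mulVec_mulVec, mulVec_mulVec z, hB, one_mulVec, ← mulVec_mulVec,
      norm_toLp_mulVec_of_isometry hB]
    exact hD z
  have h4 : ‖WithLp.toLp 2 ((B * D * Bᵀ) *ᵥ (B *ᵥ z))‖ ≤ ‖WithLp.toLp 2 (Z *ᵥ (B *ᵥ z))‖ +
      ‖WithLp.toLp 2 ((Z - B * D * Bᵀ) *ᵥ (B *ᵥ z))‖ := by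
    have : WithLp.toLp 2 ((B * D * Bᵀ) *ᵥ (B *ᵥ z)) = WithLp.toLp 2 (Z *ᵥ (B *ᵥ z)) -
        WithLp.toLp 2 ((Z - B * D * Bᵀ) *ᵥ (B *ᵥ z)) := by
      rw [← WithLp.toLp_sub, sub_mulVec]
      congr 1
      abel
    rw [this]
    exact norm_sub_le _ _
  refine le_of_mul_le_mul_right ?_ hpos
  rw [add_mul]
  linarith

end

variable {d k : ℕ} {Z : Matrix (Fin d) (Fin d) ℝ}
  {B : Matrix (Fin d) (Fin k) ℝ} {D : Matrix (Fin k) (Fin k) ℝ}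

/-- With projections P onto the range of B and P' onto that of W, P' - P = P'(1 - P) - (P(1 - P'))ᵀ.
Each part is at most 2 ε / lam: one by cutting Z down to its small singular values, the other by
expressing W through the large ones. -/
theorem norm_sub_projection_le (hk : 0 < k) (hkd : k ≤ d) {U V : Matrix (Fin d) (Fin d) ℝ}
    {s : Fin d → ℝ} (hU : Uᵀ * U = 1) (hV : Vᵀ * V = 1) (hs : Antitone s)
    (hs0 : ∀ r, 0 ≤ s r) (hZ : Z = U * diagonal s * Vᵀ) (hB : Bᵀ * B = 1) (hDt : Dᵀ = D) {lam : ℝ}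
    (hlam : 0 < lam) (hD : ∀ z, lam * ‖WithLp.toLp 2 z‖ ≤ ‖WithLp.toLp 2 (D *ᵥ z)‖)
    (W : Matrix (Fin d) (Fin k) ℝ) (hW : W = V.submatrix id (Fin.castLE hkd)) :
    ‖W * Wᵀ - B * Bᵀ‖ ≤ 4 * ‖Z - B * D * Bᵀ‖ / lam := by
  set ε := ‖Z - B * D * Bᵀ‖ with hε
  have hε0 : 0 ≤ ε := norm_nonneg _
  set E : Matrix (Fin d) (Fin k) ℝ := (1 : Matrix (Fin d) (Fin d) ℝ).submatrix id (Fin.castLE hkd)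
    with hE
  have hinj : Function.Injective (Fin.castLE hkd) := Fin.castLE_injective hkd
  have hWE : W = V * E := by
    rw [hW]
    ext i j
    simp [hE, mul_apply, one_apply]
  have hEE : Eᵀ * E = 1 := submatrix_isometry (by simp) hinj
  have hEE' : E * Eᵀ = diagonal fun r : Fin d => if r.1 < k then 1 else 0 := by
    ext i j
    simp only [hE, mul_apply, transpose_apply, submatrix_apply, id, one_apply, diagonal_apply]
    by_cases hi : i.1 < k
    · rw [Finset.sum_eq_single ⟨i.1, hi⟩]
      · have : Fin.castLE hkd ⟨i.1, hi⟩ = i := rfl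
        simp [this, hi, eq_comm]
      · intro r _ hr
        rw [if_neg, zero_mul]
        rintro h
        exact hr (hinj h.symm)
      · simp
    · have : ∀ r : Fin k, i ≠ Fin.castLE hkd r := by
        rintro r h
        apply hi
        rw [h]
        exact r.2
      simp [this, hi]
  have hsE : diagonal s * E = E * diagonal (fun r => s (Fin.castLE hkd r)) := by
    ext i j
    simp only [hE, diagonal_mul, mul_diagonal, submatrix_apply, id, one_apply]
    split_ifs with h
    · rw [h]; ring
    · simp
  have hWW : Wᵀ * W = 1 := by
    rw [hWE, transpose_mul, Matrix.mul_assoc, ← Matrix.mul_assoc Vᵀ, hV, Matrix.one_mul, hEE]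
  have hVV : V * Vᵀ = 1 := mul_eq_one_comm.1 hV
  set P := B * Bᵀ with hP
  set P' := W * Wᵀ with hP'
  have hPt : Pᵀ = P := by simp [hP]
  have hP't : P'ᵀ = P' := by simp [hP']
  have hPP : P * P = P := by
    rw [hP, Matrix.mul_assoc, ← Matrix.mul_assoc Bᵀ, hB, Matrix.one_mul]
  have hQ1 : ‖1 - P‖ ≤ 1 := by
    refine l2_opNorm_le_one_of_projection ?_
    rw [transpose_sub, transpose_one, hPt, mul_sub, sub_mul, sub_mul, hPP]
    simp
  have hP1 : ‖P'‖ ≤ 1 := by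
    refine l2_opNorm_le_one_of_projection ?_
    rw [hP't, hP', Matrix.mul_assoc, ← Matrix.mul_assoc Wᵀ, hWW, Matrix.one_mul]
  have hdec : P' - P = P' * (1 - P) - (P * (1 - P'))ᵀ := by
    rw [transpose_mul, transpose_sub, transpose_one, hPt, hP't]
    noncomm_ring
  -- Z (1 - P') retains only singular values of index at least k, which are at most ε. Hence `B D
  -- Bᵀ` (1 - P') has norm at most 2 ε, and the lower bound on D can be divided out.
  have hmain1 : ‖P * (1 - P')‖ ≤ 2 * ε / lam := by
    have hZP : ‖Z * (1 - P')‖ ≤ ε := by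
      have e1 : Z * (1 - P') = U * diagonal (fun r : Fin d => if r.1 < k then 0 else s r) * Vᵀ := by
        have : P' = V * (E * Eᵀ) * Vᵀ := by
          rw [hP', hWE, transpose_mul]
          simp only [Matrix.mul_assoc]
        rw [this, hEE', mul_sub, Matrix.mul_one, hZ]
        rw [show U * diagonal s * Vᵀ * (V * (diagonal fun r : Fin d => if r.1 < k then 1 else 0) * Vᵀ)
          = U * (diagonal s * (Vᵀ * V) * (diagonal fun r : Fin d => if r.1 < k then 1 else 0)) * Vᵀ by
          simp only [Matrix.mul_assoc], hV, Matrix.mul_one, diagonal_mul_diagonal, ← sub_mul,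
          ← mul_sub, diagonal_sub]
        congr 3
        ext r
        split_ifs <;> simp
      rw [e1]
      have hVt : Vᵀᵀ * Vᵀ = 1 := by rw [transpose_transpose]; exact hVV
      have hd : ‖diagonal (fun r : Fin d => if r.1 < k then 0 else s r)‖ ≤ ε := by
        rw [l2_opNorm_diagonal, pi_norm_le_iff_of_nonneg hε0]
        intro r
        split_ifs with h
        · simpa using hε0
        · rw [Real.norm_of_nonneg (hs0 r)]
          exact singularValue_le_of_le hU hV hs hs0 hZ r (not_lt.1 h)
      calc _ ≤ ‖U‖ * ‖diagonal (fun r : Fin d => if r.1 < k then 0 else s r)‖ * ‖Vᵀ‖ :=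
            (l2_opNorm_mul _ _).trans (by gcongr; exact l2_opNorm_mul _ _)
        _ ≤ 1 * ε * 1 := by
            gcongr
            · exact l2_opNorm_le_one_of_isometry hU
            · exact l2_opNorm_le_one_of_isometry hVt
        _ = ε := by ring
    have hQ' : ‖1 - P'‖ ≤ 1 := by
      refine l2_opNorm_le_one_of_projection ?_
      have : P' * P' = P' := by
        rw [hP', Matrix.mul_assoc, ← Matrix.mul_assoc Wᵀ, hWW, Matrix.one_mul]
      rw [transpose_sub, transpose_one, hP't, mul_sub, sub_mul, sub_mul, this]
      simp
    have hA : ‖B * D * Bᵀ * (1 - P')‖ ≤ 2 * ε := by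
      have : B * D * Bᵀ * (1 - P') = Z * (1 - P') - (Z - B * D * Bᵀ) * (1 - P') := by
        rw [sub_mul]; abel
      rw [this]
      calc _ ≤ ‖Z * (1 - P')‖ + ‖(Z - B * D * Bᵀ) * (1 - P')‖ := norm_sub_le _ _
        _ ≤ ε + ε * 1 := by
          gcongr
          exact (l2_opNorm_mul _ _).trans (by gcongr)
        _ = 2 * ε := by ring
    refine l2_opNorm_le_of_forall _ (by positivity) fun x => ?_
    have h1 := norm_toLp_mulVec_le (B * D * Bᵀ * (1 - P')) x
    rw [← mulVec_mulVec, ← mulVec_mulVec, ← mulVec_mulVec, norm_toLp_mulVec_of_isometry hB] at h1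
    have h2 := hD (Bᵀ *ᵥ ((1 - P') *ᵥ x))
    rw [← mulVec_mulVec, hP, ← mulVec_mulVec, norm_toLp_mulVec_of_isometry hB, div_mul_eq_mul_div,
      le_div_iff₀ hlam, mul_comm]
    refine h2.trans (h1.trans ?_)
    gcongr
  have hmain2 : ‖P' * (1 - P)‖ ≤ 2 * ε / lam := by
    -- If 2 ε ≤ lam, the leading k singular values are at least lam / 2 and can be inverted;
    -- otherwise the bound exceeds 1 and is trivial.
    rcases le_or_gt (2 * ε) lam with hle | hgt
    · set r0 : Fin d := ⟨k - 1, by omega⟩ with hr0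
      have hsr := le_singularValue_add (D := D) hU hV hs hs0 hZ hB hD r0 (by simp [hr0]; omega)
      have hs2 : lam / 2 ≤ s r0 := by linarith
      have hsk : ∀ r : Fin k, lam / 2 ≤ s (Fin.castLE hkd r) := fun r =>
        hs2.trans (hs (by rw [Fin.le_def]; simp [hr0]; omega))
      have hsp : ∀ r : Fin k, 0 < s (Fin.castLE hkd r) := fun r => by linarith [hsk r]
      have e1 : Zᵀ * (U * E) = W * diagonal (fun r => s (Fin.castLE hkd r)) := by
        rw [hZ, transpose_mul, transpose_mul, transpose_transpose, diagonal_transpose, hWE,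
          Matrix.mul_assoc V E, ← hsE]
        simp only [Matrix.mul_assoc]
        rw [← Matrix.mul_assoc Uᵀ, hU, Matrix.one_mul]
      -- From Zᵀ (U E) = W · diag s, and because 1 - P annihilates `B D Bᵀ`, only the perturbation
      -- survives on the left of (U E) · diag s⁻¹.
      have e2 : (1 - P) * W = ((1 - P) * ((Z - B * D * Bᵀ)ᵀ * (U * E))) *
          diagonal (fun r => (s (Fin.castLE hkd r))⁻¹) := by
        have hA0 : (1 - P) * (B * D * Bᵀ) = 0 := by
          rw [sub_mul, hP, Matrix.one_mul]
          simp only [Matrix.mul_assoc]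
          rw [← Matrix.mul_assoc Bᵀ B, hB, Matrix.one_mul, sub_self]
        have hAt : (B * D * Bᵀ)ᵀ = B * D * Bᵀ := by
          simp [transpose_mul, hDt, Matrix.mul_assoc]
        rw [transpose_sub, hAt, Matrix.sub_mul Zᵀ, e1, Matrix.mul_sub, ← Matrix.mul_assoc (1 - P) (B * D * Bᵀ), hA0,
          Matrix.zero_mul, sub_zero, Matrix.mul_assoc, Matrix.mul_assoc W, diagonal_mul_diagonal]
        have : (fun r : Fin k => s (Fin.castLE hkd r) * (s (Fin.castLE hkd r))⁻¹) = fun _ => 1 := by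
          ext r
          exact mul_inv_cancel₀ (hsp r).ne'
        rw [this, diagonal_one, Matrix.mul_one]
      have hUE : ‖U * E‖ ≤ 1 := by
        refine l2_opNorm_le_one_of_isometry ?_
        rw [transpose_mul, Matrix.mul_assoc, ← Matrix.mul_assoc Uᵀ, hU, Matrix.one_mul, hEE]
      have hdi : ‖(diagonal (fun r => (s (Fin.castLE hkd r))⁻¹) : Matrix (Fin k) (Fin k) ℝ)‖
          ≤ 2 / lam := by
        rw [l2_opNorm_diagonal, pi_norm_le_iff_of_nonneg (by positivity)]
        intro r
        rw [Real.norm_of_nonneg (inv_nonneg.2 (hsp r).le), ← inv_div lam 2]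
        exact inv_anti₀ (by positivity) (hsk r)
      have hPW : ‖(1 - P) * W‖ ≤ 2 * ε / lam := by
        rw [e2]
        calc _ ≤ (‖1 - P‖ * (‖(Z - B * D * Bᵀ)ᵀ‖ * ‖U * E‖)) *
              ‖(diagonal (fun r => (s (Fin.castLE hkd r))⁻¹) : Matrix (Fin k) (Fin k) ℝ)‖ := by
              refine (l2_opNorm_mul _ _).trans ?_
              gcongr
              refine (l2_opNorm_mul _ _).trans ?_
              gcongr
              exact l2_opNorm_mul _ _
          _ ≤ (1 * (ε * 1)) * (2 / lam) := by
              rw [l2_opNorm_transpose]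
              gcongr
          _ = 2 * ε / lam := by ring
      have e3 : P' * (1 - P) = ((1 - P) * W * Wᵀ)ᵀ := by
        rw [Matrix.mul_assoc (1 - P), ← hP', transpose_mul, transpose_sub, transpose_one, hPt, hP't]
      rw [e3, l2_opNorm_transpose]
      refine (l2_opNorm_mul _ _).trans ?_
      rw [l2_opNorm_transpose]
      refine le_trans ?_ hPW
      exact mul_le_of_le_one_right (norm_nonneg _) (l2_opNorm_le_one_of_isometry hWW)
    · have : 1 ≤ 2 * ε / lam := by
        rw [le_div_iff₀ hlam]; linarith
      refine le_trans ((l2_opNorm_mul _ _).trans ?_) this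
      calc ‖P'‖ * ‖1 - P‖ ≤ 1 * 1 := by gcongr
        _ = 1 := one_mul 1
  rw [hdec]
  refine (norm_sub_le _ _).trans ?_
  rw [l2_opNorm_transpose]
  refine (add_le_add hmain2 hmain1).trans (le_of_eq ?_)
  ring

/-- A `sin Θ` theorem for the top singular subspaces of a perturbation of `B D Bᵀ`. -/
theorem sinTheta_le (hk : 0 < k) (hkd : k ≤ d) (hB : Bᵀ * B = 1) (hDt : Dᵀ = D) {lam : ℝ}
    (hlam : 0 < lam) (hD : ∀ z, lam * ‖WithLp.toLp 2 z‖ ≤ ‖WithLp.toLp 2 (D *ᵥ z)‖)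
    {W : Matrix (Fin d) (Fin k) ℝ} (hW : IsTopSingular hkd Z W) :
    sinTheta W B ≤ 4 * ‖Z - B * D * Bᵀ‖ / lam := by
  obtain ⟨U, V, s, hU, hV, hs, hs0, hZ, h | h⟩ := hW
  · exact norm_sub_projection_le hk hkd hU hV hs hs0 hZ hB hDt hlam hD W h
  · have hZt : Zᵀ = V * diagonal s * Uᵀ := by
      rw [hZ]
      simp [transpose_mul, Matrix.mul_assoc]
    have := norm_sub_projection_le hk hkd hV hU hs hs0 hZt hB hDt hlam hD W h
    have e : Zᵀ - B * D * Bᵀ = (Z - B * D * Bᵀ)ᵀ := by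
      simp [transpose_mul, hDt, Matrix.mul_assoc]
    rwa [e, l2_opNorm_transpose] at this

theorem sinTheta_le_two {W : Matrix (Fin d) (Fin k) ℝ} (hB : Bᵀ * B = 1) (hW : Wᵀ * W = 1) :
    sinTheta W B ≤ 2 := by
  have h : ∀ {B : Matrix (Fin d) (Fin k) ℝ}, Bᵀ * B = 1 → ‖B * Bᵀ‖ ≤ 1 := by
    intro B hB
    refine l2_opNorm_le_one_of_projection ?_
    rw [transpose_mul, transpose_transpose, Matrix.mul_assoc, ← Matrix.mul_assoc Bᵀ, hB,
      Matrix.one_mul]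
  refine (norm_sub_le (W * Wᵀ) (B * Bᵀ)).trans ?_
  linarith [h hB, h hW]

theorem IsTopSingular.orthonormal {hkd : k ≤ d} {W : Matrix (Fin d) (Fin k) ℝ}
    (hW : IsTopSingular hkd Z W) : Wᵀ * W = 1 := by
  obtain ⟨U, V, s, hU, hV, -, -, -, h | h⟩ := hW
  · exact h ▸ submatrix_isometry hV (Fin.castLE_injective hkd)
  · exact h ▸ submatrix_isometry hU (Fin.castLE_injective hkd)

end SharedRep
end

/-! ### Sub-gaussian squares and sub-exponential variables -/

noncomputable section
namespace SharedRep

variable {Ω : Type*} [MeasurableSpace Ω] {μ : Measure Ω}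

theorem lintegral_exp_sq_gaussianReal_le :
    ∫⁻ x, ENNReal.ofReal (Real.exp (x ^ 2 / 4)) ∂(gaussianReal 0 1) ≤ ENNReal.ofReal 2 := by
  rw [gaussianReal_of_var_ne_zero 0 one_ne_zero, lintegral_withDensity_eq_lintegral_mul _
    (measurable_gaussianPDF 0 1) (by fun_prop)]
  have h : ∀ x : ℝ, (gaussianPDF 0 1 * fun x => ENNReal.ofReal (Real.exp (x ^ 2 / 4))) x =
      ENNReal.ofReal ((√(2 * Real.pi))⁻¹ * Real.exp (-(1 / 4) * x ^ 2)) := by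
    intro x
    rw [Pi.mul_apply, gaussianPDF, ← ENNReal.ofReal_mul (gaussianPDFReal_nonneg _ _ _),
      gaussianPDFReal_def, mul_assoc, ← Real.exp_add]
    simp only [NNReal.coe_one, mul_one, sub_zero]
    congr 3
    ring
  simp_rw [h]
  rw [← ofReal_integral_eq_lintegral_ofReal
    ((integrable_exp_neg_mul_sq (by norm_num)).const_mul _)
    (Filter.Eventually.of_forall fun x => by positivity), integral_const_mul, integral_gaussian]
  refine ENNReal.ofReal_le_ofReal ?_
  rw [show Real.pi / (1 / 4) = 2 * (2 * Real.pi) by ring, Real.sqrt_mul (by norm_num) (2 * Real.pi),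
    mul_left_comm, inv_mul_cancel₀ (by positivity), mul_one, Real.sqrt_le_left (by norm_num)]
  norm_num

theorem lintegral_exp_mul_gaussianReal (t : ℝ) :
    ∫⁻ x, ENNReal.ofReal (Real.exp (t * x)) ∂(gaussianReal 0 1) =
      ENNReal.ofReal (Real.exp (t ^ 2 / 2)) := by
  rw [← ofReal_integral_eq_lintegral_ofReal (integrable_exp_mul_gaussianReal t)
    (Filter.Eventually.of_forall fun x => (Real.exp_pos _).le)]
  have := congrFun (mgf_id_gaussianReal (μ := 0) (v := 1)) t
  simp only [mgf, id] at this
  rw [this]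
  simp

/-- Linearise the square with an auxiliary standard Gaussian g: e^(s X²) = E_g e^(√(2s) X g). After
Tonelli the sub-gaussian bound leaves e^(v s g²) ≤ e^(g²/4), whose Gaussian mean is √2 ≤ 2. -/
theorem integrable_exp_sq_of_hasSubgaussianMGF [IsProbabilityMeasure μ] {X : Ω → ℝ}
    (hX : Measurable X) {v : ℝ≥0} (h : HasSubgaussianMGF X v μ) {s : ℝ} (hs : 0 ≤ s)
    (hvs : 4 * v * s ≤ 1) :
    Integrable (fun ω => Real.exp (s * X ω ^ 2)) μ ∧ ∫ ω, Real.exp (s * X ω ^ 2) ∂μ ≤ 2 := by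
  have key : ∫⁻ ω, ENNReal.ofReal (Real.exp (s * X ω ^ 2)) ∂μ ≤ ENNReal.ofReal 2 := by
    calc ∫⁻ ω, ENNReal.ofReal (Real.exp (s * X ω ^ 2)) ∂μ
        = ∫⁻ ω, ∫⁻ x, ENNReal.ofReal (Real.exp (√(2 * s) * X ω * x)) ∂(gaussianReal 0 1) ∂μ := by
          refine lintegral_congr fun ω => ?_
          rw [lintegral_exp_mul_gaussianReal, mul_pow, Real.sq_sqrt (by positivity)]
          congr 2
          ring
      _ = ∫⁻ x, ∫⁻ ω, ENNReal.ofReal (Real.exp (√(2 * s) * X ω * x)) ∂μ ∂(gaussianReal 0 1) := by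
          refine lintegral_lintegral_swap (Measurable.aemeasurable ?_)
          have : Measurable fun p : Ω × ℝ => √(2 * s) * X p.1 * p.2 :=
            ((hX.comp measurable_fst).const_mul _).mul measurable_snd
          exact this.exp.ennreal_ofReal
      _ ≤ ∫⁻ x, ENNReal.ofReal (Real.exp (x ^ 2 / 4)) ∂(gaussianReal 0 1) := by
          refine lintegral_mono fun x => ?_
          have e : ∀ ω, √(2 * s) * X ω * x = (√(2 * s) * x) * X ω := fun ω => by ring
          simp_rw [e]
          rw [← ofReal_integral_eq_lintegral_ofReal (h.integrable_exp_mul _)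
            (Filter.Eventually.of_forall fun ω => (Real.exp_pos _).le)]
          refine ENNReal.ofReal_le_ofReal ((h.mgf_le _).trans (Real.exp_le_exp.2 ?_))
          rw [mul_pow, Real.sq_sqrt (by positivity)]
          nlinarith [sq_nonneg x]
      _ ≤ _ := lintegral_exp_sq_gaussianReal_le
  have hm : Measurable fun ω => Real.exp (s * X ω ^ 2) := ((hX.pow_const 2).const_mul s).exp
  have hint : Integrable (fun ω => Real.exp (s * X ω ^ 2)) μ := by
    refine ⟨hm.aestronglyMeasurable, ?_⟩
    rw [hasFiniteIntegral_iff_ofReal (Filter.Eventually.of_forall fun ω => (Real.exp_pos _).le)]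
    exact key.trans_lt ENNReal.ofReal_lt_top
  refine ⟨hint, ?_⟩
  rw [← ofReal_integral_eq_lintegral_ofReal hint
    (Filter.Eventually.of_forall fun ω => (Real.exp_pos _).le)] at key
  exact (ENNReal.ofReal_le_ofReal_iff (by norm_num)).1 key

/-- `W` is sub-exponential: `E[exp (t W)] ≤ exp (V t ^ 2)` for `|t| ≤ τ`. -/
def IsSubExp (W : Ω → ℝ) (V τ : ℝ) (μ : Measure Ω) : Prop :=
  ∀ t : ℝ, |t| ≤ τ → Integrable (fun ω => Real.exp (t * W ω)) μ ∧
    ∫ ω, Real.exp (t * W ω) ∂μ ≤ Real.exp (V * t ^ 2)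

theorem exp_le_one_add_add_sq_mul (x : ℝ) : Real.exp x ≤ 1 + x + x ^ 2 * Real.exp |x| := by
  have h1 : 1 ≤ Real.exp |x| := Real.one_le_exp (abs_nonneg x)
  rcases le_or_gt |x| 1 with h | h
  · have := (abs_le.1 (Real.abs_exp_sub_one_sub_id_le h)).2
    nlinarith [sq_nonneg x]
  · rcases lt_abs.1 h with hx | hx
    · rw [abs_of_pos (by linarith)]
      have : Real.exp x * 1 ≤ Real.exp x * x ^ 2 := by
        gcongr
        nlinarith
      nlinarith
    · have : Real.exp x ≤ 1 := Real.exp_le_one_iff.2 (by linarith)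
      nlinarith

/-- In e^x ≤ 1 + x + x² e^|x| with x = t W, the mean of the linear term vanishes. For |t| ≤ s / 2,
half of the exponent s |W| pays for e^|x| and the other half for W². -/
theorem isSubExp_of_integral_exp_abs_le [IsProbabilityMeasure μ] {W : Ω → ℝ} (hW : Measurable W)
    {s K : ℝ} (hs : 0 < s) (hi : Integrable (fun ω => Real.exp (s * |W ω|)) μ)
    (hK : ∫ ω, Real.exp (s * |W ω|) ∂μ ≤ K) (h0 : ∫ ω, W ω ∂μ = 0) :
    IsSubExp W (8 * K / s ^ 2) (s / 2) μ := by
  intro t ht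
  have hWi : Integrable W μ := by
    refine Integrable.mono' (hi.const_mul s⁻¹) hW.aestronglyMeasurable
      (Filter.Eventually.of_forall fun ω => ?_)
    rw [Real.norm_eq_abs, ← div_eq_inv_mul, le_div_iff₀ hs]
    linarith [Real.add_one_le_exp (s * |W ω|)]
  have hb : ∀ ω, Real.exp (t * W ω) ≤
      1 + t * W ω + (8 / s ^ 2 * t ^ 2) * Real.exp (s * |W ω|) := by
    intro ω
    refine (exp_le_one_add_add_sq_mul _).trans ?_
    refine add_le_add_right ?_ _
    set y := s / 2 * |W ω| with hy
    have hy0 : 0 ≤ y := by positivity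
    have h1 : Real.exp |t * W ω| ≤ Real.exp y := by
      rw [Real.exp_le_exp, abs_mul]
      exact mul_le_mul_of_nonneg_right ht (abs_nonneg _)
    have h2 : y ^ 2 / 2 ≤ Real.exp y := by
      have := Real.quadratic_le_exp_of_nonneg hy0
      linarith
    have h3 : W ω ^ 2 = 8 / s ^ 2 * (y ^ 2 / 2) := by
      rw [hy, mul_pow, sq_abs]
      field_simp
      ring
    calc (t * W ω) ^ 2 * Real.exp |t * W ω|
        = t ^ 2 * (8 / s ^ 2 * (y ^ 2 / 2)) * Real.exp |t * W ω| := by rw [mul_pow, h3]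
      _ ≤ t ^ 2 * (8 / s ^ 2 * Real.exp y) * Real.exp y := by gcongr
      _ = 8 / s ^ 2 * t ^ 2 * (Real.exp y * Real.exp y) := by ring
      _ = _ := by
        rw [← Real.exp_add, hy]
        congr 2
        ring
  have hdom : Integrable (fun ω => 1 + t * W ω + (8 / s ^ 2 * t ^ 2) * Real.exp (s * |W ω|)) μ :=
    ((integrable_const _).add (hWi.const_mul t)).add (hi.const_mul _)
  have hint : Integrable (fun ω => Real.exp (t * W ω)) μ := by
    refine Integrable.mono' hdom (hW.const_mul t).exp.aestronglyMeasurable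
      (Filter.Eventually.of_forall fun ω => ?_)
    rw [Real.norm_of_nonneg (Real.exp_pos _).le]
    exact hb ω
  refine ⟨hint, (integral_mono hint hdom hb).trans ?_⟩
  have e : ∫ ω, (1 + t * W ω + (8 / s ^ 2 * t ^ 2) * Real.exp (s * |W ω|)) ∂μ =
      ∫ _, (1 : ℝ) ∂μ + ∫ ω, t * W ω ∂μ + ∫ ω, (8 / s ^ 2 * t ^ 2) * Real.exp (s * |W ω|) ∂μ := by
    rw [← integral_add (integrable_const _) (hWi.const_mul t)]
    exact integral_add ((integrable_const _).add (hWi.const_mul t)) (hi.const_mul _)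
  rw [e, integral_const_mul, integral_const_mul, h0]
  simp only [integral_const, probReal_univ, smul_eq_mul, mul_one, mul_zero, add_zero]
  calc 1 + 8 / s ^ 2 * t ^ 2 * ∫ ω, Real.exp (s * |W ω|) ∂μ
      ≤ 1 + 8 / s ^ 2 * t ^ 2 * K := by gcongr
    _ = 8 * K / s ^ 2 * t ^ 2 + 1 := by ring
    _ ≤ _ := Real.add_one_le_exp _

theorem IsSubExp.integral_sq_le {W : Ω → ℝ} {V τ : ℝ} (hW : Measurable W)
    (h : IsSubExp W V τ μ) (hτ : 0 < τ) :
    Integrable (fun ω => W ω ^ 2) μ ∧ ∫ ω, W ω ^ 2 ∂μ ≤ 4 / τ ^ 2 * Real.exp (V * τ ^ 2) := by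
  obtain ⟨hi1, h1⟩ := h τ (by rw [abs_of_pos hτ])
  obtain ⟨hi2, h2⟩ := h (-τ) (by rw [abs_neg, abs_of_pos hτ])
  have hb : ∀ ω, W ω ^ 2 ≤ 2 / τ ^ 2 * (Real.exp (τ * W ω) + Real.exp (-τ * W ω)) := by
    intro ω
    have h3 : (τ * W ω) ^ 2 / 2 ≤ Real.exp |τ * W ω| := by
      have := Real.quadratic_le_exp_of_nonneg (abs_nonneg (τ * W ω))
      rw [sq_abs] at this
      linarith [abs_nonneg (τ * W ω)]
    have h4 : Real.exp |τ * W ω| ≤ Real.exp (τ * W ω) + Real.exp (-τ * W ω) := by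
      rcases abs_cases (τ * W ω) with ⟨h, -⟩ | ⟨h, -⟩ <;> rw [h]
      · linarith [Real.exp_pos (-τ * W ω)]
      · rw [← neg_mul]
        linarith [Real.exp_pos (τ * W ω)]
    calc W ω ^ 2 = 2 / τ ^ 2 * ((τ * W ω) ^ 2 / 2) := by field_simp
      _ ≤ _ := by gcongr; exact h3.trans h4
  have hdom := (hi1.add hi2).const_mul (2 / τ ^ 2)
  have hint : Integrable (fun ω => W ω ^ 2) μ := by
    refine Integrable.mono' hdom (hW.pow_const 2).aestronglyMeasurable
      (Filter.Eventually.of_forall fun ω => ?_)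
    rw [Real.norm_of_nonneg (sq_nonneg _)]
    exact hb ω
  refine ⟨hint, (integral_mono hint hdom hb).trans ?_⟩
  simp only [Pi.add_apply]
  rw [integral_const_mul, integral_add hi1 hi2]
  rw [neg_sq] at h2
  calc 2 / τ ^ 2 * (∫ ω, Real.exp (τ * W ω) ∂μ + ∫ ω, Real.exp (-τ * W ω) ∂μ)
      ≤ 2 / τ ^ 2 * (Real.exp (V * τ ^ 2) + Real.exp (V * τ ^ 2)) := by gcongr
    _ = _ := by ring

theorem IsSubExp.measureReal_ge_le [IsFiniteMeasure μ] {W : Ω → ℝ} {V τ : ℝ}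
    (h : IsSubExp W V τ μ) {t : ℝ} (ht0 : 0 ≤ t) (ht : t ≤ τ) (r : ℝ) :
    μ.real {ω | r ≤ W ω} ≤ Real.exp (-(t * r) + V * t ^ 2) := by
  obtain ⟨hi, h1⟩ := h t (by rwa [abs_of_nonneg ht0])
  refine (measure_ge_le_exp_mul_mgf r ht0 hi).trans ?_
  rw [Real.exp_add, ← neg_mul]
  gcongr
  exact h1

theorem IsSubExp.measureReal_abs_ge_le [IsFiniteMeasure μ] {W : Ω → ℝ} {V τ : ℝ}
    (h : IsSubExp W V τ μ) {t : ℝ} (ht0 : 0 ≤ t) (ht : t ≤ τ) (r : ℝ) :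
    μ.real {ω | r ≤ |W ω|} ≤ 2 * Real.exp (-(t * r) + V * t ^ 2) := by
  have hneg : IsSubExp (fun ω => -W ω) V τ μ := by
    intro t ht
    have := h (-t) (by rwa [abs_neg])
    simpa using this
  have hsub : {ω | r ≤ |W ω|} ⊆ {ω | r ≤ W ω} ∪ {ω | r ≤ -W ω} := by
    intro ω hω
    rcases le_abs.1 (show r ≤ |W ω| from hω) with h | h
    · exact Or.inl h
    · exact Or.inr h
  calc _ ≤ μ.real {ω | r ≤ W ω} + μ.real {ω | r ≤ -W ω} :=
        (measureReal_mono hsub).trans (measureReal_union_le _ _)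
    _ ≤ _ := by
        rw [two_mul]
        exact add_le_add (h.measureReal_ge_le ht0 ht r) (hneg.measureReal_ge_le ht0 ht r)

/-- Moment generating functions multiply; the admissible range of t shrinks by the largest
coefficient. -/
theorem IsSubExp.sum [IsProbabilityMeasure μ] {ι : Type*} {W : ι → Ω → ℝ}
    (hW : ∀ i, Measurable (W i)) (hind : iIndepFun W μ) {V τ : ℝ} (h : ∀ i, IsSubExp (W i) V τ μ)
    {b τ' : ℝ} {c : ι → ℝ} (hc : ∀ i, |c i| ≤ b) (hb : τ' * b ≤ τ) {q : ℝ}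
    (s : Finset ι) (hq : V * ∑ i ∈ s, c i ^ 2 ≤ q) :
    IsSubExp (fun ω => ∑ i ∈ s, c i * W i ω) q τ' μ := by
  intro t ht
  have hcW : ∀ i, Measurable fun ω => c i * W i ω := fun i => (hW i).const_mul _
  have hind' : iIndepFun (fun i ω => c i * W i ω) μ :=
    hind.comp (fun i x => c i * x) fun i => measurable_const_mul _
  have hi : ∀ i, Integrable (fun ω => Real.exp (t * (c i * W i ω))) μ ∧
      ∫ ω, Real.exp (t * (c i * W i ω)) ∂μ ≤ Real.exp (V * (t * c i) ^ 2) := by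
    intro i
    have hb0 : 0 ≤ b := (abs_nonneg _).trans (hc i)
    have := h i (t * c i) (by
      rw [abs_mul]
      exact (mul_le_mul ht (hc i) (abs_nonneg _) ((abs_nonneg _).trans ht)).trans hb)
    simpa only [mul_assoc] using this
  have hint := hind'.integrable_exp_mul_sum (t := t) hcW (s := s) fun i _ => (hi i).1
  have hmgf := hind'.mgf_sum (t := t) hcW s
  simp only [mgf, Finset.sum_apply] at hint hmgf
  refine ⟨hint, ?_⟩
  rw [hmgf]
  calc ∏ i ∈ s, ∫ ω, Real.exp (t * (c i * W i ω)) ∂μ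
      ≤ ∏ i ∈ s, Real.exp (V * (t * c i) ^ 2) :=
        Finset.prod_le_prod (fun i _ => integral_nonneg fun ω => (Real.exp_pos _).le)
          fun i _ => (hi i).2
    _ = Real.exp ((V * ∑ i ∈ s, c i ^ 2) * t ^ 2) := by
        rw [← Real.exp_sum, Finset.mul_sum, Finset.sum_mul]
        congr 1
        exact Finset.sum_congr rfl fun i _ => by ring
    _ ≤ _ := by
        gcongr

/-- Centered products of sub-gaussian variables are sub-exponential. -/
theorem isSubExp_add_mul_sub [IsProbabilityMeasure μ] {X Y Q : Ω → ℝ} (hX : Measurable X)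
    (hY : Measurable Y) (hQ : Measurable Q) {vX vY vQ : ℝ≥0} (hXs : HasSubgaussianMGF X vX μ)
    (hYs : HasSubgaussianMGF Y vY μ) (hQs : HasSubgaussianMGF Q vQ μ) {s m : ℝ} (hs : 0 < s)
    (hvX : 12 * vX * s ≤ 1) (hvY : 12 * vY * s ≤ 1) (hvQ : 12 * vQ * s ≤ 1)
    (hm : ∫ ω, (X ω + Y ω) * Q ω ∂μ = m) (hms : s * |m| ≤ 1) :
    IsSubExp (fun ω => (X ω + Y ω) * Q ω - m) (8 * (2 * Real.exp 1) / s ^ 2) (s / 2) μ := by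
  obtain ⟨iX, bX⟩ := integrable_exp_sq_of_hasSubgaussianMGF hX hXs (s := 3 * s) (by positivity)
    (by linarith)
  obtain ⟨iY, bY⟩ := integrable_exp_sq_of_hasSubgaussianMGF hY hYs (s := 3 * s) (by positivity)
    (by linarith)
  obtain ⟨iQ, bQ⟩ := integrable_exp_sq_of_hasSubgaussianMGF hQ hQs (s := 3 * s) (by positivity)
    (by linarith)
  have hP : Measurable fun ω => (X ω + Y ω) * Q ω := (hX.add hY).mul hQ
  have hdom := ((iX.add iY).add iQ).const_mul (Real.exp 1 / 3)
  have hb : ∀ ω, Real.exp (s * |(X ω + Y ω) * Q ω - m|) ≤ Real.exp 1 / 3 *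
      (Real.exp (3 * s * X ω ^ 2) + Real.exp (3 * s * Y ω ^ 2) + Real.exp (3 * s * Q ω ^ 2)) := by
    intro ω
    have h1 : |(X ω + Y ω) * Q ω - m| ≤ X ω ^ 2 + Y ω ^ 2 + Q ω ^ 2 + |m| := by
      refine (abs_sub _ _).trans ?_
      gcongr
      rw [abs_le]
      constructor <;> nlinarith [sq_nonneg (X ω + Y ω - Q ω), sq_nonneg (X ω + Y ω + Q ω),
        sq_nonneg (X ω - Y ω), sq_nonneg (Q ω)]
    set A := Real.exp (s * X ω ^ 2) with hA
    set B := Real.exp (s * Y ω ^ 2) with hB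
    set C := Real.exp (s * Q ω ^ 2) with hC
    have hA3 : Real.exp (3 * s * X ω ^ 2) = A ^ 3 := by
      rw [hA, ← Real.exp_nat_mul]; congr 1; push_cast; ring
    have hB3 : Real.exp (3 * s * Y ω ^ 2) = B ^ 3 := by
      rw [hB, ← Real.exp_nat_mul]; congr 1; push_cast; ring
    have hC3 : Real.exp (3 * s * Q ω ^ 2) = C ^ 3 := by
      rw [hC, ← Real.exp_nat_mul]; congr 1; push_cast; ring
    rw [hA3, hB3, hC3]
    have hA0 : 0 < A := Real.exp_pos _
    have hB0 : 0 < B := Real.exp_pos _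
    have hC0 : 0 < C := Real.exp_pos _
    -- AM–GM separates the three exponentials without any independence, at the price of the exponent
    -- 3 s; this is why the hypotheses read 12 v s ≤ 1, that is 4 v (3 s) ≤ 1.
    have hABC : 3 * (A * B * C) ≤ A ^ 3 + B ^ 3 + C ^ 3 := by
      nlinarith [mul_nonneg (add_pos (add_pos hA0 hB0) hC0).le
        (add_nonneg (add_nonneg (sq_nonneg (A - B)) (sq_nonneg (B - C))) (sq_nonneg (A - C)))]
    calc Real.exp (s * |(X ω + Y ω) * Q ω - m|)
        ≤ Real.exp (s * X ω ^ 2 + s * Y ω ^ 2 + s * Q ω ^ 2 + 1) := by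
          rw [Real.exp_le_exp]
          nlinarith
      _ = Real.exp 1 / 3 * (3 * (A * B * C)) := by
          rw [Real.exp_add, Real.exp_add, Real.exp_add]; ring
      _ ≤ _ := by gcongr
  have hint : Integrable (fun ω => Real.exp (s * |(X ω + Y ω) * Q ω - m|)) μ := by
    refine Integrable.mono' hdom ((hP.sub_const m).abs.const_mul s).exp.aestronglyMeasurable
      (Filter.Eventually.of_forall fun ω => ?_)
    rw [Real.norm_of_nonneg (Real.exp_pos _).le]
    exact hb ω
  have hPi : Integrable (fun ω => (X ω + Y ω) * Q ω - m) μ := by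
    refine Integrable.mono' (hint.const_mul s⁻¹) (hP.sub_const m).aestronglyMeasurable
      (Filter.Eventually.of_forall fun ω => ?_)
    rw [Real.norm_eq_abs, ← div_eq_inv_mul, le_div_iff₀ hs]
    linarith [Real.add_one_le_exp (s * |(X ω + Y ω) * Q ω - m|)]
  have hPi' : Integrable (fun ω => (X ω + Y ω) * Q ω) μ := by
    have := hPi.add (integrable_const m)
    refine this.congr (Filter.Eventually.of_forall fun ω => ?_)
    simp
  refine isSubExp_of_integral_exp_abs_le (hP.sub_const m) hs hint ?_ ?_
  · refine (integral_mono hint hdom hb).trans ?_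
    have e : ∫ ω, (Real.exp (3 * s * X ω ^ 2) + Real.exp (3 * s * Y ω ^ 2) +
        Real.exp (3 * s * Q ω ^ 2)) ∂μ = ∫ ω, Real.exp (3 * s * X ω ^ 2) ∂μ +
        ∫ ω, Real.exp (3 * s * Y ω ^ 2) ∂μ + ∫ ω, Real.exp (3 * s * Q ω ^ 2) ∂μ := by
      rw [← integral_add iX iY]
      exact integral_add (iX.add iY) iQ
    simp only [Pi.add_apply]
    rw [integral_const_mul, e]
    have := Real.exp_pos 1
    nlinarith
  · rw [integral_sub hPi' (integrable_const m), hm]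
    simp

end SharedRep
end

/-! ### Nets and the linear terms -/

noncomputable section
namespace SharedRep

open Matrix
open scoped Matrix.Norms.L2Operator

/-- A largest ½-separated subset of the ball is a ½-net. Doubled, it is 1-separated in the ball of
radius 2, where at most 5^d such points fit. -/
theorem exists_half_net (d : ℕ) : ∃ T : Finset (EuclideanSpace ℝ (Fin d)), T.card ≤ 5 ^ d ∧
    (∀ v ∈ T, ‖v‖ ≤ 1) ∧ ∀ x : EuclideanSpace ℝ (Fin d), ‖x‖ ≤ 1 → ∃ v ∈ T, ‖x - v‖ ≤ 1 / 2 := by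
  classical
  set Sep : Finset (EuclideanSpace ℝ (Fin d)) → Prop := fun T =>
    (∀ v ∈ T, ‖v‖ ≤ 1) ∧ ∀ u ∈ T, ∀ v ∈ T, u ≠ v → 1 / 2 ≤ ‖u - v‖ with hSep
  have hcard : ∀ T, Sep T → T.card ≤ 5 ^ d := by
    intro T hT
    have hinj : Function.Injective fun v : EuclideanSpace ℝ (Fin d) => (2 : ℝ) • v :=
      smul_right_injective _ two_ne_zero
    have h := Besicovitch.card_le_of_separated (T.image fun v => (2 : ℝ) • v) ?_ ?_
    · rwa [Finset.card_image_of_injective _ hinj, finrank_euclideanSpace_fin] at h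
    · intro c hc
      obtain ⟨v, hv, rfl⟩ := Finset.mem_image.1 hc
      rw [norm_smul, Real.norm_ofNat]
      linarith [hT.1 v hv]
    · intro c hc c' hc' hne
      obtain ⟨v, hv, rfl⟩ := Finset.mem_image.1 hc
      obtain ⟨v', hv', rfl⟩ := Finset.mem_image.1 hc'
      rw [← smul_sub, norm_smul, Real.norm_ofNat]
      have := hT.2 v hv v' hv' fun h => hne (by rw [h])
      linarith
  obtain ⟨T, hT, hmax⟩ : ∃ T, Sep T ∧ ∀ T', Sep T' → T'.card ≤ T.card := by
    have hne : ({m | ∃ T, Sep T ∧ T.card = m} : Set ℕ).Nonempty := ⟨0, ∅, by simp [hSep], rfl⟩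
    have hbdd : BddAbove ({m | ∃ T, Sep T ∧ T.card = m} : Set ℕ) :=
      ⟨5 ^ d, by rintro m ⟨T, hT, rfl⟩; exact hcard T hT⟩
    obtain ⟨T, hT, hTc⟩ := Nat.sSup_mem hne hbdd
    exact ⟨T, hT, fun T' hT' => hTc ▸ le_csSup hbdd ⟨T', hT', rfl⟩⟩
  refine ⟨T, hcard T hT, hT.1, fun x hx => ?_⟩
  by_contra! hfar
  have hxT : x ∉ T := fun h => by
    have := hfar x h
    rw [sub_self, norm_zero] at this
    linarith
  have := hmax (insert x T) ⟨?_, ?_⟩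
  · rw [Finset.card_insert_of_notMem hxT] at this
    omega
  · intro v hv
    rcases Finset.mem_insert.1 hv with rfl | hv
    · exact hx
    · exact hT.1 v hv
  · intro u hu v hv huv
    rcases Finset.mem_insert.1 hu with hux | hu <;> rcases Finset.mem_insert.1 hv with hvx | hv
    · exact absurd (hux.trans hvx.symm) huv
    · rw [hux]; exact (hfar v hv).le
    · rw [hvx, norm_sub_rev]; exact (hfar u hu).le
    · exact hT.2 u hu v hv huv

/-- Approximating the left vector by the net costs a factor 2. Approximating the right one gives ‖A‖
≤ 2 r + ‖A‖ / 2, and the last term is absorbed. -/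
theorem l2_opNorm_le_of_net {d : ℕ} {T : Finset (EuclideanSpace ℝ (Fin d))}
    (hT : ∀ x : EuclideanSpace ℝ (Fin d), ‖x‖ ≤ 1 → ∃ v ∈ T, ‖x - v‖ ≤ 1 / 2)
    (A : Matrix (Fin d) (Fin d) ℝ) {r : ℝ} (hr : 0 ≤ r)
    (h : ∀ u ∈ T, ∀ v ∈ T, |u.ofLp ⬝ᵥ (A *ᵥ v.ofLp)| ≤ r) : ‖A‖ ≤ 4 * r := by
  have hdual : ∀ y : EuclideanSpace ℝ (Fin d), (∀ u ∈ T, |inner ℝ u y| ≤ r) → ‖y‖ ≤ 2 * r := by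
    intro y hy
    rcases eq_or_ne y 0 with rfl | hy0
    · rw [norm_zero]; positivity
    have hyp : 0 < ‖y‖ := norm_pos_iff.2 hy0
    obtain ⟨u, hu, hxu⟩ := hT ((‖y‖)⁻¹ • y) (by
      rw [norm_smul, norm_inv, norm_norm, inv_mul_cancel₀ hyp.ne'])
    have h1 : inner ℝ ((‖y‖)⁻¹ • y) y = ‖y‖ := by
      rw [real_inner_smul_left, real_inner_self_eq_norm_sq]
      field_simp
    have h2 : inner ℝ ((‖y‖)⁻¹ • y - u) y ≤ 1 / 2 * ‖y‖ :=
      (real_inner_le_norm _ _).trans (by gcongr)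
    rw [inner_sub_left, h1] at h2
    have := (abs_le.1 (hy u hu)).2
    linarith
  have hnet : ∀ v ∈ T, ‖WithLp.toLp 2 (A *ᵥ v.ofLp)‖ ≤ 2 * r := by
    intro v hv
    refine hdual _ fun u hu => ?_
    have := h u hu v hv
    rw [EuclideanSpace.inner_eq_star_dotProduct, star_trivial, dotProduct_comm]
    exact this
  have hball : ∀ x : EuclideanSpace ℝ (Fin d), ‖x‖ ≤ 1 →
      ‖WithLp.toLp 2 (A *ᵥ x.ofLp)‖ ≤ 2 * r + ‖A‖ / 2 := by
    intro x hx
    obtain ⟨v, hv, hxv⟩ := hT x hx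
    have e : WithLp.toLp 2 (A *ᵥ x.ofLp) =
        WithLp.toLp 2 (A *ᵥ v.ofLp) + WithLp.toLp 2 (A *ᵥ (x - v).ofLp) := by
      rw [← WithLp.toLp_add, ← mulVec_add]
      simp
    rw [e]
    refine (norm_add_le _ _).trans (add_le_add (hnet v hv) ?_)
    refine (norm_toLp_mulVec_le A _).trans ?_
    rw [div_eq_mul_one_div]
    gcongr
  have := l2_opNorm_le_of_forall A (K := 2 * r + ‖A‖ / 2) (by positivity) fun x => by
    rcases eq_or_ne x 0 with rfl | hx0
    · simp
    have hxp : 0 < ‖WithLp.toLp 2 x‖ := by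
      rw [norm_pos_iff]
      simpa using hx0
    have h1 := hball ((‖WithLp.toLp 2 x‖)⁻¹ • WithLp.toLp 2 x) (by
      rw [norm_smul, norm_inv, norm_norm, inv_mul_cancel₀ hxp.ne'])
    rw [WithLp.ofLp_smul, mulVec_smul, WithLp.toLp_smul, norm_smul, norm_inv, norm_norm,
      ← div_eq_inv_mul, div_le_iff₀ hxp] at h1
    exact h1
  linarith

variable {Ω : Type*} [MeasurableSpace Ω] {μ : Measure Ω} [IsProbabilityMeasure μ]

/-- Operator norm bound for a sum of independent random vectors times fixed vectors. -/
theorem measureReal_norm_sum_vecMulVec_le {ι : Type*} [Fintype ι] {d : ℕ} (hd : 1 ≤ d)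
    {g : ι → Ω → EuclideanSpace ℝ (Fin d)} (hg : ∀ p, Measurable (g p)) (hind : iIndepFun g μ)
    {V τ : ℝ} (hV : 0 ≤ V)
    (hsub : ∀ p (u : EuclideanSpace ℝ (Fin d)), ‖u‖ ≤ 1 →
      IsSubExp (fun ω => inner ℝ u (g p ω)) V τ μ)
    (w : ι → EuclideanSpace ℝ (Fin d)) {b κ : ℝ} (hw : ∀ p, ‖w p‖ ≤ b) (hκ : 0 < κ) (hb : κ * b ≤ τ)
    {S : ℝ} (hS : ∀ v : EuclideanSpace ℝ (Fin d), ‖v‖ ≤ 1 → ∑ p, (inner ℝ (w p) v) ^ 2 ≤ S)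
    (hdS : (d : ℝ) ≤ S) {L : ℝ} (hL : 1 ≤ L) :
    μ.real {ω | 4 * ((14 + V * κ ^ 2) / κ * √(d * S) * L) <
      ‖∑ p, vecMulVec (g p ω).ofLp (w p).ofLp‖} ≤ 2 * Real.exp (-(10 * L)) := by
  obtain ⟨T, hTc, hT1, hT⟩ := exists_half_net d
  have hd0 : (1 : ℝ) ≤ d := by exact_mod_cast hd
  have hS0 : 0 < S := by linarith
  set r := (14 + V * κ ^ 2) / κ * √(d * S) * L with hr
  have hr0 : 0 ≤ r := by positivity
  -- This t gives t r = (14 + V κ²) d L against a variance cost V κ² d, leaving 14 d L. It is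
  -- admissible, t ≤ κ, exactly because d ≤ S.
  set t := κ * √(d / S) with ht
  have ht0 : 0 ≤ t := by positivity
  have htκ : t ≤ κ := by
    refine mul_le_of_le_one_right hκ.le ?_
    refine (Real.sqrt_le_sqrt ((div_le_one hS0).2 hdS)).trans Real.sqrt_one.le
  have hexp : -(t * r) + V * S * t ^ 2 ≤ -(14 * (d * L)) := by
    have h1 : √(d / S) * √(d * S) = d := by
      rw [← Real.sqrt_mul (by positivity), show (d : ℝ) / S * (d * S) = d * d by field_simp,
        Real.sqrt_mul_self (by positivity)]
    have h2 : t * r = (14 + V * κ ^ 2) * (d * L) := by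
      calc t * r = (κ * κ⁻¹) * (14 + V * κ ^ 2) * (√(d / S) * √(d * S)) * L := by
            rw [ht, hr]; ring
        _ = _ := by rw [h1, mul_inv_cancel₀ hκ.ne']; ring
    have h3 : V * S * t ^ 2 = V * κ ^ 2 * d := by
      rw [ht, mul_pow, Real.sq_sqrt (by positivity)]
      field_simp
    rw [h2, h3]
    have : V * κ ^ 2 * d * 1 ≤ V * κ ^ 2 * d * L := by gcongr
    linarith
  have hpt : ∀ u ∈ T, ∀ v ∈ T,
      μ.real {ω | r ≤ |∑ p, inner ℝ (w p) v * inner ℝ u (g p ω)|} ≤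
        2 * Real.exp (-(14 * (d * L))) := by
    intro u hu v hv
    have hind' : iIndepFun (fun p ω => inner ℝ u (g p ω)) μ :=
      hind.comp (fun _ x => inner ℝ u x) fun _ => by fun_prop
    have hsum := IsSubExp.sum (fun p => (by have := hg p; fun_prop)) hind'
      (fun p => hsub p u (hT1 u hu)) (b := b) (τ' := κ) (c := fun p => inner ℝ (w p) v)
      (fun p => (abs_real_inner_le_norm _ _).trans
        ((mul_le_of_le_one_right (norm_nonneg _) (hT1 v hv)).trans (hw p))) hb
      (q := V * S) Finset.univ (by gcongr; exact hS v (hT1 v hv))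
    refine (hsum.measureReal_abs_ge_le ht0 htκ r).trans ?_
    gcongr
  have hsubset : {ω | 4 * r < ‖∑ p, vecMulVec (g p ω).ofLp (w p).ofLp‖} ⊆
      ⋃ q ∈ T ×ˢ T, {ω | r ≤ |∑ p, inner ℝ (w p) q.2 * inner ℝ q.1 (g p ω)|} := by
    intro ω hω
    by_contra hno
    simp only [Set.mem_iUnion, not_exists] at hno
    refine absurd (l2_opNorm_le_of_net hT (∑ p, vecMulVec (g p ω).ofLp (w p).ofLp) hr0 ?_)
      (not_le.2 hω)
    intro u hu v hv
    have h1 := hno (u, v) (Finset.mem_product.2 ⟨hu, hv⟩)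
    have h2 : |∑ p, inner ℝ (w p) v * inner ℝ u (g p ω)| < r := not_le.1 h1
    have e : u.ofLp ⬝ᵥ ((∑ p, vecMulVec (g p ω).ofLp (w p).ofLp) *ᵥ v.ofLp) =
        ∑ p, inner ℝ (w p) v * inner ℝ u (g p ω) := by
      rw [sum_mulVec, dotProduct_sum]
      refine Finset.sum_congr rfl fun p _ => ?_
      rw [vecMulVec_mulVec, EuclideanSpace.inner_eq_star_dotProduct,
        EuclideanSpace.inner_eq_star_dotProduct, star_trivial, star_trivial]
      simp [dotProduct_comm]
    rw [e]
    exact h2.le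
  calc _ ≤ ∑ q ∈ T ×ˢ T, μ.real {ω | r ≤ |∑ p, inner ℝ (w p) q.2 * inner ℝ q.1 (g p ω)|} :=
        (measureReal_mono hsubset (measure_ne_top _ _)).trans (measureReal_biUnion_finset_le _ _)
    _ ≤ ∑ q ∈ T ×ˢ T, 2 * Real.exp (-(14 * (d * L))) := by
        refine Finset.sum_le_sum fun q hq => ?_
        rw [Finset.mem_product] at hq
        exact hpt q.1 hq.1 q.2 hq.2
    _ = ((T.card : ℝ) * T.card) * (2 * Real.exp (-(14 * (d * L)))) := by
        rw [Finset.sum_const, Finset.card_product, nsmul_eq_mul]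
        push_cast
        ring
    -- There are at most 5^(2d) ≤ e^(4d) pairs in the net, and 14 d L - 4 d ≥ 10 L.
    _ ≤ (Real.exp (2 * d) * Real.exp (2 * d)) * (2 * Real.exp (-(14 * (d * L)))) := by
        have h5 : (5 : ℝ) ≤ Real.exp 2 := by
          have := Real.quadratic_le_exp_of_nonneg (show (0 : ℝ) ≤ 2 by norm_num)
          linarith
        have : (T.card : ℝ) ≤ Real.exp (2 * d) := by
          calc (T.card : ℝ) ≤ 5 ^ d := by exact_mod_cast hTc
            _ ≤ (Real.exp 2) ^ d := by gcongr
            _ = Real.exp (2 * d) := by rw [← Real.exp_nat_mul]; ring_nf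
        gcongr
    _ = 2 * Real.exp (4 * d - 14 * (d * L)) := by
        rw [← Real.exp_add, mul_left_comm, ← Real.exp_add]
        congr 2
        ring
    _ ≤ 2 * Real.exp (-(10 * L)) := by
        gcongr
        nlinarith

end SharedRep
end

/-! ### Grouping independent families, truncation, symmetric dilation -/

noncomputable section

namespace ProbabilityTheory

/-- Grouping an independent family indexed by a sigma type gives an independent family. -/
theorem iIndepFun_curry {ι Ω : Type*} {mΩ : MeasurableSpace Ω} {P : Measure Ω} {κ : ι → Type*}
    {𝓧 : (i : ι) → κ i → Type*} {m𝓧 : ∀ i j, MeasurableSpace (𝓧 i j)}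
    {X : (i : ι) → (j : κ i) → Ω → 𝓧 i j} (mX : ∀ i j, Measurable (X i j))
    (h : iIndepFun (fun (p : (i : ι) × (κ i)) ω ↦ X p.1 p.2 ω) P) :
    iIndepFun (fun i ω ↦ (X i · ω)) P := by
  have h0 := h
  have := h.isProbabilityMeasure
  have : ∀ i j, IsProbabilityMeasure (P.map (X i j)) :=
    fun i j ↦ Measure.isProbabilityMeasure_map (mX i j).aemeasurable
  have : ∀ i, IsProbabilityMeasure (P.map (fun ω ↦ (X i · ω))) :=
    fun i ↦ Measure.isProbabilityMeasure_map (Measurable.aemeasurable (by fun_prop))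
  -- Independence says that the joint law is a product measure, and currying carries a product over
  -- pairs to a product of products.
  have hc : (MeasurableEquiv.piCurry 𝓧) ∘ (fun ω p ↦ X p.1 p.2 ω) = fun ω i j ↦ X i j ω := by
    ext; simp [Sigma.curry]
  rw [iIndepFun_iff_map_fun_eq_infinitePi_map (by fun_prop),
    ← (MeasurableEquiv.piCurry 𝓧).map_measurableEquiv_injective.eq_iff,
    Measure.map_map (by fun_prop) (by fun_prop), hc,
    Measure.infinitePi_map_piCurry (fun i j ↦ P.map (X i j))] at h
  rw [iIndepFun_iff_map_fun_eq_infinitePi_map (by fun_prop), h]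
  congrm Measure.infinitePi fun i ↦ ?_
  have hi : iIndepFun (X i) P := h0.precomp (g := Sigma.mk i) sigma_mk_injective
  rw [(iIndepFun_iff_map_fun_eq_infinitePi_map (by fun_prop)).1 hi]

end ProbabilityTheory

namespace SharedRep

open Matrix
open scoped Matrix.Norms.L2Operator

theorem exists_unit_of_lt_l2_opNorm {d : ℕ} {A : Matrix (Fin d) (Fin d) ℝ} {r : ℝ} (hr : 0 ≤ r)
    (h : r < ‖A‖) : ∃ u v : Fin d → ℝ, u ⬝ᵥ u = 1 ∧ v ⬝ᵥ v = 1 ∧ r ≤ u ⬝ᵥ (A *ᵥ v) := by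
  have hsq : ∀ x : EuclideanSpace ℝ (Fin d), x.ofLp ⬝ᵥ x.ofLp = ‖x‖ ^ 2 := by
    intro x
    rw [← real_inner_self_eq_norm_sq, EuclideanSpace.inner_eq_star_dotProduct, star_trivial]
  obtain ⟨x, hx⟩ : ∃ x : Fin d → ℝ, r * ‖WithLp.toLp 2 x‖ < ‖WithLp.toLp 2 (A *ᵥ x)‖ := by
    by_contra! hno
    exact absurd (l2_opNorm_le_of_forall A hr hno) (not_le.2 h)
  set y := WithLp.toLp 2 (A *ᵥ x) with hy
  have hyp : 0 < ‖y‖ := lt_of_le_of_lt (by positivity) hx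
  have hxp : 0 < ‖WithLp.toLp 2 x‖ := by
    rw [norm_pos_iff]
    rintro h0
    have : x = 0 := by simpa using h0
    rw [hy, this] at hyp
    simp at hyp
  refine ⟨(‖y‖)⁻¹ • y.ofLp, (‖WithLp.toLp 2 x‖)⁻¹ • x, ?_, ?_, ?_⟩
  · rw [smul_dotProduct, dotProduct_smul, hsq, smul_eq_mul, smul_eq_mul]
    field_simp
  · have := hsq (WithLp.toLp 2 x)
    rw [smul_dotProduct, dotProduct_smul, this, smul_eq_mul, smul_eq_mul]
    field_simp
  · have e : A *ᵥ x = y.ofLp := rfl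
    rw [mulVec_smul, e, smul_dotProduct, dotProduct_smul, hsq, smul_eq_mul, smul_eq_mul,
      show (‖y‖)⁻¹ * ((‖WithLp.toLp 2 x‖)⁻¹ * ‖y‖ ^ 2) = ‖y‖ / ‖WithLp.toLp 2 x‖ by field_simp,
      le_div_iff₀ hxp]
    exact hx.le

/-- Truncation of a vector to the ball of radius `K`. -/
def trunc {d : ℕ} (K : ℝ) (x : EuclideanSpace ℝ (Fin d)) : EuclideanSpace ℝ (Fin d) :=
  if ‖x‖ ≤ K then x else 0

section Trunc

variable {d : ℕ} {K : ℝ}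

theorem measurable_trunc : Measurable (trunc K : EuclideanSpace ℝ (Fin d) → _) :=
  Measurable.ite (measurableSet_le measurable_norm measurable_const) measurable_id measurable_const

theorem norm_trunc_le (hK : 0 ≤ K) (x : EuclideanSpace ℝ (Fin d)) : ‖trunc K x‖ ≤ K := by
  rw [trunc]
  split_ifs with h
  · exact h
  · simpa using hK

theorem inner_trunc_sq_le (w x : EuclideanSpace ℝ (Fin d)) :
    (inner ℝ w (trunc K x)) ^ 2 ≤ (inner ℝ w x) ^ 2 := by
  rw [trunc]
  split_ifs with h
  · exact le_rfl
  · rw [inner_zero_right, zero_pow two_ne_zero]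
    exact sq_nonneg _

variable {Ω : Type*} [MeasurableSpace Ω] {μ : Measure Ω} [IsProbabilityMeasure μ]
  {A : Ω → EuclideanSpace ℝ (Fin d)} {V τ : ℝ}

theorem integral_inner_sq_le (hA : Measurable A) (hτ : 0 < τ)
    (hsub : ∀ u : EuclideanSpace ℝ (Fin d), ‖u‖ ≤ 1 → IsSubExp (fun ω => inner ℝ u (A ω)) V τ μ)
    (w : EuclideanSpace ℝ (Fin d)) :
    Integrable (fun ω => (inner ℝ w (A ω)) ^ 2) μ ∧
      ∫ ω, (inner ℝ w (A ω)) ^ 2 ∂μ ≤ 4 / τ ^ 2 * Real.exp (V * τ ^ 2) * ‖w‖ ^ 2 := by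
  rcases eq_or_ne w 0 with rfl | hw
  · simp
  have hwp : 0 < ‖w‖ := norm_pos_iff.2 hw
  obtain ⟨h1, h2⟩ := (hsub ((‖w‖)⁻¹ • w) (by
    rw [norm_smul, norm_inv, norm_norm, inv_mul_cancel₀ hwp.ne'])).integral_sq_le
    (by fun_prop) hτ
  have e : ∀ ω, (inner ℝ w (A ω)) ^ 2 = ‖w‖ ^ 2 * (inner ℝ ((‖w‖)⁻¹ • w) (A ω)) ^ 2 := by
    intro ω
    rw [real_inner_smul_left]
    field_simp
  simp_rw [e]
  refine ⟨h1.const_mul _, ?_⟩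
  rw [integral_const_mul, mul_comm _ (‖w‖ ^ 2)]
  gcongr

/-- A norm above √d times a level forces some coordinate above that level. The exponent 12 leaves
room for two union bounds, over coordinates and over clients, each costing e^L. -/
theorem measureReal_norm_gt_le (hτ : 0 < τ)
    (hsub : ∀ u : EuclideanSpace ℝ (Fin d), ‖u‖ ≤ 1 → IsSubExp (fun ω => inner ℝ u (A ω)) V τ μ)
    {L : ℝ} (hL : 0 ≤ L) :
    μ.real {ω | 12 / τ * √d * L < ‖A ω‖} ≤
      d * (2 * Real.exp (V * τ ^ 2) * Real.exp (-(12 * L))) := by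
  have hsubset : {ω | 12 / τ * √d * L < ‖A ω‖} ⊆
      ⋃ a : Fin d, {ω | 12 / τ * L ≤ |inner ℝ (EuclideanSpace.single a (1 : ℝ)) (A ω)|} := by
    intro ω hω
    by_contra hno
    simp only [Set.mem_iUnion, not_exists] at hno
    refine absurd ?_ (not_le.2 (show 12 / τ * √d * L < ‖A ω‖ from hω))
    have h1 : ∀ a, |A ω a| < 12 / τ * L := fun a => by
      have : |inner ℝ (EuclideanSpace.single a (1 : ℝ)) (A ω)| < 12 / τ * L := not_le.1 (hno a)
      rwa [EuclideanSpace.inner_single_left, map_one, one_mul] at this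
    refine le_of_sq_le_sq ?_ (by positivity)
    rw [EuclideanSpace.real_norm_sq_eq]
    calc ∑ a, A ω a ^ 2 ≤ ∑ _a : Fin d, (12 / τ * L) ^ 2 := by
          refine Finset.sum_le_sum fun a _ => ?_
          rw [← sq_abs]
          have := h1 a
          gcongr
      _ = (12 / τ * √d * L) ^ 2 := by
          simp only [Finset.sum_const, Finset.card_univ, Fintype.card_fin, nsmul_eq_mul]
          rw [mul_pow, mul_pow, mul_pow, Real.sq_sqrt (by positivity)]
          ring
  calc _ ≤ ∑ a : Fin d, μ.real {ω | 12 / τ * L ≤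
          |inner ℝ (EuclideanSpace.single a (1 : ℝ)) (A ω)|} :=
        (measureReal_mono hsubset (measure_ne_top _ _)).trans (measureReal_iUnion_fintype_le _)
    _ ≤ ∑ _a : Fin d, 2 * Real.exp (V * τ ^ 2) * Real.exp (-(12 * L)) := by
        refine Finset.sum_le_sum fun a _ => ?_
        refine ((hsub _ (by simp)).measureReal_abs_ge_le hτ.le le_rfl _).trans (le_of_eq ?_)
        rw [mul_assoc, ← Real.exp_add]
        congr 2
        field_simp
        ring
    _ = _ := by simp

/-- As the untruncated mean is zero, the bias is the mean over the tail event. There |y| ≤ a y² +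
a⁻¹ with a = ε / ‖w‖, so the bias is controlled by a second moment and the tail probability. -/
theorem abs_integral_inner_trunc_le (hA : Measurable A) (hτ : 0 < τ) (hK : 0 ≤ K)
    (hsub : ∀ u : EuclideanSpace ℝ (Fin d), ‖u‖ ≤ 1 → IsSubExp (fun ω => inner ℝ u (A ω)) V τ μ)
    (hmean : ∀ u : EuclideanSpace ℝ (Fin d), ∫ ω, inner ℝ u (A ω) ∂μ = 0)
    {p ε : ℝ} (hε : 0 < ε) (hp : μ.real {ω | K < ‖A ω‖} ≤ p) (w : EuclideanSpace ℝ (Fin d)) :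
    |∫ ω, inner ℝ w (trunc K (A ω)) ∂μ| ≤
      (ε * (4 / τ ^ 2 * Real.exp (V * τ ^ 2)) + p / ε) * ‖w‖ := by
  rcases eq_or_ne w 0 with rfl | hw
  · simp
  have hwp : 0 < ‖w‖ := norm_pos_iff.2 hw
  obtain ⟨hi, hb⟩ := integral_inner_sq_le hA hτ hsub w
  have hset : MeasurableSet {ω | K < ‖A ω‖} := measurableSet_lt measurable_const hA.norm
  have hTm : Measurable fun ω => trunc K (A ω) := measurable_trunc.comp hA
  have hm : Measurable fun ω => inner ℝ w (A ω) := by fun_prop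
  have hmT : Measurable fun ω => inner ℝ w (trunc K (A ω)) := by fun_prop
  have hint : Integrable (fun ω => inner ℝ w (A ω)) μ := by
    refine Integrable.mono' (hi.add (integrable_const 1)) hm.aestronglyMeasurable
      (Filter.Eventually.of_forall fun ω => ?_)
    simp only [Pi.add_apply, Real.norm_eq_abs]
    nlinarith [sq_abs (inner ℝ w (A ω)), sq_nonneg (|inner ℝ w (A ω)| - 1)]
  have hintT : Integrable (fun ω => inner ℝ w (trunc K (A ω))) μ := by
    refine Integrable.of_bound hmT.aestronglyMeasurable (‖w‖ * K)
      (Filter.Eventually.of_forall fun ω => ?_)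
    refine (norm_inner_le_norm _ _).trans ?_
    gcongr
    exact norm_trunc_le hK _
  have h1 : ∫ ω, inner ℝ w (trunc K (A ω)) ∂μ =
      ∫ ω, (inner ℝ w (trunc K (A ω)) - inner ℝ w (A ω)) ∂μ := by
    rw [integral_sub hintT hint, hmean, sub_zero]
  have hind : Integrable ({ω | K < ‖A ω‖}.indicator fun _ => (1 : ℝ)) μ :=
    (integrable_const 1).indicator hset
  rw [h1]
  have hdom := (hi.const_mul (ε / ‖w‖)).add (hind.const_mul (‖w‖ / ε))
  have h2 : ∀ ω, ‖inner ℝ w (trunc K (A ω)) - inner ℝ w (A ω)‖ ≤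
      ε / ‖w‖ * (inner ℝ w (A ω)) ^ 2 +
        ‖w‖ / ε * {ω | K < ‖A ω‖}.indicator (fun _ => (1 : ℝ)) ω := by
    intro ω
    by_cases h : K < ‖A ω‖
    · rw [Set.indicator_of_mem (show ω ∈ {ω | K < ‖A ω‖} from h), trunc, if_neg (not_le.2 h),
        inner_zero_right, zero_sub, norm_neg, Real.norm_eq_abs]
      set y := inner ℝ w (A ω)
      set a := ε / ‖w‖ with ha
      have ha0 : 0 < a := by positivity
      have hinv : ‖w‖ / ε = a⁻¹ := by rw [ha, inv_div]
      rw [hinv, ← sq_abs]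
      have : 0 ≤ a⁻¹ * (a * |y| - 1) ^ 2 := by positivity
      have e : a⁻¹ * (a * |y| - 1) ^ 2 = a * |y| ^ 2 - 2 * |y| + a⁻¹ := by field_simp; ring
      have := abs_nonneg y
      linarith
    · rw [Set.indicator_of_notMem (show ω ∉ {ω | K < ‖A ω‖} from h), trunc, if_pos (not_lt.1 h),
        sub_self, norm_zero]
      positivity
  refine (norm_integral_le_of_norm_le hdom (Filter.Eventually.of_forall h2)).trans ?_
  have e : ∫ ω, (ε / ‖w‖ * (inner ℝ w (A ω)) ^ 2 +
      ‖w‖ / ε * {ω | K < ‖A ω‖}.indicator (fun _ => (1 : ℝ)) ω) ∂μ =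
      ε / ‖w‖ * ∫ ω, (inner ℝ w (A ω)) ^ 2 ∂μ + ‖w‖ / ε * μ.real {ω | K < ‖A ω‖} := by
    rw [integral_add (hi.const_mul _) (hind.const_mul _), integral_const_mul, integral_const_mul,
      integral_indicator_const _ hset]
    simp
  refine e.le.trans ?_
  calc _ ≤ ε / ‖w‖ * (4 / τ ^ 2 * Real.exp (V * τ ^ 2) * ‖w‖ ^ 2) + ‖w‖ / ε * p := by gcongr
    _ = _ := by field_simp

end Trunc

/-- The symmetric dilation of the rank one matrix `x yᵀ`. -/
def dilation {d : ℕ} (x y : EuclideanSpace ℝ (Fin d)) : Fin d ⊕ Fin d → Fin d ⊕ Fin d → ℝ :=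
  fromBlocks 0 (vecMulVec x.ofLp y.ofLp) (vecMulVec y.ofLp x.ofLp) 0

section Dilation

variable {d : ℕ}

theorem dilation_symm (x y : EuclideanSpace ℝ (Fin d)) (a b : Fin d ⊕ Fin d) :
    dilation x y a b = dilation x y b a := by
  rcases a with a | a <;> rcases b with b | b <;> simp [dilation, vecMulVec_apply, mul_comm]

theorem measurable_dilation :
    Measurable fun p : EuclideanSpace ℝ (Fin d) × EuclideanSpace ℝ (Fin d) =>
      dilation p.1 p.2 := by
  refine measurable_pi_iff.2 fun a => measurable_pi_iff.2 fun b => ?_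
  rcases a with a | a <;> rcases b with b | b <;>
    simp only [dilation, fromBlocks_apply₁₁, fromBlocks_apply₁₂, fromBlocks_apply₂₁,
      fromBlocks_apply₂₂, vecMulVec_apply, Matrix.zero_apply] <;> fun_prop

theorem dilation_mulVec (x y : EuclideanSpace ℝ (Fin d)) (w : Fin d ⊕ Fin d → ℝ) :
    of (dilation x y) *ᵥ w = Sum.elim
      (inner ℝ (WithLp.toLp 2 (w ∘ Sum.inr)) y • x.ofLp)
      (inner ℝ (WithLp.toLp 2 (w ∘ Sum.inl)) x • y.ofLp) := by
  have : of (dilation x y) = fromBlocks 0 (vecMulVec x.ofLp y.ofLp) (vecMulVec y.ofLp x.ofLp) 0 :=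
    rfl
  rw [this, fromBlocks_mulVec, zero_mulVec, zero_mulVec, zero_add, add_zero, vecMulVec_mulVec,
    vecMulVec_mulVec, EuclideanSpace.inner_eq_star_dotProduct,
    EuclideanSpace.inner_eq_star_dotProduct, star_trivial, star_trivial]
  simp

theorem dotProduct_dilation_mulVec (x y : EuclideanSpace ℝ (Fin d)) (w : Fin d ⊕ Fin d → ℝ) :
    w ⬝ᵥ (of (dilation x y) *ᵥ w) = 2 * (inner ℝ (WithLp.toLp 2 (w ∘ Sum.inl)) x *
      inner ℝ (WithLp.toLp 2 (w ∘ Sum.inr)) y) := by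
  have hw : w = Sum.elim (w ∘ Sum.inl) (w ∘ Sum.inr) := (Sum.elim_comp_inl_inr w).symm
  rw [dilation_mulVec]
  nth_rewrite 1 [hw]
  rw [sumElim_dotProduct_sumElim, dotProduct_smul, dotProduct_smul,
    EuclideanSpace.inner_eq_star_dotProduct, EuclideanSpace.inner_eq_star_dotProduct, star_trivial,
    star_trivial, smul_eq_mul, smul_eq_mul]
  simp only
  rw [dotProduct_comm (w ∘ Sum.inl), dotProduct_comm (w ∘ Sum.inr)]
  ring

theorem dilation_mulVec_dotProduct_self (x y : EuclideanSpace ℝ (Fin d)) (w : Fin d ⊕ Fin d → ℝ) :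
    (of (dilation x y) *ᵥ w) ⬝ᵥ (of (dilation x y) *ᵥ w) =
      (inner ℝ (WithLp.toLp 2 (w ∘ Sum.inr)) y) ^ 2 * ‖x‖ ^ 2 +
        (inner ℝ (WithLp.toLp 2 (w ∘ Sum.inl)) x) ^ 2 * ‖y‖ ^ 2 := by
  have hsq : ∀ x : EuclideanSpace ℝ (Fin d), x.ofLp ⬝ᵥ x.ofLp = ‖x‖ ^ 2 := by
    intro x
    rw [← real_inner_self_eq_norm_sq, EuclideanSpace.inner_eq_star_dotProduct, star_trivial]
  rw [dilation_mulVec, sumElim_dotProduct_sumElim, smul_dotProduct, dotProduct_smul,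
    smul_dotProduct, dotProduct_smul, hsq, hsq]
  simp only [smul_eq_mul]
  ring

theorem dotProduct_self_eq_norm_sq_add (w : Fin d ⊕ Fin d → ℝ) : w ⬝ᵥ w =
    ‖WithLp.toLp 2 (w ∘ Sum.inl)‖ ^ 2 + ‖WithLp.toLp 2 (w ∘ Sum.inr)‖ ^ 2 := by
  rw [EuclideanSpace.real_norm_sq_eq, EuclideanSpace.real_norm_sq_eq, dotProduct,
    Fintype.sum_sum_type]
  simp only [Function.comp_apply, pow_two]

end Dilation

end SharedRep
end

/-! ### The quadratic term: sums of products of independent vectors -/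

noncomputable section

namespace SharedRep

open Matrix
open scoped Matrix.Norms.L2Operator

variable {Ω : Type*} [MeasurableSpace Ω] {μ : Measure Ω} [IsProbabilityMeasure μ]

/-- Bernstein bound for the truncated products. -/
theorem measureReal_exists_dilation_le {ι : Type*} [Fintype ι] {d : ℕ} (hd : 1 ≤ d)
    {A F : ι → Ω → EuclideanSpace ℝ (Fin d)} (hA : ∀ i, Measurable (A i))
    (hF : ∀ i, Measurable (F i)) (hind : iIndepFun (fun i ω => (A i ω, F i ω)) μ)
    (hindAF : ∀ i, IndepFun (A i) (F i) μ) {V τ : ℝ} (hτ : 0 < τ)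
    (hsubA : ∀ i (u : EuclideanSpace ℝ (Fin d)), ‖u‖ ≤ 1 →
      IsSubExp (fun ω => inner ℝ u (A i ω)) V τ μ)
    (hsubF : ∀ i (u : EuclideanSpace ℝ (Fin d)), ‖u‖ ≤ 1 →
      IsSubExp (fun ω => inner ℝ u (F i ω)) V τ μ)
    {K t β : ℝ} (hK : 0 ≤ K) (ht : 0 < t) (htK : t * K ^ 2 ≤ 1) (hβ : 0 ≤ β)
    (hbA : ∀ i w, |∫ ω, inner ℝ w (trunc K (A i ω)) ∂μ| ≤ β * ‖w‖)
    (hbF : ∀ i w, |∫ ω, inner ℝ w (trunc K (F i ω)) ∂μ| ≤ β * ‖w‖) (r : ℝ) :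
    μ.real {ω | ∃ w, w ⬝ᵥ w = 1 ∧
      r ≤ w ⬝ᵥ (of (∑ i, dilation (trunc K (A i ω)) (trunc K (F i ω))) *ᵥ w)} ≤
      (2 * d) * Real.exp (-(t * r) + Fintype.card ι *
        (t * β ^ 2 + t ^ 2 * (d * (4 / τ ^ 2 * Real.exp (V * τ ^ 2)) ^ 2))) := by
  set c := 4 / τ ^ 2 * Real.exp (V * τ ^ 2) with hc
  have hc0 : 0 < c := by positivity
  have hTm : ∀ {B : Ω → EuclideanSpace ℝ (Fin d)}, Measurable B →
      Measurable fun ω => trunc K (B ω) := fun hB => measurable_trunc.comp hB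
  have hindT : ∀ i, IndepFun (fun ω => trunc K (A i ω)) (fun ω => trunc K (F i ω)) μ := fun i =>
    (hindAF i).comp measurable_trunc measurable_trunc
  have hmom : ∀ {B : Ω → EuclideanSpace ℝ (Fin d)}, Measurable B →
      (∀ u : EuclideanSpace ℝ (Fin d), ‖u‖ ≤ 1 → IsSubExp (fun ω => inner ℝ u (B ω)) V τ μ) →
      ∀ w, Integrable (fun ω => (inner ℝ w (trunc K (B ω))) ^ 2) μ ∧
        ∫ ω, (inner ℝ w (trunc K (B ω))) ^ 2 ∂μ ≤ c * ‖w‖ ^ 2 := by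
    intro B hB hsub w
    obtain ⟨h1, h2⟩ := integral_inner_sq_le hB hτ hsub w
    have hBT := hTm hB
    have hint : Integrable (fun ω => (inner ℝ w (trunc K (B ω))) ^ 2) μ := by
      have hm : Measurable fun ω => inner ℝ w (trunc K (B ω)) := by fun_prop
      refine Integrable.mono' h1 (hm.pow_const 2).aestronglyMeasurable (Filter.Eventually.of_forall fun ω => ?_)
      rw [Real.norm_of_nonneg (sq_nonneg _)]
      exact inner_trunc_sq_le _ _
    exact ⟨hint, (integral_mono hint h1 fun ω => inner_trunc_sq_le _ _).trans h2⟩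
  have hnorm : ∀ {B : Ω → EuclideanSpace ℝ (Fin d)}, Measurable B →
      (∀ u : EuclideanSpace ℝ (Fin d), ‖u‖ ≤ 1 → IsSubExp (fun ω => inner ℝ u (B ω)) V τ μ) →
      Integrable (fun ω => ‖trunc K (B ω)‖ ^ 2) μ ∧
        ∫ ω, ‖trunc K (B ω)‖ ^ 2 ∂μ ≤ d * c := by
    intro B hB hsub
    have e : ∀ ω, ‖trunc K (B ω)‖ ^ 2 =
        ∑ a : Fin d, (inner ℝ (EuclideanSpace.single a (1 : ℝ)) (trunc K (B ω))) ^ 2 := by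
      intro ω
      rw [EuclideanSpace.real_norm_sq_eq]
      refine Finset.sum_congr rfl fun a _ => ?_
      rw [EuclideanSpace.inner_single_left, map_one, one_mul]
    simp_rw [e]
    refine ⟨integrable_finsetSum _ fun a _ => (hmom hB hsub _).1, ?_⟩
    rw [integral_finsetSum _ fun a _ => (hmom hB hsub _).1]
    calc _ ≤ ∑ _a : Fin d, c := by
          refine Finset.sum_le_sum fun a _ => ?_
          have := (hmom hB hsub (EuclideanSpace.single a (1 : ℝ))).2
          simpa using this
      _ = d * c := by simp
  have hX : ∀ i, Measurable fun ω => dilation (trunc K (A i ω)) (trunc K (F i ω)) := fun i =>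
    measurable_dilation.comp ((hTm (hA i)).prodMk (hTm (hF i)))
  have hindX : iIndepFun (fun i ω => dilation (trunc K (A i ω)) (trunc K (F i ω))) μ :=
    hind.comp (fun _ p => dilation (trunc K p.1) (trunc K p.2)) fun _ =>
      measurable_dilation.comp ((measurable_trunc.comp measurable_fst).prodMk
        (measurable_trunc.comp measurable_snd))
  -- The mean is at most β² because the two factors are independent, each with bias β. The variance
  -- is at most d c²: one factor contributes its squared norm, of mean at most d c, and the other a
  -- directional second moment, at most c.
  have hmain := measureReal_exists_le_dotProduct_sum_le (μ := μ) hX hindX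
    (fun i ω a b => dilation_symm _ _ a b) (t := t) (b := β ^ 2) (v := d * c ^ 2) ht ?_ ?_ ?_ r
  · refine hmain.trans (le_of_eq ?_)
    rw [Fintype.card_sum, Fintype.card_fin]
    push_cast
    ring_nf
  · intro i ω w
    rw [dilation_mulVec_dotProduct_self, dotProduct_self_eq_norm_sq_add]
    have hin : ∀ (w x : EuclideanSpace ℝ (Fin d)),
        (inner ℝ w (trunc K x)) ^ 2 ≤ K ^ 2 * ‖w‖ ^ 2 := by
      intro w x
      rw [← sq_abs, ← mul_pow, mul_comm K]
      have h1 := abs_real_inner_le_norm w (trunc K x)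
      have h2 := norm_trunc_le hK x
      gcongr
      exact h1.trans (by gcongr)
    calc _ ≤ t ^ 2 * (K ^ 2 * ‖WithLp.toLp 2 (w ∘ Sum.inr)‖ ^ 2 * K ^ 2 +
          K ^ 2 * ‖WithLp.toLp 2 (w ∘ Sum.inl)‖ ^ 2 * K ^ 2) := by
          gcongr
          · exact hin _ _
          · exact norm_trunc_le hK _
          · exact hin _ _
          · exact norm_trunc_le hK _
      _ = (t * K ^ 2) ^ 2 * (‖WithLp.toLp 2 (w ∘ Sum.inl)‖ ^ 2 +
          ‖WithLp.toLp 2 (w ∘ Sum.inr)‖ ^ 2) := by ring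
      _ ≤ 1 * (‖WithLp.toLp 2 (w ∘ Sum.inl)‖ ^ 2 + ‖WithLp.toLp 2 (w ∘ Sum.inr)‖ ^ 2) := by
          gcongr
          exact pow_le_one₀ (by positivity) htK
      _ = _ := one_mul _
  · intro i w
    simp_rw [dotProduct_dilation_mulVec]
    have hAT := hTm (hA i)
    have hFT := hTm (hF i)
    have hprod := ((hindT i).comp
      (φ := fun x => inner ℝ (WithLp.toLp 2 (w ∘ Sum.inl)) x)
      (ψ := fun x => inner ℝ (WithLp.toLp 2 (w ∘ Sum.inr)) x)
      (by fun_prop) (by fun_prop)).integral_mul_eq_mul_integral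
      (by exact Measurable.aestronglyMeasurable (by fun_prop))
      (by exact Measurable.aestronglyMeasurable (by fun_prop))
    have hprod' : ∫ ω, inner ℝ (WithLp.toLp 2 (w ∘ Sum.inl)) (trunc K (A i ω)) *
        inner ℝ (WithLp.toLp 2 (w ∘ Sum.inr)) (trunc K (F i ω)) ∂μ =
        (∫ ω, inner ℝ (WithLp.toLp 2 (w ∘ Sum.inl)) (trunc K (A i ω)) ∂μ) *
        ∫ ω, inner ℝ (WithLp.toLp 2 (w ∘ Sum.inr)) (trunc K (F i ω)) ∂μ := hprod
    rw [integral_const_mul, hprod', dotProduct_self_eq_norm_sq_add]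
    set a := ‖WithLp.toLp 2 (w ∘ Sum.inl)‖
    set b := ‖WithLp.toLp 2 (w ∘ Sum.inr)‖
    have h1 : |(∫ ω, inner ℝ (WithLp.toLp 2 (w ∘ Sum.inl)) (trunc K (A i ω)) ∂μ) *
        ∫ ω, inner ℝ (WithLp.toLp 2 (w ∘ Sum.inr)) (trunc K (F i ω)) ∂μ| ≤ (β * a) * (β * b) := by
      rw [abs_mul]
      exact mul_le_mul (hbA i _) (hbF i _) (abs_nonneg _) (by positivity)
    have h2 := (abs_le.1 h1).2
    nlinarith [mul_nonneg (sq_nonneg β) (sq_nonneg (a - b))]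
  · intro i w
    simp_rw [dilation_mulVec_dotProduct_self]
    have hAT := hTm (hA i)
    have hFT := hTm (hF i)
    have hp1 := (hindT i).comp (φ := fun x => ‖x‖ ^ 2)
      (ψ := fun x => (inner ℝ (WithLp.toLp 2 (w ∘ Sum.inr)) x) ^ 2)
      (by fun_prop) (by fun_prop)
    have hp2 := (hindT i).comp (φ := fun x => (inner ℝ (WithLp.toLp 2 (w ∘ Sum.inl)) x) ^ 2)
      (ψ := fun x => ‖x‖ ^ 2) (by fun_prop) (by fun_prop)
    obtain ⟨iA, bA⟩ := hnorm (hA i) (hsubA i)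
    obtain ⟨iF, bF⟩ := hnorm (hF i) (hsubF i)
    obtain ⟨jA, cA⟩ := hmom (hA i) (hsubA i) (WithLp.toLp 2 (w ∘ Sum.inl))
    obtain ⟨jF, cF⟩ := hmom (hF i) (hsubF i) (WithLp.toLp 2 (w ∘ Sum.inr))
    have e1 : ∫ ω, (inner ℝ (WithLp.toLp 2 (w ∘ Sum.inr)) (trunc K (F i ω))) ^ 2 *
        ‖trunc K (A i ω)‖ ^ 2 ∂μ = (∫ ω, ‖trunc K (A i ω)‖ ^ 2 ∂μ) *
        ∫ ω, (inner ℝ (WithLp.toLp 2 (w ∘ Sum.inr)) (trunc K (F i ω))) ^ 2 ∂μ := by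
      simp_rw [mul_comm ((inner ℝ (WithLp.toLp 2 (w ∘ Sum.inr)) (trunc K (F i _))) ^ 2)]
      exact hp1.integral_mul_eq_mul_integral iA.aestronglyMeasurable jF.aestronglyMeasurable
    have e2 : ∫ ω, (inner ℝ (WithLp.toLp 2 (w ∘ Sum.inl)) (trunc K (A i ω))) ^ 2 *
        ‖trunc K (F i ω)‖ ^ 2 ∂μ =
        (∫ ω, (inner ℝ (WithLp.toLp 2 (w ∘ Sum.inl)) (trunc K (A i ω))) ^ 2 ∂μ) *
        ∫ ω, ‖trunc K (F i ω)‖ ^ 2 ∂μ :=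
      hp2.integral_mul_eq_mul_integral jA.aestronglyMeasurable iF.aestronglyMeasurable
    have i1 : Integrable (fun ω => (inner ℝ (WithLp.toLp 2 (w ∘ Sum.inr)) (trunc K (F i ω))) ^ 2 *
        ‖trunc K (A i ω)‖ ^ 2) μ := hp1.symm.integrable_mul jF iA
    have i2 : Integrable (fun ω => (inner ℝ (WithLp.toLp 2 (w ∘ Sum.inl)) (trunc K (A i ω))) ^ 2 *
        ‖trunc K (F i ω)‖ ^ 2) μ := hp2.integrable_mul jA iF
    rw [integral_add i1 i2, e1, e2, dotProduct_self_eq_norm_sq_add]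
    calc _ ≤ (d * c) * (c * ‖WithLp.toLp 2 (w ∘ Sum.inr)‖ ^ 2) +
          (c * ‖WithLp.toLp 2 (w ∘ Sum.inl)‖ ^ 2) * (d * c) := by
          gcongr
      _ = _ := by ring

/-- The constant in the deviation probability for sums of products of independent vectors. -/
def prodConst (V τ : ℝ) : ℝ :=
  2 * (2 * Real.exp (V * τ ^ 2)) +
    2 * Real.exp (((4 / τ ^ 2 * Real.exp (V * τ ^ 2)) + 2 * Real.exp (V * τ ^ 2)) ^ 2 /
      (12 / τ) ^ 2 + (4 / τ ^ 2 * Real.exp (V * τ ^ 2)) ^ 2 / (12 / τ) ^ 4)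

theorem prodConst_pos (V τ : ℝ) : 0 < prodConst V τ := by
  rw [prodConst]
  positivity

/-- Outside an event of probability O(e^(-10 L)) truncation at K changes nothing, and the truncated
sum obeys matrix Bernstein. Two powers of L come from K², the third from the confidence level. -/
theorem measureReal_norm_sum_vecMulVec_indep_le {ι : Type*} [Fintype ι] {d : ℕ} (hd : 1 ≤ d)
    {A F : ι → Ω → EuclideanSpace ℝ (Fin d)} (hA : ∀ i, Measurable (A i))
    (hF : ∀ i, Measurable (F i)) (hind : iIndepFun (fun i ω => (A i ω, F i ω)) μ)
    (hindAF : ∀ i, IndepFun (A i) (F i) μ) {V τ : ℝ} (hτ : 0 < τ)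
    (hsubA : ∀ i (u : EuclideanSpace ℝ (Fin d)), ‖u‖ ≤ 1 →
      IsSubExp (fun ω => inner ℝ u (A i ω)) V τ μ)
    (hsubF : ∀ i (u : EuclideanSpace ℝ (Fin d)), ‖u‖ ≤ 1 →
      IsSubExp (fun ω => inner ℝ u (F i ω)) V τ μ)
    (hmA : ∀ i (u : EuclideanSpace ℝ (Fin d)), ∫ ω, inner ℝ u (A i ω) ∂μ = 0)
    (hmF : ∀ i (u : EuclideanSpace ℝ (Fin d)), ∫ ω, inner ℝ u (F i ω) ∂μ = 0)
    {L : ℝ} (hL : 1 ≤ L) (hdL : (d : ℝ) ≤ Real.exp L) (hιL : (Fintype.card ι : ℝ) ≤ Real.exp L) :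
    μ.real {ω | 11 * (12 / τ) ^ 2 * √(d * (Fintype.card ι + d)) * L ^ 3 <
        ‖∑ i, vecMulVec (A i ω).ofLp (F i ω).ofLp‖} ≤ prodConst V τ * Real.exp (-(10 * L)) := by
  set m : ℝ := (Fintype.card ι : ℝ) with hm
  have hm0 : 0 ≤ m := Nat.cast_nonneg _
  have hd0 : (1 : ℝ) ≤ d := by exact_mod_cast hd
  set R := 12 / τ with hR
  have hR0 : 0 < R := by positivity
  set p₀ := 2 * Real.exp (V * τ ^ 2) with hp₀
  have hp₀0 : 0 < p₀ := by positivity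
  set c := 4 / τ ^ 2 * Real.exp (V * τ ^ 2) with hc
  have hc0 : 0 < c := by positivity
  set q := √(d * (m + d)) with hq
  have hq2 : q ^ 2 = d * (m + d) := Real.sq_sqrt (by positivity)
  have hqd : (d : ℝ) ≤ q := by
    refine Real.le_sqrt_of_sq_le ?_
    nlinarith
  have hq1 : 1 ≤ q := hd0.trans hqd
  have hq0 : 0 < q := by linarith
  set r := 11 * R ^ 2 * q * L ^ 3 with hr
  have hr0 : 0 ≤ r := by positivity
  set K := R * √d * L with hK
  have hK0 : 0 ≤ K := by positivity
  have hK2 : K ^ 2 = R ^ 2 * d * L ^ 2 := by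
    rw [hK, mul_pow, mul_pow, Real.sq_sqrt (by positivity)]
  -- With this t the truncation constraint t K² ≤ 1 holds since d ≤ q, t r = 11 L, and the variance
  -- cost is bounded since q² = d (m + d). One unit of L out of the 11 pays for the dimension
  -- factor.
  set t := (R ^ 2 * q * L ^ 2)⁻¹ with ht
  have ht0 : 0 < t := by positivity
  have htK : t * K ^ 2 ≤ 1 := by
    rw [ht, hK2, ← div_eq_inv_mul, div_le_one (by positivity)]
    gcongr
  have hp : ∀ {B : Ω → EuclideanSpace ℝ (Fin d)},
      (∀ u : EuclideanSpace ℝ (Fin d), ‖u‖ ≤ 1 → IsSubExp (fun ω => inner ℝ u (B ω)) V τ μ) →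
      μ.real {ω | K < ‖B ω‖} ≤ p₀ * Real.exp (-(11 * L)) := by
    intro B hB
    refine (measureReal_norm_gt_le hτ hB (by linarith)).trans ?_
    calc (d : ℝ) * (p₀ * Real.exp (-(12 * L))) ≤ Real.exp L * (p₀ * Real.exp (-(12 * L))) := by
          gcongr
      _ = _ := by
          rw [mul_left_comm, ← Real.exp_add]
          congr 2
          ring
  -- The bias bound with ε = e^(-5 L) and tail e^(-11 L); small enough that summing β² over at most
  -- e^L clients stays bounded.
  set β := (c + p₀) * Real.exp (-(5 * L)) with hβ
  have hβ0 : 0 ≤ β := by positivity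
  have hbias : ∀ {B : Ω → EuclideanSpace ℝ (Fin d)}, Measurable B →
      (∀ u : EuclideanSpace ℝ (Fin d), ‖u‖ ≤ 1 → IsSubExp (fun ω => inner ℝ u (B ω)) V τ μ) →
      (∀ u : EuclideanSpace ℝ (Fin d), ∫ ω, inner ℝ u (B ω) ∂μ = 0) →
      ∀ w, |∫ ω, inner ℝ w (trunc K (B ω)) ∂μ| ≤ β * ‖w‖ := by
    intro B hB hs hm w
    refine (abs_integral_inner_trunc_le hB hτ hK0 hs hm (Real.exp_pos (-(5 * L))) (hp hs) w).trans ?_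
    gcongr
    rw [hβ, add_mul, mul_comm c, mul_div_assoc, ← Real.exp_sub]
    gcongr
    linarith
  have hB := measureReal_exists_dilation_le hd hA hF hind hindAF hτ hsubA hsubF hK0 ht0 htK hβ0
    (fun i => hbias (hA i) (hsubA i) (hmA i)) (fun i => hbias (hF i) (hsubF i) (hmF i)) r
  set E₁ := {ω | ∃ w, w ⬝ᵥ w = 1 ∧
      r ≤ w ⬝ᵥ (of (∑ i, dilation (trunc K (A i ω)) (trunc K (F i ω))) *ᵥ w)} with hE₁
  have hE₁le : μ.real E₁ ≤ 2 * Real.exp ((c + p₀) ^ 2 / R ^ 2 + c ^ 2 / R ^ 4) *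
      Real.exp (-(10 * L)) := by
    refine hB.trans ?_
    have h1 : t * r = 11 * L := by
      rw [ht, hr]
      field_simp
    have htR : t ≤ (R ^ 2)⁻¹ := by
      rw [ht]
      refine inv_anti₀ (by positivity) ?_
      have : 1 ≤ q * L ^ 2 := one_le_mul_of_one_le_of_one_le hq1 (one_le_pow₀ hL)
      calc R ^ 2 = R ^ 2 * 1 := by ring
        _ ≤ R ^ 2 * (q * L ^ 2) := by gcongr
        _ = _ := by ring
    have h2 : m * (t * β ^ 2) ≤ (c + p₀) ^ 2 / R ^ 2 := by
      have hmβ : m * β ^ 2 ≤ (c + p₀) ^ 2 := by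
        rw [hβ, mul_pow, ← Real.exp_nat_mul, mul_left_comm]
        refine mul_le_of_le_one_right (by positivity) ?_
        calc m * Real.exp ((2 : ℕ) * -(5 * L)) ≤ Real.exp L * Real.exp ((2 : ℕ) * -(5 * L)) := by
              gcongr
          _ ≤ 1 := by
              rw [← Real.exp_add, Real.exp_le_one_iff]
              push_cast
              linarith
      calc m * (t * β ^ 2) = t * (m * β ^ 2) := by ring
        _ ≤ (R ^ 2)⁻¹ * (c + p₀) ^ 2 := by gcongr
        _ = _ := by rw [div_eq_inv_mul]
    have h3 : m * (t ^ 2 * (d * c ^ 2)) ≤ c ^ 2 / R ^ 4 := by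
      have hL4 : 1 ≤ L ^ 4 := one_le_pow₀ hL
      have e : t ^ 2 = (R ^ 4 * (d * (m + d)) * L ^ 4)⁻¹ := by
        rw [ht, inv_pow, mul_pow, mul_pow, hq2]
        congr 1
        ring
      rw [e]
      have hpos : 0 < R ^ 4 * (d * (m + d)) * L ^ 4 := by positivity
      rw [show m * ((R ^ 4 * (d * (m + d)) * L ^ 4)⁻¹ * (d * c ^ 2)) =
        (m * (d * c ^ 2)) / (R ^ 4 * (d * (m + d)) * L ^ 4) by field_simp,
        div_le_div_iff₀ hpos (by positivity)]
      have h4 : m * d ≤ d * (m + d) * L ^ 4 := by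
        calc m * d ≤ d * (m + d) := by nlinarith
          _ = d * (m + d) * 1 := by ring
          _ ≤ _ := by gcongr
      calc m * (d * c ^ 2) * R ^ 4 = (c ^ 2 * R ^ 4) * (m * d) := by ring
        _ ≤ (c ^ 2 * R ^ 4) * (d * (m + d) * L ^ 4) := by gcongr
        _ = _ := by ring
    rw [h1, mul_add m]
    calc 2 * (d : ℝ) * Real.exp (-(11 * L) + (m * (t * β ^ 2) + m * (t ^ 2 * (d * c ^ 2))))
        ≤ 2 * Real.exp L *
          Real.exp (-(11 * L) + ((c + p₀) ^ 2 / R ^ 2 + c ^ 2 / R ^ 4)) := by gcongr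
      _ = _ := by
          rw [mul_assoc, mul_assoc, ← Real.exp_add, ← Real.exp_add]
          congr 2
          ring
  set E₂ := ⋃ i, ({ω | K < ‖A i ω‖} ∪ {ω | K < ‖F i ω‖}) with hE₂
  have hE₂le : μ.real E₂ ≤ 2 * p₀ * Real.exp (-(10 * L)) := by
    calc μ.real E₂ ≤ ∑ i, μ.real ({ω | K < ‖A i ω‖} ∪ {ω | K < ‖F i ω‖}) :=
          measureReal_iUnion_fintype_le _
      _ ≤ ∑ _i : ι, (p₀ * Real.exp (-(11 * L)) + p₀ * Real.exp (-(11 * L))) := by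
          refine Finset.sum_le_sum fun i _ => (measureReal_union_le _ _).trans ?_
          exact add_le_add (hp (hsubA i)) (hp (hsubF i))
      _ = m * (2 * p₀ * Real.exp (-(11 * L))) := by
          rw [Finset.sum_const, Finset.card_univ, nsmul_eq_mul]
          ring
      _ ≤ Real.exp L * (2 * p₀ * Real.exp (-(11 * L))) := by gcongr
      _ = _ := by
          rw [mul_left_comm, ← Real.exp_add]
          congr 2
          ring
  have hsubset : {ω | r < ‖∑ i, vecMulVec (A i ω).ofLp (F i ω).ofLp‖} ⊆ E₁ ∪ E₂ := by
    intro ω hω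
    by_contra hno
    rw [Set.mem_union, not_or] at hno
    obtain ⟨hn1, hn2⟩ := hno
    simp only [hE₂, Set.mem_iUnion, not_exists, Set.mem_union, not_or] at hn2
    have hA' : ∀ i, trunc K (A i ω) = A i ω := fun i => if_pos (not_lt.1 (hn2 i).1)
    have hF' : ∀ i, trunc K (F i ω) = F i ω := fun i => if_pos (not_lt.1 (hn2 i).2)
    obtain ⟨u, v, hu, hv, huv⟩ := exists_unit_of_lt_l2_opNorm hr0
      (show r < ‖∑ i, vecMulVec (A i ω).ofLp (F i ω).ofLp‖ from hω)
    apply hn1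
    -- Scaling by √(1/2) makes the pair (u, v) a unit vector and cancels the factor 2 in the
    -- quadratic form of a dilation.
    set s : ℝ := √(1 / 2) with hs
    have hs2 : s * s = 1 / 2 := Real.mul_self_sqrt (by norm_num)
    refine ⟨Sum.elim (s • u) (s • v), ?_, ?_⟩
    · rw [sumElim_dotProduct_sumElim]
      simp only [smul_dotProduct, dotProduct_smul, hu, hv, smul_eq_mul]
      linarith
    · simp only [hA', hF']
      refine huv.trans (le_of_eq ?_)
      have e : of (∑ i, dilation (A i ω) (F i ω)) = ∑ i, of (dilation (A i ω) (F i ω)) := by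
        ext a b
        rw [Matrix.sum_apply]
        simp only [of_apply, Finset.sum_apply]
      rw [e, sum_mulVec, sum_mulVec, dotProduct_sum, dotProduct_sum]
      refine Finset.sum_congr rfl fun i _ => ?_
      rw [dotProduct_dilation_mulVec, vecMulVec_mulVec, Sum.elim_comp_inl, Sum.elim_comp_inr,
        EuclideanSpace.inner_eq_star_dotProduct, EuclideanSpace.inner_eq_star_dotProduct,
        star_trivial, star_trivial]
      simp only [dotProduct_smul, smul_eq_mul, op_smul_eq_smul]
      rw [dotProduct_comm u]
      linear_combination (-(2 * ((A i ω).ofLp ⬝ᵥ u) * ((F i ω).ofLp ⬝ᵥ v))) * hs2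
  calc _ ≤ μ.real E₁ + μ.real E₂ :=
        (measureReal_mono hsubset (measure_ne_top _ _)).trans (measureReal_union_le _ _)
    _ ≤ _ := add_le_add hE₁le hE₂le
    _ = _ := by
        rw [prodConst]
        ring

end SharedRep
end

/-! ### The law of one sample -/

noncomputable section

namespace SharedRep

open Matrix

section Sample

variable {Ω : Type*} [MeasurableSpace Ω] {μ : Measure Ω} [IsProbabilityMeasure μ] {d : ℕ}
  {x : Ω → EuclideanSpace ℝ (Fin d)} {v : ℝ≥0}

theorem IsSubGVec.integrable (h : IsSubGVec x v μ) : Integrable x μ := by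
  refine Integrable.of_eval_piLp fun a => ?_
  have h1 := (h (EuclideanSpace.single a 1) (by simp)).integrable.add
    (integrable_const (∫ ω, inner ℝ (EuclideanSpace.single a (1 : ℝ)) (x ω) ∂μ))
  refine h1.congr (Filter.Eventually.of_forall fun ω => ?_)
  simp [EuclideanSpace.inner_single_left]

theorem IsSubGVec.hasSubgaussianMGF_inner (h : IsSubGVec x v μ) (h0 : ∫ ω, x ω ∂μ = 0)
    (u : EuclideanSpace ℝ (Fin d)) :
    HasSubgaussianMGF (fun ω => inner ℝ u (x ω)) (‖u‖₊ ^ 2 * v) μ := by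
  rcases eq_or_ne u 0 with rfl | hu
  · simp
  have hup : 0 < ‖u‖ := norm_pos_iff.2 hu
  have h1 := h ((‖u‖)⁻¹ • u) (by rw [norm_smul, norm_inv, norm_norm, inv_mul_cancel₀ hup.ne'])
  rw [IsSubG, integral_inner h.integrable, h0, inner_zero_right] at h1
  have h2 := h1.const_mul ‖u‖
  have e : (⟨‖u‖ ^ 2, sq_nonneg _⟩ : ℝ≥0) = ‖u‖₊ ^ 2 :=
    NNReal.eq (show ‖u‖ ^ 2 = ((‖u‖₊ ^ 2 : ℝ≥0) : ℝ) by push_cast; rfl)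
  replace h2 : HasSubgaussianMGF _ (⟨‖u‖ ^ 2, sq_nonneg _⟩ * v) μ := h2
  rw [e] at h2
  refine h2.congr (Filter.Eventually.of_forall fun ω => ?_)
  simp only [sub_zero, real_inner_smul_left]
  field_simp

variable {y : Ω → ℝ} {θ w : EuclideanSpace ℝ (Fin d)} {σ2 γ2 : ℝ≥0}

theorem measurable_noise (hx : Measurable x) (hy : Measurable y) : Measurable (noise θ x y) :=
  hy.sub (hx.inner_const)

theorem IsSubGVec.integrable_inner_mul_inner (hxs : IsSubGVec x γ2 μ) (h0 : ∫ ω, x ω ∂μ = 0)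
    (u w : EuclideanSpace ℝ (Fin d)) : Integrable (fun ω => inner ℝ u (x ω) * inner ℝ w (x ω)) μ :=
  MemLp.integrable_mul (p := 2) (q := 2) (mod_cast (hxs.hasSubgaussianMGF_inner h0 u).memLp 2)
    (mod_cast (hxs.hasSubgaussianMGF_inner h0 w).memLp 2)

theorem IsSubGVec.integral_inner_mul_inner (hxs : IsSubGVec x γ2 μ) (h0 : ∫ ω, x ω ∂μ = 0)
    (u w : EuclideanSpace ℝ (Fin d)) :
    ∫ ω, inner ℝ u (x ω) * inner ℝ w (x ω) ∂μ = w.ofLp ⬝ᵥ (secondMoment x μ *ᵥ u.ofLp) := by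
  have hi : ∀ a b, Integrable (fun ω => x ω a * x ω b) μ := fun a b => by
    simpa [EuclideanSpace.inner_single_left] using hxs.integrable_inner_mul_inner h0
      (EuclideanSpace.single a 1) (EuclideanSpace.single b 1)
  have e : ∀ ω, inner ℝ u (x ω) * inner ℝ w (x ω) =
      ∑ a, ∑ b, w a * u b * (x ω a * x ω b) := by
    intro ω
    rw [EuclideanSpace.inner_eq_star_dotProduct, EuclideanSpace.inner_eq_star_dotProduct, mul_comm,
      dotProduct, dotProduct, Finset.sum_mul_sum]
    refine Finset.sum_congr rfl fun a _ => Finset.sum_congr rfl fun b _ => ?_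
    simp only [star_trivial]
    ring
  simp_rw [e]
  rw [integral_finsetSum _ fun a _ => integrable_finsetSum _ fun b _ => (hi a b).const_mul _]
  simp only [dotProduct, mulVec, secondMoment, of_apply, Finset.mul_sum]
  refine Finset.sum_congr rfl fun a _ => ?_
  rw [integral_finsetSum _ fun b _ => (hi a b).const_mul _]
  refine Finset.sum_congr rfl fun b _ => ?_
  rw [integral_const_mul]
  ring

/-- The centered product `⟨u, y x - Γ θ⟩` in a regression sample is centered and sub-exponential. -/
theorem isSubExp_inner_smul_sub (hx : Measurable x) (hy : Measurable y)
    (hind : IndepFun (noise θ x y) x μ) (hn0 : ∫ ω, noise θ x y ω ∂μ = 0)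
    (hns : IsSubG (noise θ x y) σ2 μ) (h0 : ∫ ω, x ω ∂μ = 0) (hxs : IsSubGVec x γ2 μ)
    (hw : secondMoment x μ *ᵥ θ.ofLp = w.ofLp) {s : ℝ} (hs : 0 < s)
    (hsθ : 12 * (‖θ‖ ^ 2 * γ2) * s ≤ 1) (hsσ : 12 * σ2 * s ≤ 1) (hsγ : 12 * γ2 * s ≤ 1)
    (hsw : s * ‖w‖ ≤ 1) (u : EuclideanSpace ℝ (Fin d)) :
    Integrable (fun ω => inner ℝ u (y ω • x ω - w)) μ ∧
    ∫ ω, inner ℝ u (y ω • x ω - w) ∂μ = 0 ∧ (‖u‖ ≤ 1 →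
      IsSubExp (fun ω => inner ℝ u (y ω • x ω - w)) (8 * (2 * Real.exp 1) / s ^ 2) (s / 2) μ) := by
  have hX := hxs.hasSubgaussianMGF_inner h0 θ
  have hQ := hxs.hasSubgaussianMGF_inner h0 u
  have hY : HasSubgaussianMGF (noise θ x y) σ2 μ := by
    rw [IsSubG, hn0] at hns
    simpa using hns
  have hnm := measurable_noise (θ := θ) hx hy
  have i1 := hxs.integrable_inner_mul_inner h0 θ u
  have i2 : Integrable (fun ω => noise θ x y ω * inner ℝ u (x ω)) μ :=
    MemLp.integrable_mul (p := 2) (q := 2) (mod_cast hY.memLp 2) (mod_cast hQ.memLp 2)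
  have hz : ∫ ω, noise θ x y ω * inner ℝ u (x ω) ∂μ = 0 := by
    have hind' : IndepFun (noise θ x y) (fun ω => inner ℝ u (x ω)) μ :=
      hind.comp measurable_id (ψ := fun z => inner ℝ u z) (by fun_prop)
    rw [hind'.integral_fun_mul_eq_mul_integral hnm.aestronglyMeasurable
      (Measurable.aestronglyMeasurable (by fun_prop)), hn0, zero_mul]
  -- Since y = ⟨θ, x⟩ + noise and the noise part integrates to zero, only ⟨u, Γ θ⟩ = ⟨u, w⟩ remains.
  have hm : ∫ ω, (inner ℝ θ (x ω) + noise θ x y ω) * inner ℝ u (x ω) ∂μ = inner ℝ u w := by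
    simp_rw [add_mul]
    rw [integral_add i1 i2, hz, add_zero, hxs.integral_inner_mul_inner h0, hw, dotProduct_comm,
      EuclideanSpace.inner_eq_star_dotProduct, star_trivial]
  have e : ∀ ω, inner ℝ u (y ω • x ω - w) =
      (inner ℝ θ (x ω) + noise θ x y ω) * inner ℝ u (x ω) - inner ℝ u w := by
    intro ω
    rw [inner_sub_right, real_inner_smul_right, noise, real_inner_comm θ (x ω)]
    ring
  simp_rw [e]
  have i3 : Integrable (fun ω => (inner ℝ θ (x ω) + noise θ x y ω) * inner ℝ u (x ω)) μ := by
    simp_rw [add_mul]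
    exact i1.add i2
  refine ⟨i3.sub (integrable_const _), ?_, ?_⟩
  · rw [integral_sub i3 (integrable_const _), hm]
    simp
  · intro hu
    refine isSubExp_add_mul_sub (by fun_prop) hnm (by fun_prop) hX hY hQ hs ?_ hsσ ?_ hm ?_
    · simpa using hsθ
    · refine le_trans ?_ hsγ
      have : ‖u‖ ^ 2 ≤ 1 := pow_le_one₀ (norm_nonneg _) hu
      have h3 : ‖u‖ ^ 2 * (γ2 : ℝ) ≤ γ2 := mul_le_of_le_one_left γ2.2 this
      push_cast
      gcongr
    · refine le_trans ?_ hsw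
      gcongr
      refine (abs_real_inner_le_norm _ _).trans ?_
      exact mul_le_of_le_one_left (norm_nonneg _) hu

end Sample

/-- A scale at which the centered products of the model are sub-exponential. -/
def modelScale (σ2 γ2 : ℝ≥0) (c a : ℝ) : ℝ :=
  (12 * (γ2 * (1 + (a / c) ^ 2) + σ2) + 1 + |a|)⁻¹

theorem modelScale_pos (σ2 γ2 : ℝ≥0) (c a : ℝ) : 0 < modelScale σ2 γ2 c a := by
  rw [modelScale]
  positivity

namespace Model

variable {Ω : Type*} [MeasurableSpace Ω] {μ : Measure Ω} {σ2 γ2 : ℝ≥0}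
  {c a : ℝ} {M d k : ℕ} {n : Fin M → ℕ} {x : (i : Fin M) → Fin (n i) → Ω → EuclideanSpace ℝ (Fin d)}
  {y : (i : Fin M) → Fin (n i) → Ω → ℝ} {Γ : Fin M → Matrix (Fin d) (Fin d) ℝ}
  {θ : Fin M → EuclideanSpace ℝ (Fin d)} {B : Matrix (Fin d) (Fin k) ℝ}
  {α : Fin M → EuclideanSpace ℝ (Fin k)}

theorem norm_signal_le (h : Model μ σ2 γ2 c a n x y Γ θ B α) (i : Fin M) :
    ‖WithLp.toLp 2 (B *ᵥ (α i).ofLp)‖ ≤ a := by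
  rw [norm_toLp_mulVec_of_isometry h.B_orthonormal]
  exact h.α_bound i

/-- c ‖θ‖² ≤ ⟨θ, Γ θ⟩ = ⟨θ, B α⟩ ≤ ‖θ‖ a. -/
theorem norm_θ_le (h : Model μ σ2 γ2 c a n x y Γ θ B α) (hc : 0 < c) (i : Fin M) :
    ‖θ i‖ ≤ a / c := by
  have h1 := (h.Γ_lower i).dotProduct_mulVec_nonneg (θ i).ofLp
  rw [star_trivial, sub_mulVec, smul_mulVec, one_mulVec, dotProduct_sub, dotProduct_smul,
    h.low_rank, smul_eq_mul] at h1
  have h2 : (θ i).ofLp ⬝ᵥ (θ i).ofLp = ‖θ i‖ ^ 2 := by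
    rw [← real_inner_self_eq_norm_sq, EuclideanSpace.inner_eq_star_dotProduct, star_trivial]
  have h3 : (θ i).ofLp ⬝ᵥ (B *ᵥ (α i).ofLp) ≤ ‖θ i‖ * a := by
    have := real_inner_le_norm (WithLp.toLp 2 (B *ᵥ (α i).ofLp)) (θ i)
    rw [EuclideanSpace.inner_eq_star_dotProduct, star_trivial] at this
    refine this.trans ?_
    rw [mul_comm]
    gcongr
    exact h.norm_signal_le i
  rw [le_div_iff₀ hc]
  rcases (norm_nonneg (θ i)).eq_or_lt with h0 | h0
  · rw [← h0, zero_mul]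
    exact (norm_nonneg _).trans (h.α_bound i)
  · refine le_of_mul_le_mul_left ?_ h0
    nlinarith

/-- The scale is uniform over clients, samples and dimensions, because ‖θ i‖ ≤ a / c and ‖B α i‖ ≤
a. -/
theorem isSubExp [IsProbabilityMeasure μ] (h : Model μ σ2 γ2 c a n x y Γ θ B α) (hc : 0 < c) (i : Fin M) (j : Fin (n i))
    (u : EuclideanSpace ℝ (Fin d)) :
    Integrable (fun ω => inner ℝ u (y i j ω • x i j ω - WithLp.toLp 2 (B *ᵥ (α i).ofLp))) μ ∧
    ∫ ω, inner ℝ u (y i j ω • x i j ω - WithLp.toLp 2 (B *ᵥ (α i).ofLp)) ∂μ = 0 ∧ (‖u‖ ≤ 1 →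
      IsSubExp (fun ω => inner ℝ u (y i j ω • x i j ω - WithLp.toLp 2 (B *ᵥ (α i).ofLp)))
        (8 * (2 * Real.exp 1) / modelScale σ2 γ2 c a ^ 2) (modelScale σ2 γ2 c a / 2) μ) := by
  have hs := modelScale_pos σ2 γ2 c a
  have hle : ∀ {z : ℝ}, z ≤ 12 * (γ2 * (1 + (a / c) ^ 2) + σ2) + 1 + |a| →
      z * modelScale σ2 γ2 c a ≤ 1 := by
    intro z hz
    rw [modelScale, ← div_eq_mul_inv]
    exact div_le_one_of_le₀ hz (by positivity)
  have hγ := γ2.2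
  have hσ := σ2.2
  have hγa : 0 ≤ (γ2 : ℝ) * (a / c) ^ 2 := by positivity
  have ha := abs_nonneg a
  have hθ : ‖θ i‖ ^ 2 ≤ (a / c) ^ 2 := by
    have := h.norm_θ_le hc i
    gcongr
  refine isSubExp_inner_smul_sub (h.measurable_x i j) (h.measurable_y i j) (h.indep_noise i j)
    (h.noise_mean i j) (h.noise_subG i j) (h.x_mean i j) (h.x_subG i j) ?_ hs (hle ?_) (hle ?_)
    (hle ?_) ?_ u
  · rw [h.x_secondMoment, h.low_rank]
  · nlinarith [mul_le_mul_of_nonneg_right hθ hγ]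
  · nlinarith
  · nlinarith
  · rw [mul_comm]
    refine hle ?_
    have := h.norm_signal_le i
    nlinarith [le_abs_self a]

end Model

end SharedRep
end

/-! ### Spectrum of the diversity matrix and decomposition of the estimator -/

noncomputable section

namespace SharedRep

open Matrix
open scoped Matrix.Norms.L2Operator

section Hermitian

variable {n : Type*} [Fintype n] [DecidableEq n] {A : Matrix n n ℝ} (hA : A.IsHermitian)

theorem inner_eigenvectorBasis_mulVec (z : EuclideanSpace ℝ n) (i : n) :
    inner ℝ (hA.eigenvectorBasis i) (WithLp.toLp 2 (A *ᵥ z.ofLp)) =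
      hA.eigenvalues i * inner ℝ (hA.eigenvectorBasis i) z := by
  have hAt : Aᵀ = A := hA
  rw [EuclideanSpace.inner_eq_star_dotProduct, EuclideanSpace.inner_eq_star_dotProduct, star_trivial,
    dotProduct_comm, dotProduct_mulVec, ← mulVec_transpose, hAt, hA.mulVec_eigenvectorBasis,
    smul_dotProduct, smul_eq_mul, dotProduct_comm]

theorem norm_mulVec_sq_eq_sum (z : EuclideanSpace ℝ n) :
    ‖WithLp.toLp 2 (A *ᵥ z.ofLp)‖ ^ 2 =
      ∑ i, hA.eigenvalues i ^ 2 * (inner ℝ (hA.eigenvectorBasis i) z) ^ 2 := by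
  rw [← hA.eigenvectorBasis.sum_sq_inner_right]
  simp_rw [inner_eigenvectorBasis_mulVec hA, mul_pow]

theorem dotProduct_mulVec_eq_sum (z : EuclideanSpace ℝ n) :
    z.ofLp ⬝ᵥ (A *ᵥ z.ofLp) =
      ∑ i, hA.eigenvalues i * (inner ℝ (hA.eigenvectorBasis i) z) ^ 2 := by
  have h := hA.eigenvectorBasis.sum_inner_mul_inner z (WithLp.toLp 2 (A *ᵥ z.ofLp))
  rw [EuclideanSpace.inner_eq_star_dotProduct, star_trivial, dotProduct_comm] at h
  rw [← h]
  refine Finset.sum_congr rfl fun i _ => ?_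
  rw [inner_eigenvectorBasis_mulVec, real_inner_comm]
  ring

end Hermitian

section Diversity

variable {M k : ℕ} (n : Fin M → ℕ) (α : Fin M → EuclideanSpace ℝ (Fin k)) (hk : 0 < k)

theorem eigenvalues_le_diversityEigenvalue (i : Fin k) :
    (diversity_isHermitian n α).eigenvalues i ≤ diversityEigenvalue n α ⟨0, hk⟩ := by
  rw [IsHermitian.eigenvalues, diversityEigenvalue]
  exact (diversity_isHermitian n α).eigenvalues₀_antitone (Fin.le_def.2 (Nat.zero_le _))

theorem diversityEigenvalue_le_eigenvalues (i : Fin k) :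
    diversityEigenvalue n α ⟨k - 1, Nat.sub_lt hk Nat.one_pos⟩ ≤
      (diversity_isHermitian n α).eigenvalues i := by
  rw [IsHermitian.eigenvalues, diversityEigenvalue]
  refine (diversity_isHermitian n α).eigenvalues₀_antitone (Fin.le_def.2 ?_)
  have := ((Fintype.equivOfCardEq (Fintype.card_fin (Fintype.card (Fin k)))).symm i).isLt
  simp only [Fintype.card_fin] at this
  simp only [Fin.val_cast]
  omega

theorem diversityEigenvalue_last_le_first :
    diversityEigenvalue n α ⟨k - 1, Nat.sub_lt hk Nat.one_pos⟩ ≤ diversityEigenvalue n α ⟨0, hk⟩ :=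
  (diversityEigenvalue_le_eigenvalues n α hk ⟨0, hk⟩).trans
    (eigenvalues_le_diversityEigenvalue n α hk ⟨0, hk⟩)

theorem dotProduct_diversity_mulVec_le (z : EuclideanSpace ℝ (Fin k)) :
    z.ofLp ⬝ᵥ (diversity n α *ᵥ z.ofLp) ≤ diversityEigenvalue n α ⟨0, hk⟩ * ‖z‖ ^ 2 := by
  rw [dotProduct_mulVec_eq_sum (diversity_isHermitian n α),
    ← (diversity_isHermitian n α).eigenvectorBasis.sum_sq_inner_right z, Finset.mul_sum]
  refine Finset.sum_le_sum fun i _ => ?_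
  have := eigenvalues_le_diversityEigenvalue n α hk i
  gcongr

theorem le_norm_diversity_mulVec
    (hpos : 0 ≤ diversityEigenvalue n α ⟨k - 1, Nat.sub_lt hk Nat.one_pos⟩)
    (z : EuclideanSpace ℝ (Fin k)) :
    diversityEigenvalue n α ⟨k - 1, Nat.sub_lt hk Nat.one_pos⟩ * ‖z‖ ≤
      ‖WithLp.toLp 2 (diversity n α *ᵥ z.ofLp)‖ := by
  refine le_of_sq_le_sq ?_ (norm_nonneg _)
  rw [norm_mulVec_sq_eq_sum (diversity_isHermitian n α), mul_pow,
    ← (diversity_isHermitian n α).eigenvectorBasis.sum_sq_inner_right z, Finset.mul_sum]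
  refine Finset.sum_le_sum fun i _ => ?_
  have := diversityEigenvalue_le_eigenvalues n α hk i
  gcongr

theorem totalSamples_smul_diversity (hN : totalSamples n ≠ 0) :
    (totalSamples n : ℝ) • diversity n α =
      ∑ i, (n i : ℝ) • vecMulVec (α i).ofLp (α i).ofLp := by
  rw [diversity, smul_inv_smul₀ (Nat.cast_ne_zero.2 hN)]

/-- Without samples D would be 0, with no positive eigenvalue. Positivity of λ_k thus also supplies
M ≥ 1. -/
theorem totalSamples_ne_zero
    (hpos : 0 < diversityEigenvalue n α ⟨k - 1, Nat.sub_lt hk Nat.one_pos⟩) :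
    totalSamples n ≠ 0 := by
  intro h0
  have h := le_norm_diversity_mulVec n α hk hpos.le (EuclideanSpace.single ⟨0, hk⟩ 1)
  have e : diversity n α = 0 := by
    rw [diversity, h0, Nat.cast_zero, _root_.inv_zero, zero_smul]
  rw [e, zero_mulVec, WithLp.toLp_zero, norm_zero] at h
  simp only [PiLp.norm_single, norm_one, mul_one] at h
  linarith

/-- The sum is the quadratic form of N D at `Bᵀ v`, a vector of norm at most 1. This is how λ₁
enters the variance of the linear terms. -/
theorem sum_inner_signal_sq_le {d : ℕ} {B : Matrix (Fin d) (Fin k) ℝ} (hB : Bᵀ * B = 1)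
    (hN : totalSamples n ≠ 0) (hpos : 0 ≤ diversityEigenvalue n α ⟨0, hk⟩)
    {v : EuclideanSpace ℝ (Fin d)} (hv : ‖v‖ ≤ 1) :
    ∑ i, n i * (inner ℝ (WithLp.toLp 2 (B *ᵥ (α i).ofLp)) v) ^ 2 ≤
      totalSamples n * diversityEigenvalue n α ⟨0, hk⟩ := by
  set z : EuclideanSpace ℝ (Fin k) := WithLp.toLp 2 (Bᵀ *ᵥ v.ofLp) with hz
  have hz1 : ‖z‖ ≤ 1 := by
    refine (norm_toLp_mulVec_le Bᵀ v.ofLp).trans ?_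
    rw [l2_opNorm_transpose]
    exact mul_le_one₀ (l2_opNorm_le_one_of_isometry hB) (norm_nonneg _) hv
  have e : ∑ i, n i * (inner ℝ (WithLp.toLp 2 (B *ᵥ (α i).ofLp)) v) ^ 2 =
      z.ofLp ⬝ᵥ (((totalSamples n : ℝ) • diversity n α) *ᵥ z.ofLp) := by
    rw [totalSamples_smul_diversity n α hN, sum_mulVec, dotProduct_sum]
    refine Finset.sum_congr rfl fun i _ => ?_
    have e1 : inner ℝ (WithLp.toLp 2 (B *ᵥ (α i).ofLp)) v = (α i).ofLp ⬝ᵥ z.ofLp := by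
      rw [EuclideanSpace.inner_eq_star_dotProduct, star_trivial, hz, dotProduct_mulVec,
        ← mulVec_transpose, dotProduct_comm]
    rw [e1, smul_mulVec, vecMulVec_mulVec, dotProduct_smul, op_smul_eq_smul, dotProduct_smul,
      dotProduct_comm z.ofLp]
    simp only [smul_eq_mul]
    ring
  rw [e, smul_mulVec, dotProduct_smul, smul_eq_mul]
  have h1 := dotProduct_diversity_mulVec_le n α hk z
  have h2 : ‖z‖ ^ 2 ≤ 1 := pow_le_one₀ (norm_nonneg _) hz1
  gcongr
  exact h1.trans (mul_le_of_le_one_right hpos h2)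

end Diversity

/-- The weights, relative to the average over all samples, in the first half average. -/
def firstWeight (n : ℕ) (j : Fin n) : ℝ := if j.val < n / 2 then (n : ℝ) / (n / 2 : ℕ) else 0

/-- The weights, relative to the average over all samples, in the second half average. -/
def secondWeight (n : ℕ) (j : Fin n) : ℝ := if n / 2 ≤ j.val then (n : ℝ) / (n - n / 2 : ℕ) else 0

section Weight

variable {n : ℕ}

/-- The worst case is n = 3, where the first half is a single sample. -/
theorem abs_firstWeight_le (hn : 2 ≤ n) (j : Fin n) : |firstWeight n j| ≤ 3 := by
  rw [firstWeight]
  split_ifs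
  · have h : 0 < n / 2 := by omega
    rw [abs_of_nonneg (by positivity), div_le_iff₀ (by exact_mod_cast h)]
    exact_mod_cast (by omega : n ≤ 3 * (n / 2))
  · simp

theorem abs_secondWeight_le (hn : 2 ≤ n) (j : Fin n) : |secondWeight n j| ≤ 3 := by
  rw [secondWeight]
  split_ifs
  · have h : 0 < n - n / 2 := by omega
    rw [abs_of_nonneg (by positivity), div_le_iff₀ (by exact_mod_cast h)]
    exact_mod_cast (by omega : n ≤ 3 * (n - n / 2))
  · simp

theorem firstWeight_eq_zero_or (j : Fin n) : firstWeight n j = 0 ∨ secondWeight n j = 0 := by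
  rcases lt_or_ge j.val (n / 2) with h | h
  · exact Or.inr (if_neg (not_le.2 h))
  · exact Or.inl (if_neg (not_lt.2 h))

variable {d : ℕ} (x : Fin n → EuclideanSpace ℝ (Fin d)) (y : Fin n → ℝ)
  (w : EuclideanSpace ℝ (Fin d))

theorem smul_firstHalfAvg_sub (hn : 2 ≤ n) :
    (n : ℝ) • (firstHalfAvg x y - w) = ∑ j, firstWeight n j • (y j • x j - w) := by
  have h : ((n / 2 : ℕ) : ℝ) ≠ 0 := Nat.cast_ne_zero.2 (by omega)
  simp only [firstWeight, ite_smul, zero_smul]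
  rw [← Finset.sum_filter, ← Finset.smul_sum, Finset.sum_sub_distrib, Finset.sum_const,
    Fin.card_filter_val_lt, min_eq_right (by omega), firstHalfAvg, div_eq_mul_inv, mul_smul,
    ← Nat.cast_smul_eq_nsmul ℝ, smul_sub (_⁻¹ : ℝ), inv_smul_smul₀ h]

theorem smul_secondHalfAvg_sub (hn : 2 ≤ n) :
    (n : ℝ) • (secondHalfAvg x y - w) = ∑ j, secondWeight n j • (y j • x j - w) := by
  have h : ((n - n / 2 : ℕ) : ℝ) ≠ 0 := Nat.cast_ne_zero.2 (by omega)
  have hcard : (Finset.univ.filter fun j : Fin n => n / 2 ≤ j.val).card = n - n / 2 := by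
    have h1 := Finset.card_filter_add_card_filter_not (s := (Finset.univ : Finset (Fin n)))
      (fun j : Fin n => j.val < n / 2)
    simp only [not_lt, Fin.card_filter_val_lt, Finset.card_univ, Fintype.card_fin] at h1
    omega
  simp only [secondWeight, ite_smul, zero_smul]
  rw [← Finset.sum_filter, ← Finset.smul_sum, Finset.sum_sub_distrib, Finset.sum_const,
    hcard, secondHalfAvg, div_eq_mul_inv, mul_smul,
    ← Nat.cast_smul_eq_nsmul ℝ, smul_sub (_⁻¹ : ℝ), inv_smul_smul₀ h]

end Weight

/-- Expand both half averages around `w i`. The weights rewrite them as sums over all samples of a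
client, and in the quadratic term n_i is shared as √n_i · √n_i, so that each factor has a scale
independent of n_i. -/
theorem estimatorMatrix_sub_eq {M d k : ℕ} {n : Fin M → ℕ} (hn : ∀ i, 2 ≤ n i)
    (hN : totalSamples n ≠ 0) (x : (i : Fin M) → Fin (n i) → EuclideanSpace ℝ (Fin d))
    (y : (i : Fin M) → Fin (n i) → ℝ) (B : Matrix (Fin d) (Fin k) ℝ)
    (α : Fin M → EuclideanSpace ℝ (Fin k)) {w : Fin M → EuclideanSpace ℝ (Fin d)}
    (hw : ∀ i, w i = WithLp.toLp 2 (B *ᵥ (α i).ofLp)) :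
    estimatorMatrix n x y - B * ((totalSamples n : ℝ) • diversity n α) * Bᵀ =
      ∑ p : (i : Fin M) × Fin (n i), vecMulVec (y p.1 p.2 • x p.1 p.2 - w p.1).ofLp
        (firstWeight (n p.1) p.2 • w p.1).ofLp +
      (∑ p : (i : Fin M) × Fin (n i), vecMulVec (y p.1 p.2 • x p.1 p.2 - w p.1).ofLp
        (secondWeight (n p.1) p.2 • w p.1).ofLp)ᵀ +
      ∑ i, vecMulVec
        (∑ j, (firstWeight (n i) j / √(n i)) • (y i j • x i j - w i)).ofLp
        (∑ j, (secondWeight (n i) j / √(n i)) • (y i j • x i j - w i)).ofLp := by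
  have hsq : ∀ i, √(n i : ℝ) * √(n i) = n i := fun i => Real.mul_self_sqrt (Nat.cast_nonneg _)
  have hsq0 : ∀ i, √(n i : ℝ) ≠ 0 := fun i =>
    (Real.sqrt_pos.2 (Nat.cast_pos.2 (by have := hn i; omega))).ne'
  have h1 : ∀ i, ∑ j, vecMulVec (y i j • x i j - w i).ofLp (firstWeight (n i) j • w i).ofLp =
      (n i : ℝ) • vecMulVec (firstHalfAvg (x i) (y i) - w i).ofLp (w i).ofLp := by
    intro i
    rw [← smul_vecMulVec, ← WithLp.ofLp_smul, smul_firstHalfAvg_sub _ _ _ (hn i)]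
    ext a b
    simp only [Matrix.sum_apply, vecMulVec_apply, WithLp.ofLp_sum, Finset.sum_apply,
      Finset.sum_mul, WithLp.ofLp_smul, Pi.smul_apply, smul_eq_mul]
    exact Finset.sum_congr rfl fun j _ => by ring
  have h2 : ∀ i, ∑ j, vecMulVec (y i j • x i j - w i).ofLp (secondWeight (n i) j • w i).ofLp =
      (n i : ℝ) • vecMulVec (secondHalfAvg (x i) (y i) - w i).ofLp (w i).ofLp := by
    intro i
    rw [← smul_vecMulVec, ← WithLp.ofLp_smul, smul_secondHalfAvg_sub _ _ _ (hn i)]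
    ext a b
    simp only [Matrix.sum_apply, vecMulVec_apply, WithLp.ofLp_sum, Finset.sum_apply,
      Finset.sum_mul, WithLp.ofLp_smul, Pi.smul_apply, smul_eq_mul]
    exact Finset.sum_congr rfl fun j _ => by ring
  have hdiv : ∀ i, (√(n i : ℝ))⁻¹ * n i = √(n i) := fun i => by
    rw [inv_mul_eq_iff_eq_mul₀ (hsq0 i), hsq i]
  have h3 : ∀ i, ∑ j, (firstWeight (n i) j / √(n i)) • (y i j • x i j - w i) =
      √(n i) • (firstHalfAvg (x i) (y i) - w i) := by
    intro i
    simp_rw [div_eq_inv_mul, mul_smul]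
    rw [← Finset.smul_sum, ← smul_firstHalfAvg_sub _ _ _ (hn i), smul_smul, hdiv]
  have h4 : ∀ i, ∑ j, (secondWeight (n i) j / √(n i)) • (y i j • x i j - w i) =
      √(n i) • (secondHalfAvg (x i) (y i) - w i) := by
    intro i
    simp_rw [div_eq_inv_mul, mul_smul]
    rw [← Finset.smul_sum, ← smul_secondHalfAvg_sub _ _ _ (hn i), smul_smul, hdiv]
  have h5 : B * ((totalSamples n : ℝ) • diversity n α) * Bᵀ =
      ∑ i, (n i : ℝ) • vecMulVec (w i).ofLp (w i).ofLp := by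
    rw [totalSamples_smul_diversity n α hN, Matrix.mul_sum, Matrix.sum_mul]
    refine Finset.sum_congr rfl fun i _ => ?_
    rw [Matrix.mul_smul, Matrix.smul_mul, mul_vecMulVec, vecMulVec_mul, vecMul_transpose, hw]
  rw [Fintype.sum_sigma, Fintype.sum_sigma, h5, estimatorMatrix, ← Finset.sum_sub_distrib,
    transpose_sum, ← Finset.sum_add_distrib, ← Finset.sum_add_distrib]
  refine Finset.sum_congr rfl fun i _ => ?_
  simp only [h1, h2, h3, h4]
  ext a b
  simp only [Matrix.sub_apply, Matrix.add_apply, Matrix.smul_apply, transpose_apply, vecMulVec_apply, WithLp.ofLp_sub,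
    WithLp.ofLp_smul, Pi.sub_apply, Pi.smul_apply, smul_eq_mul]
  linear_combination (-(((firstHalfAvg (x i) (y i)) a - w i a) *
    ((secondHalfAvg (x i) (y i)) b - w i b))) * hsq i

end SharedRep
end

/-! ### Deviation of the linear and quadratic terms in the model -/

noncomputable section

namespace SharedRep

open Matrix
open scoped Matrix.Norms.L2Operator

variable {Ω : Type*} [MeasurableSpace Ω] {μ : Measure Ω}

/-- Linear combinations of an independent family with disjointly supported coefficients are
independent. -/
theorem indepFun_sum_smul {ι : Type*} [Fintype ι] {d : ℕ} {g : ι → Ω → EuclideanSpace ℝ (Fin d)}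
    (hind : iIndepFun g μ) (hg : ∀ j, Measurable (g j)) {a b : ι → ℝ}
    (hab : ∀ j, a j = 0 ∨ b j = 0) :
    IndepFun (fun ω => ∑ j, a j • g j ω) (fun ω => ∑ j, b j • g j ω) μ := by
  classical
  have e : ∀ (c : ι → ℝ) (ω : Ω), ∑ j, c j • g j ω =
      ∑ j : (Finset.univ.filter fun j => c j ≠ 0), c j • g j ω := by
    intro c ω
    rw [Finset.sum_coe_sort (Finset.univ.filter fun j => c j ≠ 0) fun j => c j • g j ω,
      Finset.sum_filter_of_ne]
    intro j _ hj hcj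
    exact hj (by rw [hcj, zero_smul])
  have hm : ∀ c : ι → ℝ, Measurable fun z : (Finset.univ.filter fun j => c j ≠ 0) →
      EuclideanSpace ℝ (Fin d) => ∑ j, c j.1 • z j := fun c =>
    Finset.measurable_fun_sum _ fun j _ => by
      exact (measurable_pi_apply j).const_smul (c j.1)
  have hdisj : Disjoint (Finset.univ.filter fun j => a j ≠ 0)
      (Finset.univ.filter fun j => b j ≠ 0) := by
    rw [Finset.disjoint_filter]
    intro j _ h1 h2
    exact (hab j).elim h1 h2
  have h := (hind.indepFun_finset _ _ hdisj hg).comp (hm a) (hm b)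
  rw [funext (e a), funext (e b)]
  exact h

namespace Model

variable {σ2 γ2 : ℝ≥0} {c a : ℝ} {M d k : ℕ} {n : Fin M → ℕ}
  {x : (i : Fin M) → Fin (n i) → Ω → EuclideanSpace ℝ (Fin d)}
  {y : (i : Fin M) → Fin (n i) → Ω → ℝ} {Γ : Fin M → Matrix (Fin d) (Fin d) ℝ}
  {θ : Fin M → EuclideanSpace ℝ (Fin d)} {B : Matrix (Fin d) (Fin k) ℝ}
  {α : Fin M → EuclideanSpace ℝ (Fin k)}

/-- The centered product `y x - B α` of a sample. -/
def residual (x : (i : Fin M) → Fin (n i) → Ω → EuclideanSpace ℝ (Fin d))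
    (y : (i : Fin M) → Fin (n i) → Ω → ℝ) (B : Matrix (Fin d) (Fin k) ℝ)
    (α : Fin M → EuclideanSpace ℝ (Fin k)) (p : (i : Fin M) × Fin (n i)) (ω : Ω) :
    EuclideanSpace ℝ (Fin d) :=
  y p.1 p.2 ω • x p.1 p.2 ω - WithLp.toLp 2 (B *ᵥ (α p.1).ofLp)

/-- The variance parameter of the residuals. -/
def residualVar (σ2 γ2 : ℝ≥0) (c a : ℝ) : ℝ := 8 * (2 * Real.exp 1) / modelScale σ2 γ2 c a ^ 2

theorem residualVar_nonneg (σ2 γ2 : ℝ≥0) (c a : ℝ) : 0 ≤ residualVar σ2 γ2 c a := by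
  rw [residualVar]
  positivity

theorem measurable_residual (h : Model μ σ2 γ2 c a n x y Γ θ B α)
    (p : (i : Fin M) × Fin (n i)) : Measurable (residual x y B α p) :=
  ((h.measurable_y p.1 p.2).smul (h.measurable_x p.1 p.2)).sub_const _

theorem iIndepFun_residual (h : Model μ σ2 γ2 c a n x y Γ θ B α) :
    iIndepFun (residual x y B α) μ :=
  h.indep_samples.comp (fun p z => z.2 • z.1 - WithLp.toLp 2 (B *ᵥ (α p.1).ofLp)) fun _ => by
    fun_prop

/-- The constant of the deviation bound for a linear term. -/
def crossConst (σ2 γ2 : ℝ≥0) (c a : ℝ) : ℝ :=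
  12 * ((14 + residualVar σ2 γ2 c a * (modelScale σ2 γ2 c a / 2 / (3 * |a| + 1)) ^ 2) /
    (modelScale σ2 γ2 c a / 2 / (3 * |a| + 1)))

theorem crossConst_nonneg (σ2 γ2 : ℝ≥0) (c a : ℝ) : 0 ≤ crossConst σ2 γ2 c a := by
  have := modelScale_pos σ2 γ2 c a
  have := residualVar_nonneg σ2 γ2 c a
  rw [crossConst]
  positivity

variable [IsProbabilityMeasure μ]

/-- The right factors are deterministic, so the net bound applies with a directional variance
controlled by N λ₁ rather than by a crude a² N. -/
theorem measureReal_norm_cross_le (h : Model μ σ2 γ2 c a n x y Γ θ B α) (hc : 0 < c) (hd : 1 ≤ d)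
    (hk : 0 < k) (hN : totalSamples n ≠ 0)
    (hdN : (d : ℝ) ≤ totalSamples n * diversityEigenvalue n α ⟨0, hk⟩)
    {b : (i : Fin M) × Fin (n i) → ℝ} (hb : ∀ p, |b p| ≤ 3) {L : ℝ} (hL : 1 ≤ L) :
    μ.real {ω | crossConst σ2 γ2 c a *
        √(d * (totalSamples n * diversityEigenvalue n α ⟨0, hk⟩)) * L <
      ‖∑ p, vecMulVec (residual x y B α p ω).ofLp
        (b p • WithLp.toLp 2 (B *ᵥ (α p.1).ofLp)).ofLp‖} ≤ 2 * Real.exp (-(10 * L)) := by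
  have hs := modelScale_pos σ2 γ2 c a
  -- The right factors have norm at most 3 |a|, so κ must be at most the sub-exponential range
  -- divided by 3 |a|; the + 1 covers a = 0.
  set κ := modelScale σ2 γ2 c a / 2 / (3 * |a| + 1) with hκ
  have hκ0 : 0 < κ := by positivity
  set lam₁ := diversityEigenvalue n α ⟨0, hk⟩
  have hd0 : (0 : ℝ) < d := by exact_mod_cast hd
  have hNp : (0 : ℝ) < totalSamples n := by exact_mod_cast Nat.pos_of_ne_zero hN
  have hl : 0 ≤ lam₁ := by
    by_contra! hneg
    nlinarith
  have hb2 : ∀ p, b p ^ 2 ≤ 9 := fun p => by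
    rw [← sq_abs]
    nlinarith [hb p, abs_nonneg (b p)]
  -- Weights bounded by 3 put the factor 9 into S; its root 3, times the 4 of the net bound, is the
  -- 12 in `crossConst`.
  have hmain := measureReal_norm_sum_vecMulVec_le hd h.measurable_residual h.iIndepFun_residual
    (residualVar_nonneg σ2 γ2 c a) (fun p u hu => (h.isSubExp hc p.1 p.2 u).2.2 hu)
    (fun p => b p • WithLp.toLp 2 (B *ᵥ (α p.1).ofLp)) (b := 3 * |a|) (κ := κ) ?_ hκ0 ?_
    (S := 9 * (totalSamples n * lam₁)) ?_ (by linarith) hL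
  · refine le_trans (le_of_eq ?_) hmain
    have e : √((d : ℝ) * (9 * (totalSamples n * lam₁))) = 3 * √(d * (totalSamples n * lam₁)) := by
      rw [mul_left_comm, Real.sqrt_mul (by norm_num), show (9 : ℝ) = 3 ^ 2 by norm_num,
        Real.sqrt_sq (by norm_num)]
    rw [e, crossConst, ← hκ]
    ring_nf
  · intro p
    rw [norm_smul, Real.norm_eq_abs]
    have h1 := (h.norm_signal_le p.1).trans (le_abs_self a)
    exact mul_le_mul (hb p) h1 (norm_nonneg _) (by norm_num)
  · rw [hκ, div_mul_eq_mul_div, div_le_iff₀ (by positivity)]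
    nlinarith
  · intro v hv
    calc ∑ p : (i : Fin M) × Fin (n i), (inner ℝ (b p • WithLp.toLp 2 (B *ᵥ (α p.1).ofLp)) v) ^ 2
        ≤ ∑ p : (i : Fin M) × Fin (n i),
            9 * (inner ℝ (WithLp.toLp 2 (B *ᵥ (α p.1).ofLp)) v) ^ 2 := by
          refine Finset.sum_le_sum fun p _ => ?_
          rw [real_inner_smul_left, mul_pow]
          have := hb2 p
          gcongr
      _ = 9 * ∑ i, n i * (inner ℝ (WithLp.toLp 2 (B *ᵥ (α i).ofLp)) v) ^ 2 := by
          rw [Fintype.sum_sigma, Finset.mul_sum]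
          refine Finset.sum_congr rfl fun i _ => ?_
          simp only [Finset.sum_const, Finset.card_univ, Fintype.card_fin, nsmul_eq_mul]
          ring
      _ ≤ _ := by
          have := sum_inner_signal_sq_le n α hk h.B_orthonormal hN hl hv
          gcongr

/-- The coefficients b_j / √n_i are at most 3 and their squares sum to at most 9, so the parameters
do not depend on n_i. -/
theorem isSubExp_sum_residual (h : Model μ σ2 γ2 c a n x y Γ θ B α) (hc : 0 < c) (i : Fin M)
    (hi : 2 ≤ n i) {b : Fin (n i) → ℝ} (hb : ∀ j, |b j| ≤ 3) (u : EuclideanSpace ℝ (Fin d)) :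
    ∫ ω, inner ℝ u (∑ j, (b j / √(n i)) • residual x y B α ⟨i, j⟩ ω) ∂μ = 0 ∧ (‖u‖ ≤ 1 →
      IsSubExp (fun ω => inner ℝ u (∑ j, (b j / √(n i)) • residual x y B α ⟨i, j⟩ ω))
        (9 * residualVar σ2 γ2 c a) (modelScale σ2 γ2 c a / 2 / 3) μ) := by
  have hs := modelScale_pos σ2 γ2 c a
  have hn1 : (1 : ℝ) ≤ n i := by exact_mod_cast (by omega : 1 ≤ n i)
  have hsq1 : 1 ≤ √(n i : ℝ) := Real.one_le_sqrt.2 hn1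
  simp_rw [inner_sum, real_inner_smul_right]
  have hm : ∀ (u : EuclideanSpace ℝ (Fin d)) j,
      Measurable fun ω => inner ℝ u (residual x y B α ⟨i, j⟩ ω) := fun u j => by
    have := h.measurable_residual ⟨i, j⟩
    fun_prop
  have hVnn := residualVar_nonneg σ2 γ2 c a
  constructor
  · have hint : ∀ j, Integrable (fun ω => inner ℝ u (residual x y B α ⟨i, j⟩ ω)) μ := fun j =>
      (h.isSubExp hc i j u).1
    rw [integral_finsetSum _ fun j _ => (hint j).const_mul _]
    refine Finset.sum_eq_zero fun j _ => ?_
    rw [integral_const_mul]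
    exact mul_eq_zero_of_right _ (h.isSubExp hc i j u).2.1
  · intro hu
    refine IsSubExp.sum (hm u) ?_ (fun j => (h.isSubExp hc i j u).2.2 hu) (b := 3) ?_ (by linarith)
      Finset.univ ?_
    · exact (h.iIndepFun_residual.precomp (g := Sigma.mk i) sigma_mk_injective).comp
        (fun _ z => inner ℝ u z) fun _ => by fun_prop
    · intro j
      rw [abs_div, abs_of_pos (by linarith : 0 < √(n i : ℝ)), div_le_iff₀ (by linarith)]
      nlinarith [hb j]
    · rw [mul_comm 9]
      refine mul_le_mul_of_nonneg_left ?_ hVnn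
      calc ∑ j, (b j / √(n i)) ^ 2 ≤ ∑ _j : Fin (n i), 9 / (n i : ℝ) := by
            refine Finset.sum_le_sum fun j _ => ?_
            rw [div_pow, Real.sq_sqrt (by linarith)]
            gcongr
            rw [← sq_abs]
            nlinarith [hb j, abs_nonneg (b j)]
        _ = 9 := by
            rw [Finset.sum_const, Finset.card_univ, Fintype.card_fin, nsmul_eq_mul]
            field_simp

/-- The halves of a client use disjoint samples, hence are independent, and pairs from different
clients are independent: this is the setting of the product bound. -/
theorem measureReal_norm_product_le (h : Model μ σ2 γ2 c a n x y Γ θ B α) (hc : 0 < c)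
    (hd : 1 ≤ d) (hn : ∀ i, 2 ≤ n i) {L : ℝ} (hL : 1 ≤ L) (hdL : (d : ℝ) ≤ Real.exp L)
    (hML : (M : ℝ) ≤ Real.exp L) :
    μ.real {ω | 11 * (12 / (modelScale σ2 γ2 c a / 2 / 3)) ^ 2 * √(d * (M + d)) * L ^ 3 <
      ‖∑ i, vecMulVec
        (∑ j, (firstWeight (n i) j / √(n i)) • residual x y B α ⟨i, j⟩ ω).ofLp
        (∑ j, (secondWeight (n i) j / √(n i)) • residual x y B α ⟨i, j⟩ ω).ofLp‖} ≤
      prodConst (9 * residualVar σ2 γ2 c a) (modelScale σ2 γ2 c a / 2 / 3) *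
        Real.exp (-(10 * L)) := by
  have hs := modelScale_pos σ2 γ2 c a
  have hm := h.measurable_residual
  have hmain := measureReal_norm_sum_vecMulVec_indep_le (μ := μ) hd
    (A := fun i ω => ∑ j, (firstWeight (n i) j / √(n i)) • residual x y B α ⟨i, j⟩ ω)
    (F := fun i ω => ∑ j, (secondWeight (n i) j / √(n i)) • residual x y B α ⟨i, j⟩ ω)
    (fun i => by fun_prop) (fun i => by fun_prop) ?_ ?_
    (V := 9 * residualVar σ2 γ2 c a) (τ := modelScale σ2 γ2 c a / 2 / 3) (by positivity)
    (fun i u hu => (h.isSubExp_sum_residual hc i (hn i) (abs_firstWeight_le (hn i)) u).2 hu)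
    (fun i u hu => (h.isSubExp_sum_residual hc i (hn i) (abs_secondWeight_le (hn i)) u).2 hu)
    (fun i u => (h.isSubExp_sum_residual hc i (hn i) (abs_firstWeight_le (hn i)) u).1)
    (fun i u => (h.isSubExp_sum_residual hc i (hn i) (abs_secondWeight_le (hn i)) u).1)
    hL hdL (by rwa [Fintype.card_fin])
  · rwa [Fintype.card_fin] at hmain
  · exact (iIndepFun_curry (X := fun i j => residual x y B α ⟨i, j⟩) (fun i j => hm ⟨i, j⟩)
      h.iIndepFun_residual).comp
      (fun i z => (∑ j, (firstWeight (n i) j / √(n i)) • z j,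
        ∑ j, (secondWeight (n i) j / √(n i)) • z j)) fun i => by fun_prop
  · intro i
    refine indepFun_sum_smul (h.iIndepFun_residual.precomp (g := Sigma.mk i) sigma_mk_injective)
      (fun j => hm ⟨i, j⟩) fun j => ?_
    rcases firstWeight_eq_zero_or j with h0 | h0
    · exact Or.inl (by rw [h0, zero_div])
    · exact Or.inr (by rw [h0, zero_div])

end Model

end SharedRep
end

/-! ### Assembly of the error bound -/

noncomputable section

namespace SharedRep

open Matrix
open scoped Matrix.Norms.L2Operator

/-- The constant of the deviation bound for the quadratic term. -/
def quadConst (σ2 γ2 : ℝ≥0) (c a : ℝ) : ℝ :=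
  11 * (12 / (modelScale σ2 γ2 c a / 2 / 3)) ^ 2

/-- The constant of the error bound. -/
def rateConst (σ2 γ2 : ℝ≥0) (c a : ℝ) : ℝ :=
  4 * (2 * Model.crossConst σ2 γ2 c a + quadConst σ2 γ2 c a) + 2

/-- The constant of the failure probability. -/
def failConst (σ2 γ2 : ℝ≥0) (c a : ℝ) : ℝ :=
  4 + prodConst (9 * Model.residualVar σ2 γ2 c a) (modelScale σ2 γ2 c a / 2 / 3)

variable {Ω : Type*} [MeasurableSpace Ω] {μ : Measure Ω} [IsProbabilityMeasure μ]

namespace Model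

variable {σ2 γ2 : ℝ≥0} {c a : ℝ} {M d k : ℕ} {n : Fin M → ℕ}
  {x : (i : Fin M) → Fin (n i) → Ω → EuclideanSpace ℝ (Fin d)}
  {y : (i : Fin M) → Fin (n i) → Ω → ℝ} {Γ : Fin M → Matrix (Fin d) (Fin d) ℝ}
  {θ : Fin M → EuclideanSpace ℝ (Fin d)} {B : Matrix (Fin d) (Fin k) ℝ}
  {α : Fin M → EuclideanSpace ℝ (Fin k)}

/-- Deviation of the estimator matrix from its mean, when `d ≤ N λ₁`. -/
theorem measureReal_norm_estimatorMatrix_sub_le (h : Model μ σ2 γ2 c a n x y Γ θ B α) (hc : 0 < c)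
    (hd : 1 ≤ d) (hk : 0 < k) (hn : ∀ i, 2 ≤ n i) (hN : totalSamples n ≠ 0)
    (hdN : (d : ℝ) ≤ totalSamples n * diversityEigenvalue n α ⟨0, hk⟩) {L : ℝ} (hL : 1 ≤ L)
    (hdL : (d : ℝ) ≤ Real.exp L) (hML : (M : ℝ) ≤ Real.exp L) :
    μ.real {ω | (2 * crossConst σ2 γ2 c a + quadConst σ2 γ2 c a) *
        (√(d * (totalSamples n * diversityEigenvalue n α ⟨0, hk⟩)) + √(M * d)) * L ^ 3 <
      ‖estimatorMatrix n (fun i j => x i j ω) (fun i j => y i j ω) -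
        B * ((totalSamples n : ℝ) • diversity n α) * Bᵀ‖} ≤
      failConst σ2 γ2 c a * Real.exp (-(10 * L)) := by
  set S := (totalSamples n : ℝ) * diversityEigenvalue n α ⟨0, hk⟩ with hS
  set K₁ := crossConst σ2 γ2 c a with hK₁
  set K₂ := quadConst σ2 γ2 c a with hK₂
  have hK₁0 : 0 ≤ K₁ := crossConst_nonneg σ2 γ2 c a
  have hK₂0 : 0 ≤ K₂ := by
    rw [hK₂, quadConst]
    positivity
  have h1 := h.measureReal_norm_cross_le hc hd hk hN hdN
    (b := fun p => firstWeight (n p.1) p.2) (fun p => abs_firstWeight_le (hn p.1) p.2) hL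
  have h2 := h.measureReal_norm_cross_le hc hd hk hN hdN
    (b := fun p => secondWeight (n p.1) p.2) (fun p => abs_secondWeight_le (hn p.1) p.2) hL
  have h3 := h.measureReal_norm_product_le hc hd hn hL hdL hML
  rw [← quadConst, ← hK₂] at h3
  rw [← hS, ← hK₁] at h1 h2
  have hsubset : {ω | (2 * K₁ + K₂) * (√(d * S) + √(M * d)) * L ^ 3 <
      ‖estimatorMatrix n (fun i j => x i j ω) (fun i j => y i j ω) -
        B * ((totalSamples n : ℝ) • diversity n α) * Bᵀ‖} ⊆
      ({ω | K₁ * √(d * S) * L < ‖∑ p : (i : Fin M) × Fin (n i),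
          vecMulVec (residual x y B α p ω).ofLp
            (firstWeight (n p.1) p.2 • WithLp.toLp 2 (B *ᵥ (α p.1).ofLp)).ofLp‖} ∪
        {ω | K₁ * √(d * S) * L < ‖∑ p : (i : Fin M) × Fin (n i),
          vecMulVec (residual x y B α p ω).ofLp
            (secondWeight (n p.1) p.2 • WithLp.toLp 2 (B *ᵥ (α p.1).ofLp)).ofLp‖}) ∪
      {ω | K₂ * √(d * (M + d)) * L ^ 3 < ‖∑ i, vecMulVec
        (∑ j, (firstWeight (n i) j / √(n i)) • residual x y B α ⟨i, j⟩ ω).ofLp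
        (∑ j, (secondWeight (n i) j / √(n i)) • residual x y B α ⟨i, j⟩ ω).ofLp‖} := by
    intro ω hω
    by_contra hno
    simp only [Set.mem_union, Set.mem_ofPred_eq, not_or, not_lt] at hno
    obtain ⟨⟨g1, g2⟩, g3⟩ := hno
    refine absurd ?_ (not_le.2 (show (2 * K₁ + K₂) * (√(d * S) + √(M * d)) * L ^ 3 <
      ‖estimatorMatrix n (fun i j => x i j ω) (fun i j => y i j ω) -
        B * ((totalSamples n : ℝ) • diversity n α) * Bᵀ‖ from hω))
    rw [estimatorMatrix_sub_eq hn hN _ _ B α (fun _ => rfl)]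
    refine (norm_add₃_le).trans ?_
    rw [l2_opNorm_transpose]
    refine (add_le_add (add_le_add g1 g2) g3).trans ?_
    have hL3 : L ≤ L ^ 3 := by
      calc L = L * 1 := (mul_one L).symm
        _ ≤ L * L ^ 2 := by
            gcongr
            exact one_le_pow₀ hL
        _ = L ^ 3 := by ring
    have hd0 : (0 : ℝ) ≤ d := Nat.cast_nonneg d
    have hM0 : (0 : ℝ) ≤ M := Nat.cast_nonneg M
    -- The condition d ≤ S absorbs the d² inside √(d (M + d)) into the linear term.
    have hdS : (d : ℝ) ≤ √(d * S) := by
      refine Real.le_sqrt_of_sq_le ?_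
      rw [pow_two]
      gcongr
    have hsum : √((d : ℝ) * (M + d)) ≤ √(d * S) + √(M * d) := by
      rw [Real.sqrt_le_left (by positivity)]
      have e1 : √((M : ℝ) * d) ^ 2 = M * d := Real.sq_sqrt (by positivity)
      have e2 := Real.sqrt_nonneg ((M : ℝ) * d)
      have e3 := Real.sqrt_nonneg ((d : ℝ) * S)
      nlinarith [mul_nonneg e2 e3]
    have hle : √(d * S) ≤ √(d * S) + √(M * d) := le_add_of_nonneg_right (Real.sqrt_nonneg _)
    have hL0 : 0 ≤ L := by linarith
    calc K₁ * √(d * S) * L + K₁ * √(d * S) * L + K₂ * √(d * (M + d)) * L ^ 3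
        ≤ K₁ * (√(d * S) + √(M * d)) * L ^ 3 + K₁ * (√(d * S) + √(M * d)) * L ^ 3 +
          K₂ * (√(d * S) + √(M * d)) * L ^ 3 := by gcongr
      _ = _ := by ring
  calc _ ≤ _ := measureReal_mono hsubset (measure_ne_top _ _)
    _ ≤ _ := measureReal_union_le _ _
    _ ≤ (2 * Real.exp (-(10 * L)) + 2 * Real.exp (-(10 * L))) + _ :=
        add_le_add ((measureReal_union_le _ _).trans (add_le_add h1 h2)) h3
    _ = _ := by
        rw [failConst]
        ring

/-- For d ≤ N λ₁ the deviation bound is fed into the `sin Θ` bound with gap N λ_k; for d > N λ₁ the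
asserted bound is at least 2 and the bad event is empty. -/
theorem measureReal_sinTheta_le (h : Model μ σ2 γ2 c a n x y Γ θ B α) (hc : 0 < c)
    (hk : 0 < k) (hkd : k ≤ d) (hn : ∀ i, 2 ≤ n i) {N lam₁ lamk : ℝ}
    (hN : N = (totalSamples n : ℝ)) (hlam₁ : lam₁ = diversityEigenvalue n α ⟨0, hk⟩)
    (hlamk : lamk = diversityEigenvalue n α ⟨k - 1, Nat.sub_lt hk Nat.one_pos⟩)
    (hpos : 0 < lamk) {W : Ω → Matrix (Fin d) (Fin k) ℝ}
    (hW : ∀ ω, IsTopSingular hkd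
      (estimatorMatrix n (fun i j => x i j ω) (fun i j => y i j ω)) (W ω)) :
    μ.real {ω | ¬ sinTheta (W ω) B ≤ rateConst σ2 γ2 c a *
        ((√(d * lam₁ / (N * lamk ^ 2)) + √(M * d / (N ^ 2 * lamk ^ 2))) *
          Real.log (d + N) ^ 3)} ≤
      failConst σ2 γ2 c a / (d + N) ^ 10 := by
  have hd : 1 ≤ d := hk.trans_le hkd
  have hd1 : (1 : ℝ) ≤ d := by exact_mod_cast hd
  have hN0 : totalSamples n ≠ 0 := totalSamples_ne_zero n α hk (hlamk ▸ hpos)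
  have hMN : 2 * M ≤ totalSamples n := by
    calc 2 * M = ∑ _i : Fin M, 2 := by simp [mul_comm]
      _ ≤ _ := Finset.sum_le_sum fun i _ => hn i
  have hN2 : 2 ≤ totalSamples n := by
    have : M ≠ 0 := by
      rintro rfl
      exact hN0 (by simp [totalSamples])
    omega
  have hN2' : (2 : ℝ) ≤ N := by
    rw [hN]
    exact_mod_cast hN2
  have hMN' : (M : ℝ) ≤ N := by
    rw [hN]
    exact_mod_cast (by omega : M ≤ totalSamples n)
  have hNp : 0 < N := by linarith
  have hsum : 0 < d + N := by linarith
  have hle : lamk ≤ lam₁ := by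
    rw [hlamk, hlam₁]
    exact diversityEigenvalue_last_le_first n α hk
  have hl1 : 0 < lam₁ := hpos.trans_le hle
  -- With this L, e^L = d + N dominates both d and M, and e^(-10 L) is the required probability. L ≥
  -- 1 because d + N ≥ 3 > e.
  set L := Real.log (d + N) with hLdef
  have hexp : Real.exp L = d + N := Real.exp_log hsum
  have hL : 1 ≤ L := by
    rw [hLdef, Real.le_log_iff_exp_le hsum]
    linarith [Real.exp_one_lt_three]
  have hL3 : 1 ≤ L ^ 3 := one_le_pow₀ hL
  set K := 2 * crossConst σ2 γ2 c a + quadConst σ2 γ2 c a with hK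
  have hK0 : 0 ≤ K := by
    have := crossConst_nonneg σ2 γ2 c a
    rw [hK, quadConst]
    positivity
  have hfail : failConst σ2 γ2 c a * Real.exp (-(10 * L)) = failConst σ2 γ2 c a / (d + N) ^ 10 := by
    rw [Real.exp_neg, show 10 * L = ((10 : ℕ) : ℝ) * L by norm_num, Real.exp_nat_mul, hexp,
      div_eq_mul_inv]
  have hq1 : √(d * lam₁ / (N * lamk ^ 2)) = √(d * (N * lam₁)) / (N * lamk) := by
    rw [show d * lam₁ / (N * lamk ^ 2) = d * (N * lam₁) / (N * lamk) ^ 2 by field_simp,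
      Real.sqrt_div' _ (by positivity), Real.sqrt_sq (by positivity)]
  have hq2 : √(M * d / (N ^ 2 * lamk ^ 2)) = √(M * d) / (N * lamk) := by
    rw [← mul_pow, Real.sqrt_div' _ (by positivity), Real.sqrt_sq (by positivity)]
  rcases le_or_gt (d : ℝ) (N * lam₁) with hdN | hdN
  · have hmain := h.measureReal_norm_estimatorMatrix_sub_le hc hd hk hn hN0
      (by rwa [← hN, ← hlam₁]) hL (by rw [hexp]; linarith) (by rw [hexp]; linarith)
    rw [← hN, ← hlam₁, hfail] at hmain
    -- `W` is an arbitrary selection, possibly not measurable; monotonicity of the outer measure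
    -- replaces its bad event by one about Z alone.
    refine (measureReal_mono (fun ω hω => ?_) (measure_ne_top _ _)).trans hmain
    by_contra hno
    rw [Set.mem_ofPred_eq, not_lt] at hno
    refine hω ?_
    have hDt : (N • diversity n α)ᵀ = N • diversity n α := by
      rw [transpose_smul]
      congr 1
      exact diversity_isHermitian n α
    have hs := sinTheta_le hk hkd h.B_orthonormal hDt (lam := N * lamk) (by positivity)
      (fun z => ?_) (hW ω)
    · refine hs.trans ?_
      rw [hq1, hq2, ← add_div, div_le_iff₀ (by positivity)]
      calc _ ≤ 4 * (K * (√(d * (N * lam₁)) + √(M * d)) * L ^ 3) := by gcongr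
        _ = 4 * K * ((√(d * (N * lam₁)) + √(M * d)) * L ^ 3) := by ring
        _ ≤ rateConst σ2 γ2 c a * ((√(d * (N * lam₁)) + √(M * d)) * L ^ 3) := by
            rw [rateConst]
            gcongr
            linarith
        _ = _ := by field_simp
    · rw [smul_mulVec, WithLp.toLp_smul, norm_smul, Real.norm_of_nonneg hNp.le, mul_assoc]
      have := le_norm_diversity_mulVec n α hk (hlamk ▸ hpos.le) (WithLp.toLp 2 z)
      rw [← hlamk] at this
      gcongr
  -- Here N λ_k² ≤ N λ₁² < d λ₁, so the first root is at least 1; the summand 2 in `rateConst` then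
  -- covers the trivial bound.
  · have hempty : {ω | ¬ sinTheta (W ω) B ≤ rateConst σ2 γ2 c a *
        ((√(d * lam₁ / (N * lamk ^ 2)) + √(M * d / (N ^ 2 * lamk ^ 2))) * L ^ 3)} = ∅ := by
      refine Set.eq_empty_of_forall_notMem fun ω hω => hω ?_
      refine (sinTheta_le_two h.B_orthonormal (hW ω).orthonormal).trans ?_
      have h1 : 1 ≤ √(d * lam₁ / (N * lamk ^ 2)) := by
        rw [Real.one_le_sqrt, one_le_div (by positivity)]
        calc N * lamk ^ 2 ≤ N * lam₁ ^ 2 := by gcongr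
          _ = (N * lam₁) * lam₁ := by ring
          _ ≤ d * lam₁ := by gcongr
      have h2 : 1 ≤ (√(d * lam₁ / (N * lamk ^ 2)) + √(M * d / (N ^ 2 * lamk ^ 2))) * L ^ 3 :=
        one_le_mul_of_one_le_of_one_le (h1.trans (le_add_of_nonneg_right (Real.sqrt_nonneg _))) hL3
      have h3 : 2 ≤ rateConst σ2 γ2 c a := by
        rw [rateConst]
        linarith
      calc (2 : ℝ) = 2 * 1 := by norm_num
        _ ≤ _ := by gcongr
    rw [hempty, measureReal_empty, failConst]
    have := prodConst_pos (9 * residualVar σ2 γ2 c a) (modelScale σ2 γ2 c a / 2 / 3)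
    positivity

end Model

theorem rateConst_pos (σ2 γ2 : ℝ≥0) (c a : ℝ) : 0 < rateConst σ2 γ2 c a := by
  have := Model.crossConst_nonneg σ2 γ2 c a
  rw [rateConst, quadConst]
  positivity

theorem failConst_pos (σ2 γ2 : ℝ≥0) (c a : ℝ) : 0 < failConst σ2 γ2 c a := by
  have := prodConst_pos (9 * Model.residualVar σ2 γ2 c a) (modelScale σ2 γ2 c a / 2 / 3)
  rw [failConst]
  positivity

end SharedRep
end

theorem mainTheorem1 (σ2 γ2 : ℝ≥0) (c a : ℝ) (hc : 0 < c) :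
    ∃ C₁ C₂ : ℝ, 0 < C₁ ∧ 0 < C₂ ∧
      ∀ (M d k : ℕ) (hk : 0 < k) (hkd : k ≤ d) (n : Fin M → ℕ) (_hn : ∀ i, 2 ≤ n i)
        (Ω : Type*) [MeasurableSpace Ω] (μ : Measure Ω) [IsProbabilityMeasure μ]
        (x : (i : Fin M) → Fin (n i) → Ω → EuclideanSpace ℝ (Fin d))
        (y : (i : Fin M) → Fin (n i) → Ω → ℝ)
        (Γ : Fin M → Matrix (Fin d) (Fin d) ℝ) (θ : Fin M → EuclideanSpace ℝ (Fin d))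
        (B : Matrix (Fin d) (Fin k) ℝ) (α : Fin M → EuclideanSpace ℝ (Fin k))
        (_hmodel : SharedRep.Model μ σ2 γ2 c a n x y Γ θ B α)
        (N lam₁ lamk : ℝ) (_hN : N = (SharedRep.totalSamples n : ℝ))
        (_hlam₁ : lam₁ = SharedRep.diversityEigenvalue n α ⟨0, hk⟩)
        (_hlamk : lamk = SharedRep.diversityEigenvalue n α ⟨k - 1, Nat.sub_lt hk Nat.one_pos⟩)
        (_hpos : 0 < lamk)
        (Bhat : Ω → Matrix (Fin d) (Fin k) ℝ)
        (_hBhat : ∀ ω, SharedRep.IsTopSingular hkd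
          (SharedRep.estimatorMatrix n (fun i j => x i j ω) (fun i j => y i j ω)) (Bhat ω)),
        μ.real {ω | ¬ SharedRep.sinTheta (Bhat ω) B ≤
            C₁ * ((Real.sqrt (d * lam₁ / (N * lamk ^ 2)) +
              Real.sqrt (M * d / (N ^ 2 * lamk ^ 2))) * Real.log (d + N) ^ 3)}
          ≤ C₂ / (d + N) ^ 10 := by
  refine ⟨SharedRep.rateConst σ2 γ2 c a, SharedRep.failConst σ2 γ2 c a,
    SharedRep.rateConst_pos σ2 γ2 c a, SharedRep.failConst_pos σ2 γ2 c a, ?_⟩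
  intro M d k hk hkd n hn Ω _ μ _ x y Γ θ B α h N lam₁ lamk hN hlam₁ hlamk hpos Bhat hBhat
  exact h.measureReal_sinTheta_le hc hk hkd hn hN hlam₁ hlamk hpos hBhat
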